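/- Let $A$ be a separable $C^*$-algebra, $G$ a second countable, compact (Hausdorff) group with normalized Haar measure $\mu$, and $\alpha: G\curvearrowright A$ a point-norm continuous action by $*$-automorphisms. Notation. For a $C^*$-algebra $B$ let $B_\infty=\ell^\infty(\mathbb N,B)/\{(b_n)_n : \lim_{n\to\infty}\|b_n\|=0\}$, into which $B$ embeds canonically as constant sequences. A $*$-homomorphism $\varphi: B\to C$ of $C^*$-algebras is called sequentially split if there is a $*$-homomorphism $\psi: C\to B_\infty$ such that $\psi\circ\varphi$ is the canonical embedding $B\hookrightarrow B_\infty$. Let $F_\infty(A)=(A_\infty\cap A')/\{x\in A_\infty : xa=ax=0 \text{ for all } a\in A\}$, a unital $C^*$-algebra on which $G$ acts by $\tilde\alpha_\infty$, the action induced by applying $\alpha$ componentwise to sequences, and let $F_{\infty,\alpha}(A)\subset F_\infty(A)$ be the $C^*$-subalgebra of those $x$ for which $g\mapsto\tilde\alpha_{\infty,g}(x)$ is norm-continuous. Let $\sigma: G\curvearrowright C(G)$ be the shift $\sigma_g(f)=f(g^{-1}\,\cdot\,)$. The action $\alpha$ has the Rokhlin property if there is a unital, equivariant $*$-homomorphism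 $(C(G),\sigma)\to(F_{\infty,\alpha}(A),\tilde\alpha_\infty)$. Assume that $\alpha$ has the Rokhlin property. Then: (i) The inclusion map $A^\alpha\hookrightarrow A$ of the fixed point algebra is sequentially split. (ii) Identify $C(G)\otimes A$ with $C(G,A)$, with the action $(\sigma\otimes\alpha)_g(f)(t)=\alpha_g(f(g^{-1}t))$. There is a unique $*$-isomorphism $\Phi: (C(G)\otimes A)\rtimes_{\sigma\otimes\alpha}G\to A\otimes\mathcal K(L^2(G))$ which, for all $a\in A$ and $\xi,\eta\in C(G)$, sends the function $s\mapsto\big(t\mapsto\xi(t)\overline{\eta(s^{-1}t)}\,\alpha_t(a)\big)$ in $C(G,C(G,A))$ to $a\otimes|\xi\rangle\langle\eta|$, where $|\xi\rangle\langle\eta|$ is the operator $\zeta\mapsto\langle\eta,\zeta\rangle\,\xi$, with $\langle\eta,\zeta\rangle=\int_G\overline{\eta}\,\zeta\,d\mu$. The canonical embedding $$A\rtimes_\alpha G\to (C(G)\otimes A)\rtimes_{\sigma\otimes\alpha}G\xrightarrow{\ \Phi\ }A\otimes\mathcal K(L^2(G)),$$ whose first map is induced by the equivariant second-factor embedding $A\to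 C(G)\otimes A$, $a\mapsto \mathbf 1\otimes a$, is sequentially split. -/

import Mathlib

noncomputable section

namespace RokhlinSplit

open scoped ENNReal TensorProduct
open MeasureTheory Topology

set_option linter.unusedSectionVars false

/-! ### Quotients by two-sided `*`-ideals -/

section Quotients

/-- A two-sided self-adjoint ideal of a complex `*`-algebra. -/
structure StarIdeal (X : Type*) [NonUnitalRing X] [StarRing X] [Module ℂ X] extends
    Submodule ℂ X where
  mul_mem_left' : ∀ x y, y ∈ carrier → x * y ∈ carrier
  mul_mem_right' : ∀ x y, x ∈ carrier → x * y ∈ carrier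
  star_mem' : ∀ x, x ∈ carrier → star x ∈ carrier

variable {X : Type*} [NonUnitalSeminormedRing X] [StarRing X] [NormedSpace ℂ X]

/-- The quotient `X / I`, with the quotient norm. -/
def StarIdeal.Quotient (I : StarIdeal X) : Type _ := X ⧸ I.toSubmodule

namespace StarIdeal.Quotient

variable (I : StarIdeal X)

instance : SeminormedAddCommGroup I.Quotient :=
  inferInstanceAs (SeminormedAddCommGroup (X ⧸ I.toSubmodule))

instance : NormedSpace ℂ I.Quotient :=
  inferInstanceAs (NormedSpace ℂ (X ⧸ I.toSubmodule))

variable {I} in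
/-- The class of an element. -/
def mk (x : X) : I.Quotient := Submodule.Quotient.mk (p := I.toSubmodule) x

variable {I}

theorem mk_surjective : Function.Surjective (mk : X → I.Quotient) :=
  Submodule.Quotient.mk_surjective _

theorem mk_eq_mk {x y : X} : (mk x : I.Quotient) = mk y ↔ x - y ∈ I.toSubmodule :=
  Submodule.Quotient.eq _

theorem mk_add (x y : X) : (mk (x + y) : I.Quotient) = mk x + mk y := rfl

theorem mk_zero : (mk 0 : I.Quotient) = 0 := rfl

theorem mk_smul (c : ℂ) (x : X) : (mk (c • x) : I.Quotient) = c • mk x := rfl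

instance : Mul I.Quotient where
  mul := Quotient.map₂ (· * ·) (by
    intro x x' hx y y' hy
    have hx' : x - x' ∈ I.toSubmodule := (Submodule.quotientRel_def _).1 hx
    have hy' : y - y' ∈ I.toSubmodule := (Submodule.quotientRel_def _).1 hy
    refine (Submodule.quotientRel_def _).2 ?_
    have h : x * y - x' * y' = (x - x') * y + x' * (y - y') := by noncomm_ring
    rw [h]
    exact I.add_mem (I.mul_mem_right' _ _ hx') (I.mul_mem_left' _ _ hy'))

theorem mk_mul (x y : X) : (mk (x * y) : I.Quotient) = mk x * mk y := rfl

instance : Star I.Quotient where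
  star := Quotient.map star (by
    intro x x' hx
    have hx' : x - x' ∈ I.toSubmodule := (Submodule.quotientRel_def _).1 hx
    refine (Submodule.quotientRel_def _).2 ?_
    rw [← star_sub]
    exact I.star_mem' _ hx')

theorem mk_star (x : X) : (mk (star x) : I.Quotient) = star (mk x) := rfl

theorem norm_mk_le (x : X) : ‖(mk x : I.Quotient)‖ ≤ ‖x‖ :=
  Submodule.Quotient.norm_mk_le _ x

theorem exists_norm_lt (x : I.Quotient) {ε : ℝ} (hε : 0 < ε) :
    ∃ y : X, mk y = x ∧ ‖y‖ < ‖x‖ + ε :=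
  Submodule.Quotient.norm_mk_lt (S := I.toSubmodule) x hε

instance : NonUnitalRing I.Quotient where
  __ : AddCommGroup I.Quotient := inferInstance
  left_distrib x y z := by
    obtain ⟨x, rfl⟩ := mk_surjective x
    obtain ⟨y, rfl⟩ := mk_surjective y
    obtain ⟨z, rfl⟩ := mk_surjective z
    simp only [← mk_add, ← mk_mul, mul_add]
  right_distrib x y z := by
    obtain ⟨x, rfl⟩ := mk_surjective x
    obtain ⟨y, rfl⟩ := mk_surjective y
    obtain ⟨z, rfl⟩ := mk_surjective z
    simp only [← mk_add, ← mk_mul, add_mul]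
  zero_mul x := by
    obtain ⟨x, rfl⟩ := mk_surjective x
    simp only [← mk_zero, ← mk_mul, zero_mul]
  mul_zero x := by
    obtain ⟨x, rfl⟩ := mk_surjective x
    simp only [← mk_zero, ← mk_mul, mul_zero]
  mul_assoc x y z := by
    obtain ⟨x, rfl⟩ := mk_surjective x
    obtain ⟨y, rfl⟩ := mk_surjective y
    obtain ⟨z, rfl⟩ := mk_surjective z
    simp only [← mk_mul, mul_assoc]

theorem norm_mul_le_aux (x y : I.Quotient) : ‖x * y‖ ≤ ‖x‖ * ‖y‖ := by
  refine le_of_forall_gt fun c hc => ?_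
  have hcont : Filter.Tendsto (fun ε : ℝ => (‖x‖ + ε) * (‖y‖ + ε)) (𝓝[>] 0)
      (𝓝 (‖x‖ * ‖y‖)) := by
    have h : Continuous fun ε : ℝ => (‖x‖ + ε) * (‖y‖ + ε) := by fun_prop
    have h0 := h.tendsto 0
    simp only [add_zero] at h0
    exact h0.mono_left nhdsWithin_le_nhds
  obtain ⟨ε, hε, hpos⟩ :=
    ((hcont.eventually (gt_mem_nhds hc)).and self_mem_nhdsWithin).exists
  obtain ⟨x', rfl, hx'⟩ := exists_norm_lt x hpos
  obtain ⟨y', rfl, hy'⟩ := exists_norm_lt y hpos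
  calc ‖(mk x' * mk y' : I.Quotient)‖ ≤ ‖x' * y'‖ := by rw [← mk_mul]; exact norm_mk_le _
    _ ≤ ‖x'‖ * ‖y'‖ := norm_mul_le _ _
    _ ≤ _ := mul_le_mul hx'.le hy'.le (norm_nonneg _)
        ((norm_nonneg _).trans hx'.le)
    _ < c := hε

instance : NonUnitalSeminormedRing I.Quotient :=
  { (inferInstance : SeminormedAddCommGroup I.Quotient),
    (inferInstance : NonUnitalRing I.Quotient) with
    norm_mul_le := norm_mul_le_aux }

instance : StarRing I.Quotient where
  star_involutive x := by
    obtain ⟨x, rfl⟩ := mk_surjective x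
    simp only [← mk_star, star_star]
  star_mul x y := by
    obtain ⟨x, rfl⟩ := mk_surjective x
    obtain ⟨y, rfl⟩ := mk_surjective y
    simp only [← mk_star, ← mk_mul, star_mul]
  star_add x y := by
    obtain ⟨x, rfl⟩ := mk_surjective x
    obtain ⟨y, rfl⟩ := mk_surjective y
    simp only [← mk_star, ← mk_add, star_add]

instance [IsScalarTower ℂ X X] : IsScalarTower ℂ I.Quotient I.Quotient where
  smul_assoc c x y := by
    obtain ⟨x, rfl⟩ := mk_surjective x
    obtain ⟨y, rfl⟩ := mk_surjective y
    simp only [← mk_smul, ← mk_mul, smul_eq_mul, smul_mul_assoc]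

instance [SMulCommClass ℂ X X] : SMulCommClass ℂ I.Quotient I.Quotient where
  smul_comm c x y := by
    obtain ⟨x, rfl⟩ := mk_surjective x
    obtain ⟨y, rfl⟩ := mk_surjective y
    simp only [← mk_smul, ← mk_mul, smul_eq_mul, mul_smul_comm]

instance [StarModule ℂ X] : StarModule ℂ I.Quotient where
  star_smul c x := by
    obtain ⟨x, rfl⟩ := mk_surjective x
    simp only [← mk_smul, ← mk_star, star_smul]

instance [NormedStarGroup X] : NormedStarGroup I.Quotient where
  norm_star_le x := by
    refine le_of_forall_pos_lt_add fun ε hε => ?_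
    obtain ⟨x', rfl, hx'⟩ := exists_norm_lt x hε
    calc ‖star (mk x' : I.Quotient)‖ ≤ ‖star x'‖ := by rw [← mk_star]; exact norm_mk_le _
      _ = ‖x'‖ := norm_star _
      _ < _ := hx'

/-- The quotient map as a `*`-homomorphism. -/
def mkHom (I : StarIdeal X) : X →⋆ₙₐ[ℂ] I.Quotient where
  toFun := mk
  map_smul' _ _ := rfl
  map_zero' := rfl
  map_add' _ _ := rfl
  map_mul' _ _ := rfl
  map_star' _ := rfl

section Map

variable {Y : Type*} [NonUnitalSeminormedRing Y] [StarRing Y] [NormedSpace ℂ Y]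
  {J : StarIdeal Y}

/-- The map between quotients induced by a `*`-homomorphism that respects the ideals. -/
def mapFun (θ : X →⋆ₙₐ[ℂ] Y) (h : ∀ x ∈ I.toSubmodule, θ x ∈ J.toSubmodule) :
    I.Quotient → J.Quotient :=
  Quotient.map θ (by
    intro x x' hx
    have hx' : x - x' ∈ I.toSubmodule := (Submodule.quotientRel_def _).1 hx
    refine (Submodule.quotientRel_def _).2 ?_
    rw [← map_sub]
    exact h _ hx')

theorem mapFun_mk (θ : X →⋆ₙₐ[ℂ] Y) (h : ∀ x ∈ I.toSubmodule, θ x ∈ J.toSubmodule) (x : X) :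
    mapFun θ h (mk x : I.Quotient) = mk (θ x) := rfl

/-- The `*`-homomorphism between quotients induced by a `*`-homomorphism that respects the
ideals. -/
def map (θ : X →⋆ₙₐ[ℂ] Y) (h : ∀ x ∈ I.toSubmodule, θ x ∈ J.toSubmodule) :
    I.Quotient →⋆ₙₐ[ℂ] J.Quotient where
  toFun := mapFun θ h
  map_smul' c x := by
    obtain ⟨x, rfl⟩ := mk_surjective x
    simp only [MonoidHom.id_apply, ← mk_smul, mapFun_mk, map_smul]
  map_zero' := by
    rw [← mk_zero, mapFun_mk, map_zero, mk_zero]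
  map_add' x y := by
    obtain ⟨x, rfl⟩ := mk_surjective x
    obtain ⟨y, rfl⟩ := mk_surjective y
    simp only [← mk_add, mapFun_mk, map_add]
  map_mul' x y := by
    obtain ⟨x, rfl⟩ := mk_surjective x
    obtain ⟨y, rfl⟩ := mk_surjective y
    simp only [← mk_mul, mapFun_mk, map_mul]
  map_star' x := by
    obtain ⟨x, rfl⟩ := mk_surjective x
    simp only [← mk_star, mapFun_mk, map_star]

theorem map_mk (θ : X →⋆ₙₐ[ℂ] Y) (h : ∀ x ∈ I.toSubmodule, θ x ∈ J.toSubmodule) (x : X) :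
    map θ h (mk x : I.Quotient) = mk (θ x) := rfl

end Map

end StarIdeal.Quotient

end Quotients

/-! ### Sequence algebras and sequentially split `*`-homomorphisms -/

section SequenceAlgebra

variable (A : Type*) [NonUnitalCStarAlgebra A]

/-- The ideal of null sequences in the `C*`-algebra of bounded sequences in `A`. -/
def nullSequences : StarIdeal (lp (fun _ : ℕ => A) ∞) where
  carrier := {x | Filter.Tendsto (fun n => ‖x n‖) Filter.atTop (𝓝 0)}
  zero_mem' := by simp
  add_mem' {x y} hx hy := by
    have h := Filter.Tendsto.add hx hy
    rw [add_zero] at h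
    exact squeeze_zero (fun n => norm_nonneg _) (fun n => norm_add_le (x n) (y n)) h
  smul_mem' c x hx := by
    have h := Filter.Tendsto.const_mul ‖c‖ hx
    rw [mul_zero] at h
    exact squeeze_zero (fun n => norm_nonneg _) (fun n => (norm_smul c (x n)).le) h
  mul_mem_left' x y hy := by
    have h := Filter.Tendsto.const_mul ‖x‖ hy
    rw [mul_zero] at h
    refine squeeze_zero (fun n => norm_nonneg _) (fun n => ?_) h
    exact (norm_mul_le (x n) (y n)).trans
      (mul_le_mul_of_nonneg_right (lp.norm_apply_le_norm ENNReal.top_ne_zero x n) (norm_nonneg _))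
  mul_mem_right' x y hx := by
    have h := Filter.Tendsto.mul_const ‖y‖ hx
    rw [zero_mul] at h
    refine squeeze_zero (fun n => norm_nonneg _) (fun n => ?_) h
    exact (norm_mul_le (x n) (y n)).trans
      (mul_le_mul_of_nonneg_left (lp.norm_apply_le_norm ENNReal.top_ne_zero y n) (norm_nonneg _))
  star_mem' x hx := by
    refine squeeze_zero (fun n => norm_nonneg _) (fun n => ?_) hx
    exact (norm_star (x n)).le

/-- The sequence algebra `A_∞ = ℓ^∞(ℕ, A) / c₀(ℕ, A)`. -/
abbrev SeqAlgebra : Type _ := (nullSequences A).Quotient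

/-- Constant sequences. -/
def constSeq : A →⋆ₙₐ[ℂ] lp (fun _ : ℕ => A) ∞ where
  toFun a := ⟨fun _ => a, memℓp_infty ⟨‖a‖, by rintro _ ⟨i, rfl⟩; exact le_rfl⟩⟩
  map_smul' _ _ := rfl
  map_zero' := rfl
  map_add' _ _ := rfl
  map_mul' _ _ := rfl
  map_star' _ := rfl

/-- The canonical inclusion `A → A_∞` as (classes of) constant sequences. -/
def toSeqAlgebra : A →⋆ₙₐ[ℂ] SeqAlgebra A :=
  (StarIdeal.Quotient.mkHom (nullSequences A)).comp (constSeq A)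

variable {A} {B : Type*} [NonUnitalCStarAlgebra B]

/-- A `*`-homomorphism `φ : A → B` is sequentially split if there is a `*`-homomorphism
`ψ : B → A_∞` such that `ψ ∘ φ` is the canonical inclusion `A → A_∞`. -/
def SequentiallySplit (φ : A →⋆ₙₐ[ℂ] B) : Prop :=
  ∃ ψ : B →⋆ₙₐ[ℂ] SeqAlgebra A, ψ.comp φ = toSeqAlgebra A

/-- Componentwise application of a `*`-homomorphism to bounded sequences. -/
def seqMap (θ : A →⋆ₙₐ[ℂ] B) : lp (fun _ : ℕ => A) ∞ →⋆ₙₐ[ℂ] lp (fun _ : ℕ => B) ∞ where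
  toFun x := ⟨fun n => θ (x n), memℓp_infty ⟨‖x‖, by
    rintro _ ⟨n, rfl⟩
    exact (NonUnitalStarAlgHom.norm_apply_le θ (x n)).trans
      (lp.norm_apply_le_norm ENNReal.top_ne_zero x n)⟩⟩
  map_smul' c x := lp.ext (funext fun n => map_smul θ c (x n))
  map_zero' := lp.ext (funext fun _ => map_zero θ)
  map_add' x y := lp.ext (funext fun n => map_add θ (x n) (y n))
  map_mul' x y := lp.ext (funext fun n => map_mul θ (x n) (y n))
  map_star' x := lp.ext (funext fun n => map_star θ (x n))

/-- The `*`-homomorphism `A_∞ → B_∞` induced by componentwise application. -/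
def SeqAlgebra.map (θ : A →⋆ₙₐ[ℂ] B) : SeqAlgebra A →⋆ₙₐ[ℂ] SeqAlgebra B :=
  StarIdeal.Quotient.map (seqMap θ) fun x hx =>
    squeeze_zero (fun _ => norm_nonneg _)
      (fun n => NonUnitalStarAlgHom.norm_apply_le θ (x n)) hx

theorem SeqAlgebra.map_toSeqAlgebra (θ : A →⋆ₙₐ[ℂ] B) (a : A) :
    SeqAlgebra.map θ (toSeqAlgebra A a) = toSeqAlgebra B (θ a) := rfl

variable (A)

/-- The relative commutant `A_∞ ∩ A'`. -/
def relCommutant : NonUnitalStarSubalgebra ℂ (SeqAlgebra A) :=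
  NonUnitalStarSubalgebra.centralizer ℂ (Set.range (toSeqAlgebra A))

instance : NormedStarGroup (relCommutant A) where
  norm_star_le x := (norm_star (x : SeqAlgebra A)).le

/-- The two-sided annihilator `Ann(A, A_∞)` as an ideal of `A_∞ ∩ A'`. -/
def annihilator : StarIdeal (relCommutant A) where
  carrier := {x | ∀ a : A, (x : SeqAlgebra A) * toSeqAlgebra A a = 0 ∧
    toSeqAlgebra A a * (x : SeqAlgebra A) = 0}
  zero_mem' a := by simp
  add_mem' {x y} hx hy a := by
    simp [add_mul, mul_add, (hx a).1, (hx a).2, (hy a).1, (hy a).2]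
  smul_mem' c x hx a := by
    simp [smul_mul_assoc, mul_smul_comm, (hx a).1, (hx a).2]
  mul_mem_left' x y hy a := by
    have hx := ((NonUnitalStarSubalgebra.mem_centralizer_iff ℂ).1 x.2 _ ⟨a, rfl⟩).1
    refine ⟨?_, ?_⟩
    · simp [mul_assoc, (hy a).1]
    · rw [NonUnitalStarSubalgebra.coe_mul, ← mul_assoc, hx, mul_assoc, (hy a).2, mul_zero]
  mul_mem_right' x y hx a := by
    have hy := ((NonUnitalStarSubalgebra.mem_centralizer_iff ℂ).1 y.2 _ ⟨a, rfl⟩).1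
    refine ⟨?_, ?_⟩
    · rw [NonUnitalStarSubalgebra.coe_mul, mul_assoc, ← hy, ← mul_assoc, (hx a).1, zero_mul]
    · rw [NonUnitalStarSubalgebra.coe_mul, ← mul_assoc, (hx a).2, zero_mul]
  star_mem' x hx a := by
    refine ⟨?_, ?_⟩
    · have h := congrArg star (hx (star a)).2
      rwa [star_mul, ← map_star, star_star, star_zero] at h
    · have h := congrArg star (hx (star a)).1
      rwa [star_mul, ← map_star, star_star, star_zero] at h

/-- The central sequence algebra `F_∞(A) = (A_∞ ∩ A') / Ann(A, A_∞)`. -/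
abbrev CentralSeqAlgebra : Type _ := (annihilator A).Quotient

end SequenceAlgebra

/-! ### Actions and the Rokhlin property -/

/-- A point-norm continuous action of a topological group on a `C*`-algebra. -/
structure CStarAction (G A : Type*) [Group G] [TopologicalSpace G] [NonUnitalCStarAlgebra A] where
  /-- The action by `*`-automorphisms. -/
  toMonoidHom : G →* (A ≃⋆ₐ[ℂ] A)
  continuous_apply' : ∀ a : A, Continuous fun g => toMonoidHom g a

namespace CStarAction

variable {G A : Type*} [Group G] [TopologicalSpace G] [NonUnitalCStarAlgebra A]
  (α : CStarAction G A)

/-- The `*`-automorphism `α_g`, as a `*`-homomorphism. -/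
def aut (g : G) : A →⋆ₙₐ[ℂ] A := (α.toMonoidHom g : A →⋆ₙₐ[ℂ] A)

theorem aut_mul (g h : G) (a : A) : α.aut (g * h) a = α.aut g (α.aut h a) := by
  simp [aut, map_mul]

theorem aut_one (a : A) : α.aut 1 a = a := by
  simp [aut]

theorem norm_aut (g : G) (a : A) : ‖α.aut g a‖ = ‖a‖ :=
  StarAlgEquiv.norm_map (α.toMonoidHom g) a

theorem continuous_aut (a : A) : Continuous fun g => α.aut g a := α.continuous_apply' a

theorem continuous_aut_uncurry : Continuous fun p : G × A => α.aut p.1 p.2 := by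
  rw [continuous_iff_continuousAt]
  rintro ⟨g, a⟩
  rw [ContinuousAt, tendsto_iff_norm_sub_tendsto_zero]
  have h1 : Filter.Tendsto (fun p : G × A => ‖p.2 - a‖ + ‖α.aut p.1 a - α.aut g a‖)
      (𝓝 (g, a)) (𝓝 0) := by
    have hc : Continuous fun p : G × A => ‖p.2 - a‖ + ‖α.aut p.1 a - α.aut g a‖ := by
      have := (α.continuous_aut a).comp (continuous_fst (X := G) (Y := A))
      exact ((continuous_snd.sub continuous_const).norm).add ((this.sub continuous_const).norm)
    simpa using hc.tendsto (g, a)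
  refine squeeze_zero (fun p => norm_nonneg _) (fun p => ?_) h1
  calc ‖α.aut p.1 p.2 - α.aut g a‖
      = ‖α.aut p.1 (p.2 - a) + (α.aut p.1 a - α.aut g a)‖ := by rw [map_sub]; abel_nf
    _ ≤ ‖α.aut p.1 (p.2 - a)‖ + ‖α.aut p.1 a - α.aut g a‖ := norm_add_le _ _
    _ = _ := by rw [norm_aut]

theorem continuous_aut_comp {Y : Type*} [TopologicalSpace Y]
    {u : Y → G} {v : Y → A} (hu : Continuous u) (hv : Continuous v) :
    Continuous fun y => α.aut (u y) (v y) := α.continuous_aut_uncurry.comp (hu.prodMk hv)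

/-- The fixed point algebra `A^α`. -/
def fixedPoints : NonUnitalStarSubalgebra ℂ A where
  carrier := {a | ∀ g, α.aut g a = a}
  zero_mem' g := map_zero _
  add_mem' ha hb g := by rw [map_add, ha g, hb g]
  smul_mem' c a ha g := by rw [map_smul, ha g]
  mul_mem' ha hb g := by rw [map_mul, ha g, hb g]
  star_mem' ha g := by rw [map_star, ha g]

instance : IsClosed (α.fixedPoints : Set A) := by
  have h : (α.fixedPoints : Set A) = ⋂ g, {a | α.aut g a = a} := by
    ext a
    rw [Set.mem_iInter]
    exact Iff.rfl
  rw [h]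
  refine isClosed_iInter fun g => isClosed_eq ?_ continuous_id
  exact α.continuous_aut_uncurry.comp (Continuous.prodMk_right g)

/-- The inclusion `A^α → A`. -/
def fixedPointsInclusion : α.fixedPoints →⋆ₙₐ[ℂ] A :=
  NonUnitalStarSubalgebraClass.subtype α.fixedPoints

/-- The (in general discontinuous) action `α_∞` on `A_∞`. -/
def seqAut (g : G) : SeqAlgebra A →⋆ₙₐ[ℂ] SeqAlgebra A := SeqAlgebra.map (α.aut g)

theorem toSeqAlgebra_eq_seqAut (g : G) (a : A) :
    toSeqAlgebra A a = α.seqAut g (toSeqAlgebra A (α.aut g⁻¹ a)) := by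
  rw [seqAut, SeqAlgebra.map_toSeqAlgebra, ← aut_mul, mul_inv_cancel, aut_one]

theorem seqAut_mem_relCommutant (g : G) (x : relCommutant A) :
    α.seqAut g (x : SeqAlgebra A) ∈ relCommutant A := by
  have key : ∀ a : A, toSeqAlgebra A a * α.seqAut g (x : SeqAlgebra A) =
      α.seqAut g (x : SeqAlgebra A) * toSeqAlgebra A a := fun a => by
    have hx := ((NonUnitalStarSubalgebra.mem_centralizer_iff ℂ).1 x.2 _
      ⟨α.aut g⁻¹ a, rfl⟩).1
    rw [α.toSeqAlgebra_eq_seqAut g a, ← map_mul, ← map_mul, hx]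
  refine (NonUnitalStarSubalgebra.mem_centralizer_iff ℂ).2 ?_
  rintro _ ⟨a, rfl⟩
  refine ⟨key a, ?_⟩
  rw [← map_star]
  exact key (star a)

/-- The restriction of `α_∞` to `A_∞ ∩ A'`. -/
def commutantAut (g : G) : relCommutant A →⋆ₙₐ[ℂ] relCommutant A :=
  NonUnitalStarAlgHom.codRestrict
    ((α.seqAut g).comp (NonUnitalStarSubalgebraClass.subtype (relCommutant A)))
    (relCommutant A) (α.seqAut_mem_relCommutant g)

/-- The induced (in general discontinuous) action on `F_∞(A)`. -/
def centralAut (g : G) : CentralSeqAlgebra A →⋆ₙₐ[ℂ] CentralSeqAlgebra A :=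
  StarIdeal.Quotient.map (α.commutantAut g) fun x hx a => by
    have h := hx (α.aut g⁻¹ a)
    have e : ((α.commutantAut g x : relCommutant A) : SeqAlgebra A) =
      α.seqAut g (x : SeqAlgebra A) := rfl
    rw [e, α.toSeqAlgebra_eq_seqAut g a, ← map_mul, ← map_mul, h.1, h.2, map_zero]
    exact ⟨rfl, rfl⟩

/-- The continuous part `F_{∞,α}(A)` of `F_∞(A)`: the elements with norm-continuous orbit maps. -/
def continuousCentral : NonUnitalStarSubalgebra ℂ (CentralSeqAlgebra A) where
  carrier := {x | Continuous fun g => α.centralAut g x}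
  zero_mem' := by simpa using continuous_const
  add_mem' {x y} hx hy := by
    simp only [Set.mem_ofPred_eq, map_add] at *
    exact hx.add hy
  smul_mem' c x hx := by
    simp only [Set.mem_ofPred_eq, map_smul] at *
    exact hx.const_smul c
  mul_mem' {x y} hx hy := by
    simp only [Set.mem_ofPred_eq, map_mul] at *
    exact hx.mul hy
  star_mem' {x} hx := by
    simp only [Set.mem_ofPred_eq, map_star] at *
    exact hx.star

variable [IsTopologicalGroup G]

/-- The shift `σ_g(f) = f(g⁻¹ ·)` on `C(G)`. -/
def shift (g : G) (f : C(G, ℂ)) : C(G, ℂ) := f.comp ⟨fun t => g⁻¹ * t, by fun_prop⟩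

/-- The Rokhlin property: there is a unital equivariant `*`-homomorphism from `(C(G), σ)` to
`F_{∞,α}(A)`. -/
def RokhlinProperty [CompactSpace G] : Prop :=
  ∃ φ : C(G, ℂ) →⋆ₙₐ[ℂ] α.continuousCentral,
    (∀ x, φ 1 * x = x ∧ x * φ 1 = x) ∧
    ∀ g f, (φ (shift g f) : CentralSeqAlgebra A) = α.centralAut g (φ f)

end CStarAction

/-! ### Enveloping `C*`-algebras -/

section Enveloping

/-- A `C*`-seminorm on a complex `*`-algebra. -/
structure CStarSeminorm (X : Type*) [NonUnitalRing X] [StarRing X] [Module ℂ X] extends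
    Seminorm ℂ X where
  mul_le' : ∀ x y, toFun (x * y) ≤ toFun x * toFun y
  star_mul_self' : ∀ x, toFun (star x * x) = toFun x * toFun x

/-- A pointwise bounded set of `C*`-seminorms. -/
structure SeminormFamily (X : Type*) [NonUnitalRing X] [StarRing X] [Module ℂ X] where
  /-- The members of the family. -/
  seminorms : Set (CStarSeminorm X)
  bounded : ∀ x, ∃ C, ∀ p ∈ seminorms, p.toSeminorm x ≤ C

namespace SeminormFamily

variable {X : Type*} [NonUnitalRing X] [StarRing X] [Module ℂ X] (S : SeminormFamily X)

/-- The pointwise supremum of the family. -/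
def sup (x : X) : ℝ := ⨆ p : S.seminorms, p.1.toSeminorm x

theorem le_sup {p : CStarSeminorm X} (hp : p ∈ S.seminorms) (x : X) :
    p.toSeminorm x ≤ S.sup x := by
  refine le_ciSup (f := fun p : S.seminorms => p.1.toSeminorm x) ?_ ⟨p, hp⟩
  obtain ⟨C, hC⟩ := S.bounded x
  refine ⟨C, ?_⟩
  rintro _ ⟨q, rfl⟩
  exact hC q.1 q.2

theorem sup_nonneg (x : X) : 0 ≤ S.sup x := Real.iSup_nonneg fun _ => apply_nonneg _ _

theorem sup_le {x : X} {C : ℝ} (hC : 0 ≤ C) (h : ∀ p ∈ S.seminorms, p.toSeminorm x ≤ C) :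
    S.sup x ≤ C := Real.iSup_le (fun p => h p.1 p.2) hC

/-- The supremum of the family is a `C*`-seminorm. -/
def supSeminorm : CStarSeminorm X where
  toSeminorm := Seminorm.ofSMulLE S.sup
    (le_antisymm (S.sup_le le_rfl fun p _ => (map_zero p.toSeminorm).le) (S.sup_nonneg 0))
    (fun x y => S.sup_le (add_nonneg (S.sup_nonneg x) (S.sup_nonneg y)) fun p hp =>
      (map_add_le_add p.toSeminorm x y).trans (add_le_add (S.le_sup hp x) (S.le_sup hp y)))
    (fun c x => S.sup_le (mul_nonneg (norm_nonneg c) (S.sup_nonneg x)) fun p hp =>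
      (map_smul_eq_mul p.toSeminorm c x).le.trans
        (mul_le_mul_of_nonneg_left (S.le_sup hp x) (norm_nonneg c)))
  mul_le' x y := S.sup_le (mul_nonneg (S.sup_nonneg x) (S.sup_nonneg y)) fun p hp =>
    (p.mul_le' x y).trans (mul_le_mul (S.le_sup hp x) (S.le_sup hp y)
      (apply_nonneg p.toSeminorm y) (S.sup_nonneg x))
  star_mul_self' x := by
    refine le_antisymm ?_ ?_
    · exact S.sup_le (mul_nonneg (S.sup_nonneg x) (S.sup_nonneg x)) fun p hp =>
        (p.star_mul_self' x).le.trans (mul_le_mul (S.le_sup hp x) (S.le_sup hp x)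
          (apply_nonneg p.toSeminorm x) (S.sup_nonneg x))
    · change S.sup x * S.sup x ≤ S.sup (star x * x)
      rw [← sq, ← Real.le_sqrt (S.sup_nonneg x) (S.sup_nonneg _)]
      refine S.sup_le (Real.sqrt_nonneg _) fun p hp => Real.le_sqrt_of_sq_le ?_
      rw [sq]
      exact (p.star_mul_self' x).ge.trans (S.le_sup hp _)

/-- The `*`-algebra `X` with the supremum of the family as its seminorm. -/
def Pre (_S : SeminormFamily X) : Type _ := X

namespace Pre

instance : NonUnitalRing S.Pre := inferInstanceAs (NonUnitalRing X)
instance : StarRing S.Pre := inferInstanceAs (StarRing X)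
instance : Module ℂ S.Pre := inferInstanceAs (Module ℂ X)
instance [IsScalarTower ℂ X X] : IsScalarTower ℂ S.Pre S.Pre :=
  inferInstanceAs (IsScalarTower ℂ X X)
instance [SMulCommClass ℂ X X] : SMulCommClass ℂ S.Pre S.Pre :=
  inferInstanceAs (SMulCommClass ℂ X X)
instance [StarModule ℂ X] : StarModule ℂ S.Pre := inferInstanceAs (StarModule ℂ X)

instance : SeminormedAddCommGroup S.Pre :=
  AddGroupSeminorm.toSeminormedAddCommGroup (E := S.Pre) S.supSeminorm.toAddGroupSeminorm

theorem norm_def (x : S.Pre) : ‖x‖ = S.supSeminorm.toSeminorm x := rfl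

instance : NonUnitalSeminormedRing S.Pre :=
  { (inferInstance : SeminormedAddCommGroup S.Pre), (inferInstance : NonUnitalRing S.Pre) with
    norm_mul_le := S.supSeminorm.mul_le' }

instance : NormedSpace ℂ S.Pre where
  norm_smul_le c x := (map_smul_eq_mul S.supSeminorm.toSeminorm c x).le

theorem norm_star_mul_self (x : S.Pre) : ‖star x * x‖ = ‖x‖ * ‖x‖ :=
  S.supSeminorm.star_mul_self' x

instance : NormedStarGroup S.Pre where
  norm_star_le x := by
    have key : ∀ y : S.Pre, ‖y‖ ≤ ‖star y‖ := fun y => by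
      rcases (norm_nonneg y).eq_or_lt with h | h
      · rw [← h]; exact norm_nonneg _
      · have := (norm_star_mul_self S y).symm.le.trans (norm_mul_le (star y) y)
        exact le_of_mul_le_mul_right this h
    simpa using key (star x)

end Pre

/-- The enveloping `C*`-algebra: the Hausdorff completion of `X` with respect to the supremum of
the family of `C*`-seminorms. -/
def Env : Type _ := UniformSpace.Completion S.Pre

namespace Env

open UniformSpace

instance : NormedAddCommGroup S.Env := inferInstanceAs (NormedAddCommGroup (Completion S.Pre))
instance : CompleteSpace S.Env := inferInstanceAs (CompleteSpace (Completion S.Pre))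
instance : NormedSpace ℂ S.Env := inferInstanceAs (NormedSpace ℂ (Completion S.Pre))

theorem continuous_smul_left (c : ℂ) : Continuous fun x : S.Env => c • x :=
  continuous_const_smul c

variable {S} in
/-- The canonical map from `X` to its enveloping `C*`-algebra. -/
def of (x : S.Pre) : S.Env := (x : Completion S.Pre)

theorem norm_of (x : S.Pre) : ‖of x‖ = ‖x‖ := Completion.norm_coe x

theorem continuous_of : Continuous (of : S.Pre → S.Env) := Completion.continuous_coe _

theorem denseRange_of : DenseRange (of : S.Pre → S.Env) := Completion.denseRange_coe

theorem isDenseInducing_of : IsDenseInducing (of : S.Pre → S.Env) := Completion.isDenseInducing_coe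

theorem of_add (x y : S.Pre) : of (x + y) = of x + of y := Completion.coe_add x y

theorem of_zero : of (0 : S.Pre) = 0 := Completion.coe_zero

theorem of_smul (c : ℂ) (x : S.Pre) : of (c • x) = c • of x := Completion.coe_smul c x

/-- The canonical map as an additive homomorphism. -/
def ofAddHom : S.Pre →+ S.Env where
  toFun := of
  map_zero' := of_zero S
  map_add' := of_add S

instance : Mul S.Env where
  mul := Function.curry (((isDenseInducing_of S).prodMap (isDenseInducing_of S)).extend
    (of ∘ Function.uncurry (· * ·)))

theorem of_mul (x y : S.Pre) : of (x * y) = of x * of y :=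
  (((isDenseInducing_of S).prodMap (isDenseInducing_of S)).extend_eq
    ((continuous_of S).comp (continuous_mul (M := S.Pre))) (x, y)).symm

instance : ContinuousMul S.Env where
  continuous_mul := by
    let m := (AddMonoidHom.mul : S.Pre →+ S.Pre →+ S.Pre).compr₂ (ofAddHom S)
    have h : Continuous fun p : S.Pre × S.Pre => m p.1 p.2 :=
      (continuous_of S).comp continuous_mul
    have di : IsDenseInducing (ofAddHom S) := isDenseInducing_of S
    exact (di.extend_Z_bilin di h :)

instance : Star S.Env where
  star := (isDenseInducing_of S).extend (of ∘ star)

theorem of_star (x : S.Pre) : of (star x) = star (of x) :=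
  ((isDenseInducing_of S).extend_eq ((continuous_of S).comp continuous_star) x).symm

theorem isometry_of_star : Isometry (of ∘ star : S.Pre → S.Env) := by
  refine Isometry.of_dist_eq fun x y => ?_
  have h : ∀ u v : S.Pre, dist (of u) (of v) = dist u v := fun u v => Completion.dist_eq u v
  rw [Function.comp_apply, Function.comp_apply, h, dist_eq_norm, dist_eq_norm, ← star_sub,
    norm_star]

instance : ContinuousStar S.Env where
  continuous_star :=
    (uniformContinuous_uniformly_extend
      (Completion.isUniformInducing_coe S.Pre) (denseRange_of S)
      (isometry_of_star S).uniformContinuous).continuous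

variable {S} in
@[elab_as_elim]
theorem induction_on {P : S.Env → Prop} (x : S.Env) (hP : IsClosed {x | P x})
    (h : ∀ x : S.Pre, P (of x)) : P x := Completion.induction_on x hP h

variable {S} in
@[elab_as_elim]
theorem induction_on₂ {P : S.Env → S.Env → Prop} (x y : S.Env)
    (hP : IsClosed {q : S.Env × S.Env | P q.1 q.2})
    (h : ∀ x y : S.Pre, P (of x) (of y)) : P x y := Completion.induction_on₂ x y hP h

variable {S} in
@[elab_as_elim]
theorem induction_on₃ {P : S.Env → S.Env → S.Env → Prop} (x y z : S.Env)
    (hP : IsClosed {q : S.Env × S.Env × S.Env | P q.1 q.2.1 q.2.2})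
    (h : ∀ x y z : S.Pre, P (of x) (of y) (of z)) : P x y z :=
  Completion.induction_on₃ x y z hP h

instance : NonUnitalRing S.Env where
  __ : AddCommGroup S.Env := inferInstance
  left_distrib x y z := induction_on₃ x y z (isClosed_eq (by fun_prop) (by fun_prop))
    fun x y z => by simp only [← of_add, ← of_mul, mul_add]
  right_distrib x y z := induction_on₃ x y z (isClosed_eq (by fun_prop) (by fun_prop))
    fun x y z => by simp only [← of_add, ← of_mul, add_mul]
  zero_mul x := induction_on x (isClosed_eq (by fun_prop) (by fun_prop))
    fun x => by rw [← of_zero, ← of_mul, zero_mul]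
  mul_zero x := induction_on x (isClosed_eq (by fun_prop) (by fun_prop))
    fun x => by rw [← of_zero, ← of_mul, mul_zero]
  mul_assoc x y z := induction_on₃ x y z (isClosed_eq (by fun_prop) (by fun_prop))
    fun x y z => by simp only [← of_mul, mul_assoc]

theorem norm_mul_le_aux (x y : S.Env) : ‖x * y‖ ≤ ‖x‖ * ‖y‖ :=
  induction_on₂ x y (isClosed_le (by fun_prop) (by fun_prop))
    fun x y => by rw [← of_mul, norm_of, norm_of, norm_of]; exact norm_mul_le x y

instance : NonUnitalNormedRing S.Env :=
  { (inferInstance : NormedAddCommGroup S.Env), (inferInstance : NonUnitalRing S.Env) with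
    norm_mul_le := norm_mul_le_aux S }

instance : StarRing S.Env where
  star_involutive x := induction_on x (isClosed_eq (by fun_prop) (by fun_prop))
    fun x => by rw [← of_star, ← of_star, star_star]
  star_mul x y := induction_on₂ x y (isClosed_eq (by fun_prop) (by fun_prop))
    fun x y => by rw [← of_mul, ← of_star, star_mul, of_mul, of_star, of_star]
  star_add x y := induction_on₂ x y (isClosed_eq (by fun_prop) (by fun_prop))
    fun x y => by rw [← of_add, ← of_star, star_add, of_add, of_star, of_star]

instance : CStarRing S.Env where
  norm_mul_self_le x := induction_on x (isClosed_le (by fun_prop) (by fun_prop))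
    fun x => by
      rw [← of_star, ← of_mul, norm_of, norm_of]
      exact (Pre.norm_star_mul_self S x).ge

variable [IsScalarTower ℂ X X] [SMulCommClass ℂ X X] [StarModule ℂ X]

instance : IsScalarTower ℂ S.Env S.Env where
  smul_assoc c x y := by
    rw [smul_eq_mul, smul_eq_mul]
    induction x, y using induction_on₂ with
    | hP => 
      have hs := continuous_smul_left S c
      exact isClosed_eq ((hs.comp continuous_fst).mul continuous_snd)
        (hs.comp (continuous_fst.mul continuous_snd))
    | h x y => rw [← of_smul, ← of_mul, ← of_mul, ← of_smul, smul_mul_assoc]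

instance : SMulCommClass ℂ S.Env S.Env where
  smul_comm c x y := by
    rw [smul_eq_mul, smul_eq_mul]
    induction x, y using induction_on₂ with
    | hP => 
      have hs := continuous_smul_left S c
      exact isClosed_eq (hs.comp (continuous_fst.mul continuous_snd))
        (continuous_fst.mul (hs.comp continuous_snd))
    | h x y => rw [← of_smul, ← of_mul, ← of_mul, ← of_smul, mul_smul_comm]

instance : StarModule ℂ S.Env where
  star_smul c x := by
    induction x using induction_on with
    | hP => 
      exact isClosed_eq (continuous_star.comp (continuous_smul_left S c))
        ((continuous_smul_left S (star c)).comp continuous_star)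
    | h x => rw [← of_smul, ← of_star, star_smul, of_smul, of_star]

instance : NonUnitalCStarAlgebra S.Env where

/-- The canonical map as a `*`-homomorphism. -/
def ofHom : S.Pre →⋆ₙₐ[ℂ] S.Env where
  toFun := of
  map_smul' := of_smul S
  map_zero' := of_zero S
  map_add' := of_add S
  map_mul' := of_mul S
  map_star' := of_star S

section Map

variable {S}
variable {Y : Type*} [NonUnitalRing Y] [StarRing Y] [Module ℂ Y] [IsScalarTower ℂ Y Y]
  [SMulCommClass ℂ Y Y] [StarModule ℂ Y] {T : SeminormFamily Y}

/-- The extension of a map by continuity. -/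
def mapFun (θ : S.Pre →⋆ₙₐ[ℂ] T.Pre) : S.Env → T.Env :=
  Completion.map (α := S.Pre) (β := T.Pre) θ

/-- The `*`-homomorphism between the enveloping algebras that extends a contractive
`*`-homomorphism. -/
def map (θ : S.Pre →⋆ₙₐ[ℂ] T.Pre) (h : ∀ x, ‖θ x‖ ≤ ‖x‖) : S.Env →⋆ₙₐ[ℂ] T.Env :=
  have hu : UniformContinuous θ :=
    LipschitzWith.uniformContinuous (K := 1) (LipschitzWith.of_dist_le_mul fun x y => by
      rw [dist_eq_norm, dist_eq_norm, NNReal.coe_one, one_mul, ← map_sub]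
      exact h _)
  have hc : Continuous (mapFun θ) :=
    Completion.continuous_map (α := S.Pre) (β := T.Pre)
  have hof : ∀ x, mapFun θ (of x) = of (θ x) :=
    fun x => Completion.map_coe hu x
  { toFun := mapFun θ
    map_smul' := fun c x => by
      rw [MonoidHom.id_apply]
      induction x using induction_on with
      | hP => 
        exact isClosed_eq (hc.comp (continuous_smul_left S c))
          ((continuous_smul_left T c).comp hc)
      | h x => rw [← of_smul, hof, hof, map_smul, of_smul]
    map_zero' := by rw [← of_zero, hof, map_zero, of_zero]
    map_add' := fun x y => by
      induction x, y using induction_on₂ with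
      | hP => exact isClosed_eq (by fun_prop) (by fun_prop)
      | h x y => rw [← of_add, hof, hof, hof, map_add, of_add]
    map_mul' := fun x y => by
      induction x, y using induction_on₂ with
      | hP => exact isClosed_eq (by fun_prop) (by fun_prop)
      | h x y => rw [← of_mul, hof, hof, hof, map_mul, of_mul]
    map_star' := fun x => by
      induction x using induction_on with
      | hP => exact isClosed_eq (by fun_prop) (by fun_prop)
      | h x => rw [← of_star, hof, hof, map_star, of_star] }

end Map

end Env

end SeminormFamily

/-- The pull-back of a `C*`-seminorm along a `*`-homomorphism. -/
def CStarSeminorm.comp {X Y : Type*} [NonUnitalRing X] [StarRing X] [Module ℂ X]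
    [NonUnitalRing Y] [StarRing Y] [Module ℂ Y] (p : CStarSeminorm Y) (θ : X →⋆ₙₐ[ℂ] Y) :
    CStarSeminorm X where
  toSeminorm := p.toSeminorm.comp
    ({ toFun := θ, map_add' := map_add θ, map_smul' := fun c x => map_smul θ c x } : X →ₗ[ℂ] Y)
  mul_le' x y := by
    change p.toSeminorm (θ (x * y)) ≤ p.toSeminorm (θ x) * p.toSeminorm (θ y)
    rw [map_mul]
    exact p.mul_le' _ _
  star_mul_self' x := by
    change p.toSeminorm (θ (star x * x)) = p.toSeminorm (θ x) * p.toSeminorm (θ x)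
    rw [map_mul, map_star]
    exact p.star_mul_self' _

/-- A `*`-homomorphism `X → Y`, regarded as one between the seminormed algebras. -/
def SeminormFamily.Pre.map {X Y : Type*} [NonUnitalRing X] [StarRing X] [Module ℂ X]
    [NonUnitalRing Y] [StarRing Y] [Module ℂ Y] (S : SeminormFamily X) (T : SeminormFamily Y)
    (θ : X →⋆ₙₐ[ℂ] Y) : S.Pre →⋆ₙₐ[ℂ] T.Pre := θ

theorem SeminormFamily.Pre.norm_map_le {X Y : Type*} [NonUnitalRing X] [StarRing X] [Module ℂ X]
    [NonUnitalRing Y] [StarRing Y] [Module ℂ Y] (S : SeminormFamily X) (T : SeminormFamily Y)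
    (θ : X →⋆ₙₐ[ℂ] Y) (h : ∀ p ∈ T.seminorms, p.comp θ ∈ S.seminorms) (x : S.Pre) :
    ‖SeminormFamily.Pre.map S T θ x‖ ≤ ‖x‖ := by
  have key : ∀ x : X, T.sup (θ x) ≤ S.sup x := fun x =>
    T.sup_le (S.sup_nonneg x) fun p hp => S.le_sup (h p hp) x
  exact key x

end Enveloping

/-! ### Crossed products by compact groups -/

section CrossedProduct

variable {G A : Type*} [Group G] [TopologicalSpace G] [IsTopologicalGroup G] [CompactSpace G]
  [SecondCountableTopology G] [MeasurableSpace G] [BorelSpace G] [NonUnitalCStarAlgebra A]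

/-- The convolution algebra `C(G, A)` of a dynamical system `(A, α, G)` over a compact group. -/
def ConvAlg (_α : CStarAction G A) (_μ : Measure G) : Type _ := C(G, A)

namespace ConvAlg

variable (α : CStarAction G A) (μ : Measure G)

instance : AddCommGroup (ConvAlg α μ) := inferInstanceAs (AddCommGroup C(G, A))
instance : Module ℂ (ConvAlg α μ) := inferInstanceAs (Module ℂ C(G, A))
instance : FunLike (ConvAlg α μ) G A := inferInstanceAs (FunLike C(G, A) G A)

/-- A continuous function, as an element of the convolution algebra. -/
def mk (f : C(G, A)) : ConvAlg α μ := f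

variable {α μ}

@[ext]
theorem ext {f g : ConvAlg α μ} (h : ∀ t, f t = g t) : f = g := DFunLike.ext f g h

theorem mk_apply (f : C(G, A)) (t : G) : mk α μ f t = f t := rfl

theorem add_apply (f g : ConvAlg α μ) (t : G) : (f + g) t = f t + g t := rfl

theorem zero_apply (t : G) : (0 : ConvAlg α μ) t = 0 := rfl

theorem smul_apply (c : ℂ) (f : ConvAlg α μ) (t : G) : (c • f) t = c • f t := rfl

theorem continuous_coe (f : ConvAlg α μ) : Continuous f :=
  ContinuousMap.continuous (show C(G, A) from f)

end ConvAlg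

/-- A `*`-homomorphism between `C*`-algebras as a continuous linear map. -/
def homL {B : Type*} [NonUnitalCStarAlgebra B] (φ : A →⋆ₙₐ[ℂ] B) : A →L[ℂ] B :=
  LinearMap.mkContinuous
    { toFun := φ, map_add' := map_add φ, map_smul' := fun c x => map_smul φ c x } 1
    fun a => by
      rw [one_mul]
      exact NonUnitalStarAlgHom.norm_apply_le φ a

namespace ConvAlg

variable {α : CStarAction G A} {μ : Measure G}

theorem continuous_integrand {Y : Type*} [TopologicalSpace Y] (f g : ConvAlg α μ)
    {u v w : Y → G} (hu : Continuous u) (hv : Continuous v) (hw : Continuous w) :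
    Continuous fun y => f (u y) * α.aut (v y) (g (w y)) :=
  (f.continuous_coe.comp hu).mul (α.continuous_aut_comp hv (g.continuous_coe.comp hw))

variable [μ.IsHaarMeasure]

theorem integrable_of_continuous {E : Type*} [NormedAddCommGroup E] {F : G → E}
    (h : Continuous F) : Integrable F μ :=
  h.integrable_of_hasCompactSupport (HasCompactSupport.of_compactSpace F)

/-- The convolution product `(f * g)(t) = ∫ f(s) α_s(g(s⁻¹ t)) ds`. -/
instance : Mul (ConvAlg α μ) where
  mul f g := mk α μ
    { toFun := fun t => ∫ s, f s * α.aut s (g (s⁻¹ * t)) ∂μ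
      continuous_toFun := by
        have h := continuous_parametric_integral_of_continuous (μ := μ) (s := Set.univ)
          (f := fun t s => f s * α.aut s (g (s⁻¹ * t)))
          (continuous_integrand f g continuous_snd continuous_snd
            (continuous_snd.inv.mul continuous_fst)) isCompact_univ
        simpa only [Measure.restrict_univ] using h }

theorem mul_apply (f g : ConvAlg α μ) (t : G) :
    (f * g) t = ∫ s, f s * α.aut s (g (s⁻¹ * t)) ∂μ := rfl

/-- The involution `f^*(t) = α_t(f(t⁻¹)^*)` (compact groups are unimodular). -/
instance : Star (ConvAlg α μ) where
  star f := mk α μ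
    { toFun := fun t => α.aut t (star (f t⁻¹))
      continuous_toFun := α.continuous_aut_comp continuous_id
        (f.continuous_coe.comp continuous_inv).star }

theorem star_apply (f : ConvAlg α μ) (t : G) : star f t = α.aut t (star (f t⁻¹)) := rfl

theorem integrable_integrand (f g : ConvAlg α μ) (t : G) :
    Integrable (fun s => f s * α.aut s (g (s⁻¹ * t))) μ :=
  integrable_of_continuous
    (continuous_integrand f g continuous_id continuous_id (continuous_inv.mul continuous_const))

theorem mul_assoc_aux (f g h : ConvAlg α μ) : f * g * h = f * (g * h) := by
  ext t
  have e1 : ∀ s, (f * g) s * α.aut s (h (s⁻¹ * t)) =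
      ∫ r, f r * α.aut r (g (r⁻¹ * s)) * α.aut s (h (s⁻¹ * t)) ∂μ := fun s =>
    (((ContinuousLinearMap.mul ℂ A).flip (α.aut s (h (s⁻¹ * t)))).integral_comp_comm
      (integrable_integrand f g s)).symm
  have e2 : ∀ r, f r * α.aut r ((g * h) (r⁻¹ * t)) =
      ∫ s, f r * α.aut r (g (r⁻¹ * s)) * α.aut s (h (s⁻¹ * t)) ∂μ := fun r => by
    have i1 := (((ContinuousLinearMap.mul ℂ A (f r)).comp (homL (α.aut r))).integral_comp_comm
      (integrable_integrand g h (r⁻¹ * t))).symm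
    have i2 := integral_mul_left_eq_self (μ := μ)
      (fun s => f r * α.aut r (g s * α.aut s (h (s⁻¹ * (r⁻¹ * t))))) r⁻¹
    refine i1.trans (i2.symm.trans (integral_congr_ae (Filter.Eventually.of_forall fun s => ?_)))
    change f r * α.aut r (g (r⁻¹ * s) * α.aut (r⁻¹ * s) (h ((r⁻¹ * s)⁻¹ * (r⁻¹ * t)))) =
      f r * α.aut r (g (r⁻¹ * s)) * α.aut s (h (s⁻¹ * t))
    have eg : (r⁻¹ * s)⁻¹ * (r⁻¹ * t) = s⁻¹ * t := by group
    rw [map_mul, ← α.aut_mul, mul_inv_cancel_left, mul_assoc, eg]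
  rw [mul_apply, mul_apply]
  simp_rw [e1, e2]
  refine integral_integral_swap_of_hasCompactSupport ?_ (HasCompactSupport.of_compactSpace _)
  exact (continuous_integrand f g continuous_snd continuous_snd
    (continuous_snd.inv.mul continuous_fst)).mul
    (α.continuous_aut_comp continuous_fst (h.continuous_coe.comp
      (continuous_fst.inv.mul continuous_const)))

instance : NonUnitalRing (ConvAlg α μ) where
  __ : AddCommGroup (ConvAlg α μ) := inferInstance
  left_distrib f g h := by
    ext t
    rw [add_apply, mul_apply, mul_apply, mul_apply,
      ← integral_add (integrable_integrand f g t) (integrable_integrand f h t)]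
    simp only [add_apply, map_add, mul_add]
  right_distrib f g h := by
    ext t
    rw [add_apply, mul_apply, mul_apply, mul_apply,
      ← integral_add (integrable_integrand f h t) (integrable_integrand g h t)]
    simp only [add_apply, add_mul]
  zero_mul f := by
    ext t
    simp only [mul_apply, zero_apply, zero_mul, integral_zero]
  mul_zero f := by
    ext t
    simp only [mul_apply, zero_apply, map_zero, mul_zero, integral_zero]
  mul_assoc := mul_assoc_aux

theorem star_mul_aux (f g : ConvAlg α μ) : star (f * g) = star g * star f := by
  ext t
  have i1 : star (∫ s, f s * α.aut s (g (s⁻¹ * t⁻¹)) ∂μ) =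
      ∫ s, star (f s * α.aut s (g (s⁻¹ * t⁻¹))) ∂μ :=
    ((starL' ℝ : A ≃L[ℝ] A).toContinuousLinearMap.integral_comp_comm
      (integrable_integrand f g t⁻¹)).symm
  have i2 := ((homL (α.aut t)).integral_comp_comm (μ := μ)
    (φ := fun s => star (f s * α.aut s (g (s⁻¹ * t⁻¹))))
      (integrable_of_continuous (continuous_integrand f g continuous_id continuous_id
        (continuous_inv.mul continuous_const)).star)).symm
  have i3 := integral_mul_left_eq_self (μ := μ)
      (fun s => α.aut t (star (f s * α.aut s (g (s⁻¹ * t⁻¹))))) t⁻¹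
  rw [star_apply, mul_apply, mul_apply, i1]
  refine i2.trans (i3.symm.trans (integral_congr_ae (Filter.Eventually.of_forall fun s => ?_)))
  change α.aut t (star (f (t⁻¹ * s) * α.aut (t⁻¹ * s) (g ((t⁻¹ * s)⁻¹ * t⁻¹)))) =
    α.aut s (star (g s⁻¹)) * α.aut s (α.aut (s⁻¹ * t) (star (f (s⁻¹ * t)⁻¹)))
  rw [star_mul, map_mul, ← map_star, ← α.aut_mul, ← α.aut_mul, mul_inv_cancel_left,
    mul_inv_cancel_left]
  congr 4 <;> group

instance : StarRing (ConvAlg α μ) where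
  star_involutive f := by
    ext t
    rw [star_apply, star_apply, ← map_star, ← α.aut_mul, mul_inv_cancel, α.aut_one, star_star,
      inv_inv]
  star_mul := star_mul_aux
  star_add f g := by
    ext t
    simp only [star_apply, add_apply, star_add, map_add]

instance : IsScalarTower ℂ (ConvAlg α μ) (ConvAlg α μ) where
  smul_assoc c f g := by
    ext t
    rw [smul_eq_mul, smul_eq_mul, smul_apply, mul_apply, mul_apply, ← integral_smul]
    simp only [smul_apply, smul_mul_assoc]

instance : SMulCommClass ℂ (ConvAlg α μ) (ConvAlg α μ) where
  smul_comm c f g := by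
    ext t
    rw [smul_eq_mul, smul_eq_mul, smul_apply, mul_apply, mul_apply, ← integral_smul]
    simp only [smul_apply, map_smul, mul_smul_comm]

instance : StarModule ℂ (ConvAlg α μ) where
  star_smul c f := by
    ext t
    simp only [star_apply, smul_apply, star_smul, map_smul]

variable (α μ)

/-- The `C*`-seminorms on `C(G, A)` that are dominated by the `L¹`-norm. -/
def seminormFamily : SeminormFamily (ConvAlg α μ) where
  seminorms := {p | ∀ f, p.toSeminorm f ≤ ∫ t, ‖f t‖ ∂μ}
  bounded f := ⟨_, fun _ hp => hp f⟩

end ConvAlg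

namespace CStarAction

variable (α : CStarAction G A) (μ : Measure G) [μ.IsHaarMeasure]

/-- The (full) crossed product `A ⋊_α G`, as the enveloping `C*`-algebra of the convolution algebra:
the completion of `C(G, A)` in the largest `C*`-seminorm dominated by the `L¹`-norm. -/
abbrev CrossedProduct : Type _ := (ConvAlg.seminormFamily α μ).Env

/-- The canonical `*`-homomorphism from the convolution algebra to the crossed product. -/
def toCrossedProduct : ConvAlg α μ →⋆ₙₐ[ℂ] α.CrossedProduct μ :=
  SeminormFamily.Env.ofHom (ConvAlg.seminormFamily α μ)

variable {B : Type*} [NonUnitalCStarAlgebra B] {α} {β : CStarAction G B}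

/-- The map `f ↦ φ ∘ f` on convolution algebras induced by an equivariant `*`-homomorphism. -/
def convMap (φ : A →⋆ₙₐ[ℂ] B) (hφ : ∀ g a, φ (α.aut g a) = β.aut g (φ a)) :
    ConvAlg α μ →⋆ₙₐ[ℂ] ConvAlg β μ where
  toFun f := ConvAlg.mk β μ ⟨fun t => φ (f t),
    (homL φ).continuous.comp f.continuous_coe⟩
  map_smul' c f := ConvAlg.ext fun t => map_smul φ c (f t)
  map_zero' := ConvAlg.ext fun _ => map_zero φ
  map_add' f g := ConvAlg.ext fun t => map_add φ (f t) (g t)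
  map_mul' f g := ConvAlg.ext fun t => by
    refine ((homL φ).integral_comp_comm (ConvAlg.integrable_integrand f g t)).symm.trans
      (integral_congr_ae (Filter.Eventually.of_forall fun s => ?_))
    change φ (f s * α.aut s (g (s⁻¹ * t))) = φ (f s) * β.aut s (φ (g (s⁻¹ * t)))
    rw [map_mul, hφ]
  map_star' f := ConvAlg.ext fun t => by
    change φ (α.aut t (star (f t⁻¹))) = β.aut t (star (φ (f t⁻¹)))
    rw [hφ, map_star]

/-- The `*`-homomorphism `φ ⋊ G : A ⋊_α G → B ⋊_β G` induced by an equivariant `*`-homomorphism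
`φ : (A, α) → (B, β)`. -/
def crossedProductMap (φ : A →⋆ₙₐ[ℂ] B) (hφ : ∀ g a, φ (α.aut g a) = β.aut g (φ a)) :
    α.CrossedProduct μ →⋆ₙₐ[ℂ] β.CrossedProduct μ :=
  SeminormFamily.Env.map (SeminormFamily.Pre.map _ _ (convMap μ φ hφ))
    (SeminormFamily.Pre.norm_map_le _ _ _ fun p hp f => by
      refine (hp (convMap μ φ hφ f)).trans ?_
      refine integral_mono (ConvAlg.integrable_of_continuous (ConvAlg.continuous_coe _).norm)
        (ConvAlg.integrable_of_continuous (ConvAlg.continuous_coe _).norm) fun t => ?_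
      exact NonUnitalStarAlgHom.norm_apply_le φ (f t))

end CStarAction

end CrossedProduct

/-! ### The system `(C(G) ⊗ A, σ ⊗ α)` -/

namespace CStarAction

section ShiftTensor

variable {G A : Type*} [Group G] [TopologicalSpace G] [IsTopologicalGroup G] [CompactSpace G]
  [NonUnitalCStarAlgebra A] (α : CStarAction G A)

/-- The automorphism `(σ ⊗ α)_g` of `C(G) ⊗ A = C(G, A)`, given by `f ↦ (t ↦ α_g(f(g⁻¹ t)))`. -/
def shiftTensorFun (g : G) (f : C(G, A)) : C(G, A) where
  toFun t := α.aut g (f (g⁻¹ * t))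
  continuous_toFun := α.continuous_aut_comp continuous_const
    (f.continuous.comp (continuous_const.mul continuous_id))

/-- The action `σ ⊗ α` of `G` on `C(G) ⊗ A = C(G, A)`. -/
def shiftTensor : CStarAction G C(G, A) where
  toMonoidHom :=
    { toFun := fun g =>
        { toFun := α.shiftTensorFun g
          invFun := α.shiftTensorFun g⁻¹
          left_inv := fun f => ContinuousMap.ext fun t => by
            simp [shiftTensorFun, ← aut_mul, aut_one]
          right_inv := fun f => ContinuousMap.ext fun t => by
            simp [shiftTensorFun, ← aut_mul, aut_one]
          map_mul' := fun f h => ContinuousMap.ext fun t => map_mul (α.aut g) _ _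
          map_add' := fun f h => ContinuousMap.ext fun t => map_add (α.aut g) _ _
          map_star' := fun f => ContinuousMap.ext fun t => map_star (α.aut g) _
          map_smul' := fun c f => ContinuousMap.ext fun t => map_smul (α.aut g) c _ }
      map_one' := StarAlgEquiv.ext fun f => ContinuousMap.ext fun t => by
        change α.aut 1 (f (1⁻¹ * t)) = f t
        rw [aut_one, inv_one, one_mul]
      map_mul' := fun g h => StarAlgEquiv.ext fun f => ContinuousMap.ext fun t => by
        change α.aut (g * h) (f ((g * h)⁻¹ * t)) = α.aut g (α.aut h (f (h⁻¹ * (g⁻¹ * t))))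
        rw [aut_mul, mul_inv_rev, mul_assoc] }
  continuous_apply' f := by
    have h : Continuous fun p : G × G => α.aut p.1 (f (p.1⁻¹ * p.2)) :=
      α.continuous_aut_comp continuous_fst
        (f.continuous.comp (continuous_fst.inv.mul continuous_snd))
    exact (ContinuousMap.curry ⟨_, h⟩).continuous

theorem shiftTensor_aut_apply (g : G) (f : C(G, A)) (t : G) :
    α.shiftTensor.aut g f t = α.aut g (f (g⁻¹ * t)) := rfl

variable (G A) in
/-- The second-factor embedding `A → C(G) ⊗ A = C(G, A)`, by constant functions. -/
def secondFactor : A →⋆ₙₐ[ℂ] C(G, A) where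
  toFun a := ContinuousMap.const G a
  map_smul' _ _ := rfl
  map_zero' := rfl
  map_add' _ _ := rfl
  map_mul' _ _ := rfl
  map_star' _ := rfl

theorem secondFactor_equivariant (g : G) (a : A) :
    secondFactor G A (α.aut g a) = α.shiftTensor.aut g (secondFactor G A a) := rfl

end ShiftTensor

end CStarAction

/-! ### The tensor product `A ⊗ K(H)` -/

section Compacts

theorem isCompactOperator_star {H : Type*} [NormedAddCommGroup H] [InnerProductSpace ℂ H]
    [CompleteSpace H] {T : H →L[ℂ] H} (hT : IsCompactOperator T) :
    IsCompactOperator (star T : H →L[ℂ] H) := by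
  have hTT : IsCompactOperator (T * star T : H →L[ℂ] H) := hT.comp_clm (star T)
  refine (isCompactOperator_iff_isCompact_closure_image_closedBall (𝕜₁ := ℂ)
    ((star T : H →L[ℂ] H) : H →ₗ[ℂ] H) one_pos).2 ?_
  have h1 := (isCompactOperator_iff_isCompact_closure_image_closedBall (𝕜₁ := ℂ)
    ((T * star T : H →L[ℂ] H) : H →ₗ[ℂ] H) one_pos).1 hTT
  have tb : TotallyBounded ((T * star T : H →L[ℂ] H) '' Metric.closedBall 0 1) :=
    h1.totallyBounded.subset subset_closure
  refine TotallyBounded.isCompact_of_isClosed (TotallyBounded.closure ?_) isClosed_closure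
  rw [Metric.totallyBounded_iff]
  intro ε hε
  obtain ⟨t, hts, htf, htc⟩ := Metric.finite_approx_of_totallyBounded tb (ε ^ 2 / 2) (by positivity)
  have hts' : ∀ y ∈ t, ∃ v, v ∈ Metric.closedBall (0 : H) 1 ∧ (T * star T) v = y :=
    fun y hy => hts hy
  choose! u hu using hts'
  refine ⟨(fun y => star T (u y)) '' t, htf.image _, ?_⟩
  rintro _ ⟨x, hx, rfl⟩
  obtain ⟨y, hy, hxy⟩ := Set.mem_iUnion₂.1 (htc ⟨x, hx, rfl⟩)
  refine Set.mem_iUnion₂.2 ⟨_, ⟨y, hy, rfl⟩, ?_⟩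
  obtain ⟨hub, huy⟩ := hu y hy
  rw [Metric.mem_ball, dist_eq_norm] at hxy ⊢
  rw [← huy, ← map_sub] at hxy
  change ‖star T x - star T (u y)‖ < ε
  rw [← map_sub]
  set z := x - u y with hz
  have hz2 : ‖z‖ ≤ 2 := by
    rw [mem_closedBall_zero_iff] at hx hub
    exact (norm_sub_le _ _).trans (by linarith)
  have key : ‖star T z‖ ^ 2 ≤ ‖(T * star T) z‖ * ‖z‖ := by
    have e : RCLike.re (inner ℂ ((T * star T) z) z) = ‖star T z‖ ^ 2 := by
      have : inner ℂ ((T * star T) z) z = inner ℂ (star T z) (star T z) := by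
        rw [ContinuousLinearMap.star_eq_adjoint, ContinuousLinearMap.adjoint_inner_right]
        rfl
      rw [this, inner_self_eq_norm_sq]
    rw [← e]
    exact (RCLike.re_le_norm _).trans (norm_inner_le_norm _ _)
  have : ‖star T z‖ ^ 2 < ε ^ 2 := by
    refine key.trans_lt ?_
    calc ‖(T * star T) z‖ * ‖z‖ ≤ ‖(T * star T) z‖ * 2 := by gcongr
      _ < ε ^ 2 := by linarith
  exact lt_of_pow_lt_pow_left₀ 2 hε.le this

theorem isCompactOperator_rankOne {H : Type*} [NormedAddCommGroup H] [InnerProductSpace ℂ H]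
    (ξ η : H) : IsCompactOperator (InnerProductSpace.rankOne ℂ ξ η) := by
  have h : IsCompactOperator (innerSL ℂ η) :=
    isCompactOperator_of_locallyCompactSpace_dom (innerSL ℂ η)
  exact h.clm_comp (ContinuousLinearMap.toSpanSingleton ℂ ξ)

variable (H : Type*) [NormedAddCommGroup H] [InnerProductSpace ℂ H] [CompleteSpace H]

/-- The `C*`-algebra `K(H)` of compact operators on a Hilbert space. -/
def compacts : NonUnitalStarSubalgebra ℂ (H →L[ℂ] H) where
  carrier := {T | IsCompactOperator T}
  zero_mem' := isCompactOperator_zero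
  add_mem' hS hT := hS.add hT
  smul_mem' c _ hT := hT.smul c
  mul_mem' {_ T} hS _ := hS.comp_clm T
  star_mem' hT := isCompactOperator_star hT

instance : IsClosed (compacts H : Set (H →L[ℂ] H)) :=
  isClosed_setOfPred_isCompactOperator

variable {H} in
/-- The rank-one operator `ζ ↦ ⟨η, ζ⟩ ξ`, as an element of `K(H)`. -/
def rankOneCompact (ξ η : H) : compacts H :=
  ⟨InnerProductSpace.rankOne ℂ ξ η, isCompactOperator_rankOne ξ η⟩

variable (A K : Type*) [NonUnitalCStarAlgebra A] [NonUnitalCStarAlgebra K]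

/-- The `C*`-seminorms `p` on the algebraic tensor product `A ⊙ K` with
`p(a ⊗ k) ≤ ‖a‖ ‖k‖` (an inequality that every `C*`-seminorm on `A ⊙ K` satisfies). -/
def tensorSeminorms : SeminormFamily (A ⊗[ℂ] K) where
  seminorms := {p | ∀ (a : A) (k : K), p.toSeminorm (a ⊗ₜ k) ≤ ‖a‖ * ‖k‖}
  bounded x := by
    induction x using TensorProduct.induction_on with
    | zero => exact ⟨0, fun p _ => (map_zero p.toSeminorm).le⟩
    | tmul a k => exact ⟨_, fun p hp => hp a k⟩
    | add x y hx hy =>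
      obtain ⟨C, hC⟩ := hx
      obtain ⟨D, hD⟩ := hy
      exact ⟨C + D, fun p hp => (map_add_le_add p.toSeminorm x y).trans
        (add_le_add (hC p hp) (hD p hp))⟩

/-- The `C*`-tensor product `A ⊗ K`: the completion of the algebraic tensor product in its largest
`C*`-norm. It is only used where `K` is an algebra of compact operators, which is nuclear, so that
the algebraic tensor product has exactly one `C*`-norm. -/
abbrev CStarTensor : Type _ := (tensorSeminorms A K).Env

variable {A K} in
/-- The elementary tensor `a ⊗ k`. -/
def elemTensor (a : A) (k : K) : CStarTensor A K :=
  SeminormFamily.Env.of (S := tensorSeminorms A K) (a ⊗ₜ[ℂ] k : A ⊗[ℂ] K)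

end Compacts

/-! ### The canonical embedding of the crossed product -/

namespace CStarAction

variable {G A : Type*} [Group G] [TopologicalSpace G] [IsTopologicalGroup G] [CompactSpace G]
  [SecondCountableTopology G] [MeasurableSpace G] [BorelSpace G] [NonUnitalCStarAlgebra A]
  (α : CStarAction G A) (μ : Measure G) [μ.IsHaarMeasure]

/-- For `a ∈ A` and `ξ, η ∈ C(G)`, the element `s ↦ (t ↦ ξ(t) conj(η(s⁻¹ t)) α_t(a))` of
`C(G, C(G, A))`. -/
def kernelElement (a : A) (ξ η : C(G, ℂ)) : ConvAlg α.shiftTensor μ :=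
  ConvAlg.mk α.shiftTensor μ (ContinuousMap.curry
    { toFun := fun p : G × G => (ξ p.2 * star (η (p.1⁻¹ * p.2))) • α.aut p.2 a
      continuous_toFun := by
        have h := (α.continuous_aut a).comp (continuous_snd (X := G) (Y := G))
        have h2 : Continuous fun p : G × G => ξ p.2 * star (η (p.1⁻¹ * p.2)) := by fun_prop
        exact h2.smul h })

/-- The canonical isomorphism `(C(G) ⊗ A) ⋊_{σ ⊗ α} G ≅ A ⊗ K(L²(G))`. It is the composition of the
isomorphism with `(C(G) ⊗ A) ⋊_{σ ⊗ id} G` that is induced by the conjugacy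
`f ↦ (t ↦ α_t(f(t)))` from `σ ⊗ id` to `σ ⊗ α`, and of the isomorphism
`(C(G) ⊗ A) ⋊_{σ ⊗ id} G ≅ A ⊗ K(L²(G))` given by multiplication operators and left translations.
So it sends `f ∈ C(G, C(G, A))` to the operator with the `A`-valued kernel
`k(t, r) = α_t⁻¹(f(t r⁻¹)(t))`. The predicate says this for the `f` whose kernel is of the form
`k(t, r) = ξ(t) conj(η(r)) a`; these `f` span a dense subspace. -/
def IsCanonicalIso
    (Φ : α.shiftTensor.CrossedProduct μ ≃⋆ₐ[ℂ] CStarTensor A (compacts (Lp ℂ 2 μ))) : Prop :=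
  ∀ (a : A) (ξ η : C(G, ℂ)),
    Φ (α.shiftTensor.toCrossedProduct μ (α.kernelElement μ a ξ η)) =
      elemTensor a (rankOneCompact (ContinuousMap.toLp 2 μ ℂ ξ) (ContinuousMap.toLp 2 μ ℂ η))

/-- The `*`-homomorphism `A ⋊_α G → A ⊗ K(L²(G))` given by an isomorphism
`(C(G) ⊗ A) ⋊_{σ ⊗ α} G ≅ A ⊗ K(L²(G))` and induced by the equivariant second-factor embedding
`A → C(G) ⊗ A`. -/
def crossedProductEmbedding
    (Φ : α.shiftTensor.CrossedProduct μ ≃⋆ₐ[ℂ] CStarTensor A (compacts (Lp ℂ 2 μ))) :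
    α.CrossedProduct μ →⋆ₙₐ[ℂ] CStarTensor A (compacts (Lp ℂ 2 μ)) :=
  (Φ : α.shiftTensor.CrossedProduct μ →⋆ₙₐ[ℂ] CStarTensor A (compacts (Lp ℂ 2 μ))).comp
    (crossedProductMap μ (secondFactor G A) α.secondFactor_equivariant)

end CStarAction

end RokhlinSplit

end

noncomputable section

namespace RokhlinSplit

open scoped ENNReal TensorProduct
open MeasureTheory Topology

set_option linter.unusedSectionVars false

/-! ### An automatic contractivity principle -/

section AutomaticContractivity

/-! A Rokhlin map `φ : C(G) → F_{∞,α}(A)` can be multiplied into `A`. An element of `F_∞(A)` is only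
defined modulo the annihilator of `A`, so its product with `a ∈ A` is well defined in `A_∞`; since
representatives commute with `A`, the elements `φ(f) a` multiply like the elementary tensors `f ⊗
a`. The universal property of `C(G, A)` (`CommutingPair.exists_hom`) turns this into an equivariant
`*`-homomorphism `ψ : C(G, A) → A_∞` with `ψ(1 ⊗ a) = a` (`RokhlinProperty.exists_hom`). Both
splittings come from this `ψ`.

For the fixed point algebra, `ψ` sends the orbit function `t ↦ α_t(a)`, which is invariant under `σ
⊗ α`, to an invariant element of `A_∞`. Averaging representatives over `G` shows that such elements
come from sequences in `A^α` (`exists_fixed_lift`). For `a ∈ A^α` the orbit function is the constant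
`1 ⊗ a`, and the composition is the canonical embedding.

For crossed products, `ψ` has to induce a map `B ⋊ G → (A ⋊ G)_∞`, where `B = C(G, A)`, although the
action on `A_∞` need not be continuous. The device is the space `liftPairs` of pairs `(F, (f_n))`
such that `(f_n(s))` represents `ψ(F(s))` for each `s`. Dominated convergence gives `limsup ‖f_n‖₁ ≤
‖F‖_∞`, so the class of `(f_n)` in `(A ⋊ G)_∞` depends only on `F`, boundedly
(`norm_liftPairsMap_le`), and lifting commutes with integration, hence with convolution
(`exists_crossedProduct_seqHom`).

For the canonical isomorphism, both algebras contain a dense image of `C(G) ⊙ C(G) ⊙ A`, with the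
same product and adjoint. A given tensor is a matrix over a finite orthonormal family of continuous
functions, on which both products are matrix multiplication; comparing coefficients bounds each norm
by the required one up to a constant depending on the family. The uniform bounds in the two
directions are `norm_tensorToElem_le` and `norm_tensorToConv_tmul_le`.

What removes such constants throughout is `norm_le_of_norm_le_const_mul`: by the `C*`-identity the
norm of `T(h)`, for `h = x* x`, is the `2^k`-th root of the norm of `T(h^{2^k})`, and multiplicative
constants disappear under these roots. The same principle lets a bound in the supremum norm be
improved to a bound in the `L¹`-norm, which is what the universal property of the crossed product
requires. -/

/-- A multiplicative, star-preserving map into a `C*`-algebra that is bounded, up to a constant, by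
`q'` is bounded by `q`, if `q` is submultiplicative and `q'` is a `q`-module norm. -/
theorem norm_le_of_norm_le_const_mul {R B : Type*} [Semigroup R] [Star R]
    [NonUnitalNormedRing B] [StarRing B] [CStarRing B] (T : R → B)
    (hmul : ∀ x y, T (x * y) = T x * T y) (hstar : ∀ x, T (star x) = star (T x))
    (hstar_mul : ∀ x : R, star (star x * x) = star x * x)
    (hstar_mul_mul : ∀ x y : R, star (x * y) = star y * star x)
    (q q' : R → ℝ) (hq0 : ∀ x, 0 ≤ q x) (hq : ∀ x y, q (x * y) ≤ q x * q y)
    (hqs : ∀ x, q (star x) ≤ q x) (hq' : ∀ x y, q' (x * y) ≤ q x * q' y)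
    (C : ℝ) (hC0 : 0 ≤ C) (hC : ∀ x, ‖T x‖ ≤ C * q' x) (x : R) : ‖T x‖ ≤ q x := by
  set h : R := star x * x with hh
  -- Repeated squaring, so that `y k` is `h ^ (2 ^ k)`. Each `y k` is self-adjoint, so the
  -- `C*`-identity evaluates `‖T (y k)‖` exactly.
  let y : ℕ → R := fun k => Nat.rec h (fun _ z => z * z) k
  have y0 : y 0 = h := rfl
  have ys : ∀ k, y (k + 1) = y k * y k := fun k => rfl
  have hsa : ∀ k, star (y k) = y k := by
    intro k
    induction k with
    | zero => exact hstar_mul x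
    | succ k ih => rw [ys, hstar_mul_mul, ih]
  have hT : ∀ k, ‖T (y k)‖ = ‖T h‖ ^ 2 ^ k := by
    intro k
    induction k with
    | zero => simp [y0]
    | succ k ih =>
      have e : T (y (k + 1)) = star (T (y k)) * T (y k) := by rw [ys, hmul, ← hstar, hsa]
      rw [e, CStarRing.norm_star_mul_self, ih, pow_succ, pow_mul, sq]
  have hqy : ∀ k, q (y k) ≤ q h ^ 2 ^ k := by
    intro k
    induction k with
    | zero => simp [y0]
    | succ k ih =>
      rw [ys, pow_succ, pow_mul, sq]
      exact (hq _ _).trans (mul_le_mul ih ih (hq0 _) (pow_nonneg (hq0 _) _))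
  have hqy' : ∀ k, 0 ≤ C * q' (y k) := fun k => (norm_nonneg _).trans (hC _)
  -- Morally `q'(h^{2^k}) ≤ q(h)^{2^k - 1} q'(h)`; the additional factor `q h` on the left avoids
  -- the exponent `2^k - 1`.
  have hfin : ∀ k, ‖T h‖ ^ 2 ^ k * q h ≤ (C * q' h) * q h ^ 2 ^ k := by
    have key : ∀ k, (C * q' (y k)) * q h ≤ (C * q' h) * q h ^ 2 ^ k := by
      intro k
      induction k with
      | zero => simp [y0]
      | succ k ih =>
        calc (C * q' (y (k + 1))) * q h ≤ (q (y k) * (C * q' (y k))) * q h := by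
              refine mul_le_mul_of_nonneg_right ?_ (hq0 _)
              rw [ys]
              calc C * q' (y k * y k) ≤ C * (q (y k) * q' (y k)) :=
                    mul_le_mul_of_nonneg_left (hq' _ _) hC0
                _ = _ := by ring
          _ = q (y k) * ((C * q' (y k)) * q h) := by ring
          _ ≤ q h ^ 2 ^ k * ((C * q' h) * q h ^ 2 ^ k) :=
              mul_le_mul (hqy k) ih (mul_nonneg (hqy' k) (hq0 _)) (pow_nonneg (hq0 _) _)
          _ = _ := by rw [pow_succ 2 k, pow_mul]; ring
    intro k
    rw [← hT]
    exact (mul_le_mul_of_nonneg_right (hC _) (hq0 _)).trans (key k)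
  have main : ‖T h‖ ≤ q h := by
    rcases (hq0 h).eq_or_lt with h0 | h0
    -- If `q h = 0`, then already `q'(h * h) ≤ q h * q' h = 0`, so one squaring suffices.
    · have h1 : ‖T (y 1)‖ ≤ 0 := by
        refine (hC _).trans ?_
        calc C * q' (y 1) ≤ C * (q h * q' h) := mul_le_mul_of_nonneg_left (hq' _ _) hC0
          _ = 0 := by rw [← h0]; ring
      rw [hT, pow_one] at h1
      rw [← h0]
      exact le_of_eq (pow_eq_zero_iff two_ne_zero |>.1 (le_antisymm h1 (by positivity)))
    · by_contra hlt
      push Not at hlt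
      have hr : 1 < ‖T h‖ / q h := (one_lt_div h0).2 hlt
      have hbd : ∀ k : ℕ, (‖T h‖ / q h) ^ 2 ^ k ≤ (C * q' h) / q h := fun k => by
        rw [div_pow, div_le_div_iff₀ (by positivity) h0]
        exact hfin k
      -- A ratio greater than one has unbounded powers, which contradicts the uniform bound `hbd`.
      obtain ⟨n, hn⟩ := pow_unbounded_of_one_lt ((C * q' h) / q h) hr
      have := hbd n
      exact absurd (hn.trans_le (pow_le_pow_right₀ hr.le (Nat.lt_two_pow_self).le)) this.not_gt
  have e : ‖T h‖ = ‖T x‖ * ‖T x‖ := by rw [hh, hmul, hstar, CStarRing.norm_star_mul_self]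
  have : ‖T x‖ * ‖T x‖ ≤ q x * q x := by
    rw [← e]
    exact main.trans ((hq _ _).trans (mul_le_mul_of_nonneg_right (hqs x) (hq0 x)))
  exact abs_le_of_sq_le_sq' (by nlinarith) (hq0 x) |>.2

end AutomaticContractivity

/-! ### The sequence algebra is a `C*`-algebra -/

section SeqAlgebraCStar

variable {A : Type*} [NonUnitalCStarAlgebra A]

open StarIdeal.Quotient (mk)

namespace SeqAlgebra

theorem mk_eq_mk_iff {x y : lp (fun _ : ℕ => A) ∞} :
    (mk x : SeqAlgebra A) = mk y ↔
      Filter.Tendsto (fun n => ‖x n - y n‖) Filter.atTop (𝓝 0) :=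
  StarIdeal.Quotient.mk_eq_mk

/-- A representative of almost minimal norm differs from `x` by a null sequence. Together with
`norm_mk_le_of_eventually` this identifies the quotient norm with `limsup ‖x n‖`. -/
theorem eventually_norm_le {x : lp (fun _ : ℕ => A) ∞} {c : ℝ} (h : ‖(mk x : SeqAlgebra A)‖ ≤ c)
    {ε : ℝ} (hε : 0 < ε) : ∀ᶠ n in Filter.atTop, ‖x n‖ ≤ c + ε := by
  obtain ⟨y, hy, hy'⟩ := StarIdeal.Quotient.exists_norm_lt (mk x : SeqAlgebra A) (half_pos hε)
  have h0 := (mk_eq_mk_iff.1 hy).eventually (gt_mem_nhds (half_pos hε))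
  filter_upwards [h0] with n hn
  have h1 : ‖y n‖ ≤ ‖y‖ := lp.norm_apply_le_norm ENNReal.top_ne_zero y n
  have h2 : ‖x n‖ ≤ ‖y n‖ + ‖y n - x n‖ := by
    have := norm_sub_le (y n) (y n - x n)
    rwa [sub_sub_cancel] at this
  linarith

theorem norm_mk_le_of_eventually {x : lp (fun _ : ℕ => A) ∞} {c : ℝ} (hc : 0 ≤ c)
    (h : ∀ ε > 0, ∀ᶠ n in Filter.atTop, ‖x n‖ ≤ c + ε) : ‖(mk x : SeqAlgebra A)‖ ≤ c := by
  refine le_of_forall_pos_le_add fun ε hε => ?_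
  obtain ⟨N, hN⟩ := Filter.eventually_atTop.1 (h ε hε)
  have hb : ∀ n, ‖(if n < N then 0 else x n : A)‖ ≤ c + ε := fun n => by
    split_ifs with hn
    · rw [norm_zero]; positivity
    · exact hN n (not_lt.1 hn)
  -- Deleting the first `N` terms does not change the class, and leaves a sequence whose supremum is
  -- under control.
  let y : lp (fun _ : ℕ => A) ∞ := ⟨fun n => if n < N then 0 else x n,
    memℓp_infty ⟨c + ε, by rintro _ ⟨n, rfl⟩; exact hb n⟩⟩
  have e : (mk x : SeqAlgebra A) = mk y := by
    rw [mk_eq_mk_iff]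
    refine tendsto_const_nhds.congr' ?_
    filter_upwards [Filter.eventually_ge_atTop N] with n hn
    change (0 : ℝ) = ‖x n - (if n < N then 0 else x n : A)‖
    rw [if_neg (not_lt.2 hn), sub_self, norm_zero]
  rw [e]
  exact (StarIdeal.Quotient.norm_mk_le y).trans (lp.norm_le_of_forall_le (by positivity) hb)

instance : NormedAddCommGroup (SeqAlgebra A) :=
  { (inferInstance : SeminormedAddCommGroup (SeqAlgebra A)) with
    eq_of_dist_eq_zero := by
      intro x y hxy
      obtain ⟨x, rfl⟩ := StarIdeal.Quotient.mk_surjective x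
      obtain ⟨y, rfl⟩ := StarIdeal.Quotient.mk_surjective y
      rw [mk_eq_mk_iff, Metric.tendsto_nhds]
      intro ε hε
      have h0 : ‖(mk (x - y) : SeqAlgebra A)‖ ≤ 0 := by
        have e : dist (mk x : SeqAlgebra A) (mk y) = ‖(mk (x - y) : SeqAlgebra A)‖ :=
          dist_eq_norm _ _
        exact (e.symm.trans hxy).le
      filter_upwards [eventually_norm_le h0 (half_pos hε)] with n hn
      have hn' : ‖x n - y n‖ ≤ 0 + ε / 2 := hn
      rw [Real.dist_eq, sub_zero, abs_of_nonneg (norm_nonneg _)]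
      linarith }

instance : NonUnitalNormedRing (SeqAlgebra A) :=
  { (inferInstance : NormedAddCommGroup (SeqAlgebra A)),
    (inferInstance : NonUnitalSeminormedRing (SeqAlgebra A)) with }

instance : CompleteSpace (SeqAlgebra A) :=
  inferInstanceAs (CompleteSpace (lp (fun _ : ℕ => A) ∞ ⧸ (nullSequences A).toSubmodule))

instance : CStarRing (SeqAlgebra A) where
  norm_mul_self_le x := by
    obtain ⟨x, rfl⟩ := StarIdeal.Quotient.mk_surjective x
    rw [← StarIdeal.Quotient.mk_star, ← StarIdeal.Quotient.mk_mul]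
    have h0 := norm_nonneg (mk (star x * x) : SeqAlgebra A)
    rw [← sq, ← Real.le_sqrt (norm_nonneg _) h0]
    refine norm_mk_le_of_eventually (Real.sqrt_nonneg _) fun ε hε => ?_
    -- The tolerance is `ε ^ 2` because `N + ε² ≤ (√N + ε)²`.
    filter_upwards [eventually_norm_le (le_refl ‖(mk (star x * x) : SeqAlgebra A)‖)
      (show 0 < ε ^ 2 by positivity)] with n hn
    have hn' : ‖star (x n) * x n‖ ≤ ‖(mk (star x * x) : SeqAlgebra A)‖ + ε ^ 2 := hn
    rw [CStarRing.norm_star_mul_self] at hn'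
    refine abs_le_of_sq_le_sq' ?_ (by positivity) |>.2
    have := Real.sq_sqrt h0
    nlinarith [Real.sqrt_nonneg ‖(mk (star x * x) : SeqAlgebra A)‖]

instance : NonUnitalCStarAlgebra (SeqAlgebra A) where

end SeqAlgebra

end SeqAlgebraCStar

/-! ### Partitions of unity and vector-valued functions -/

section Density

variable {X : Type*} [TopologicalSpace X]
  {E : Type*} [NormedAddCommGroup E] [NormedSpace ℂ E]

variable (X E) in
/-- The bilinear map `(f, e) ↦ (x ↦ f(x) e)`. -/
def smulConst : C(X, ℂ) →ₗ[ℂ] E →ₗ[ℂ] C(X, E) :=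
  LinearMap.mk₂ ℂ (fun f e => ⟨fun x => f x • e, f.continuous.smul continuous_const⟩)
    (fun f g e => ContinuousMap.ext fun x => add_smul (f x) (g x) e)
    (fun c f e => ContinuousMap.ext fun x => smul_assoc c (f x) e)
    (fun f e e' => ContinuousMap.ext fun x => smul_add (f x) e e')
    (fun c f e => ContinuousMap.ext fun x => smul_comm (f x) c e)

theorem smulConst_apply (f : C(X, ℂ)) (e : E) (x : X) : smulConst X E f e x = f x • e := rfl

variable (X E) in
/-- The canonical map `C(X) ⊙ E → C(X, E)`. -/
def tensorToFun : C(X, ℂ) ⊗[ℂ] E →ₗ[ℂ] C(X, E) := TensorProduct.lift (smulConst X E)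

/-- A real-valued function, as a complex-valued one. -/
def realToComplex (h : C(X, ℝ)) : C(X, ℂ) := ⟨fun x => (h x : ℂ), by fun_prop⟩

/-- The difference is the convex combination of the vectors `F x - F j` with weights `h j x`, and
only indices with `F j` within `ε` of `F x` have nonzero weight. -/
theorem norm_sub_partition_sum_le (F : C(X, E)) {ε : ℝ} {s : Finset X} {h : X → C(X, ℝ)}
    (h0 : ∀ j x, 0 ≤ h j x) (h1 : ∀ x, ∑ j ∈ s, h j x = 1)
    (hF : ∀ j x, h j x ≠ 0 → ‖F x - F j‖ < ε) (x : X) :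
    ‖F x - ∑ j ∈ s, (h j x : ℂ) • F j‖ ≤ ε := by
  have e : F x - ∑ j ∈ s, (h j x : ℂ) • F j = ∑ j ∈ s, (h j x : ℂ) • (F x - F j) := by
    simp only [smul_sub, Finset.sum_sub_distrib]
    rw [← Finset.sum_smul, ← Complex.ofReal_sum, h1, Complex.ofReal_one, one_smul]
  rw [e]
  calc ‖∑ j ∈ s, (h j x : ℂ) • (F x - F j)‖ ≤ ∑ j ∈ s, h j x * ε := by
        refine norm_sum_le_of_le _ fun j _ => ?_
        rw [norm_smul, Complex.norm_real, Real.norm_of_nonneg (h0 j x)]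
        by_cases hx : h j x = 0
        · simp [hx]
        · exact mul_le_mul_of_nonneg_left (hF j x hx).le (h0 j x)
    _ = ε := by rw [← Finset.sum_mul, h1, one_mul]

variable [CompactSpace X]

theorem norm_smulConst (f : C(X, ℂ)) (e : E) : ‖smulConst X E f e‖ ≤ ‖f‖ * ‖e‖ := by
  rw [ContinuousMap.norm_le _ (by positivity)]
  intro x
  rw [smulConst_apply, norm_smul]
  exact mul_le_mul_of_nonneg_right (f.norm_coe_le_norm x) (norm_nonneg _)

variable [T2Space X]

/-- Partitions of unity that are subordinate to the `ε`-balls around the values of a function. -/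
theorem exists_partition (F : C(X, E)) {ε : ℝ} (hε : 0 < ε) :
    ∃ (s : Finset X) (h : X → C(X, ℝ)), (∀ j x, 0 ≤ h j x) ∧ (∀ x, ∑ j ∈ s, h j x = 1) ∧
      ∀ j x, h j x ≠ 0 → ‖F x - F j‖ < ε := by
  let U : X → Set X := fun j => {x | ‖F x - F j‖ < ε}
  have hU : ∀ j, IsOpen (U j) := fun j =>
    isOpen_lt ((F.continuous.sub continuous_const).norm) continuous_const
  have hcov : (Set.univ : Set X) ⊆ ⋃ j, U j := fun x _ =>
    Set.mem_iUnion.2 ⟨x, by simpa [U] using hε⟩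
  obtain ⟨p, hp⟩ := PartitionOfUnity.exists_isSubordinate isClosed_univ U hU hcov
  have hfin : (Set.univ ∩ {j | (Function.support (p j) ∩ Set.univ).Nonempty}).Finite := by
    have := p.locallyFinite.finite_nonempty_inter_compact isCompact_univ
    simpa using this
  have hfin' : {j | (Function.support (p j)).Nonempty}.Finite := by simpa using hfin
  refine ⟨hfin'.toFinset, fun j => p j, fun j x => p.nonneg j x, fun x => ?_, fun j x hx => ?_⟩
  · rw [← p.sum_eq_one (Set.mem_univ x)]
    refine (finsum_eq_sum_of_support_subset _ fun j hj => ?_).symm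
    rw [Set.Finite.coe_toFinset]
    exact ⟨x, hj⟩
  · exact hp j (subset_tsupport _ hx)

/-- A partition of unity adapted to `F` approximates `F` uniformly by `∑ h_j ⊗ F(j)`. -/
theorem denseRange_tensorToFun : DenseRange (tensorToFun X E) := by
  rw [Metric.denseRange_iff]
  intro F ε hε
  obtain ⟨s, h, h0, h1, hF⟩ := exists_partition F (half_pos hε)
  refine ⟨∑ j ∈ s, realToComplex (h j) ⊗ₜ F j, ?_⟩
  rw [dist_eq_norm, map_sum]
  refine lt_of_le_of_lt ?_ (half_lt_self hε)
  rw [ContinuousMap.norm_le _ (by positivity)]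
  intro x
  rw [ContinuousMap.sub_apply, ContinuousMap.sum_apply]
  exact norm_sub_partition_sum_le F h0 h1 hF x

/-- Continuous linear maps on `C(X, E)` are determined by their values on the functions
`x ↦ f(x) e`. -/
theorem continuousLinearMap_ext {Y : Type*} [NormedAddCommGroup Y] [NormedSpace ℂ Y]
    {S T : C(X, E) →L[ℂ] Y} (h : ∀ f e, S (smulConst X E f e) = T (smulConst X E f e)) :
    S = T := by
  have h2 : (S : C(X, E) →ₗ[ℂ] Y) ∘ₗ tensorToFun X E =
      (T : C(X, E) →ₗ[ℂ] Y) ∘ₗ tensorToFun X E := TensorProduct.ext' h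
  refine ContinuousLinearMap.coe_injective (LinearMap.ext fun F => ?_)
  exact congrFun (denseRange_tensorToFun.equalizer S.continuous T.continuous
    (funext fun x => LinearMap.congr_fun h2 x)) F

end Density

/-! ### Integration over a compact group -/

section Haar

variable {G : Type*} [Group G] [TopologicalSpace G] [IsTopologicalGroup G] [CompactSpace G]
  [SecondCountableTopology G] [MeasurableSpace G] [BorelSpace G]
  (μ : Measure G) [μ.IsHaarMeasure] [IsProbabilityMeasure μ]
  {E : Type*} [NormedAddCommGroup E] [NormedSpace ℝ E] [CompleteSpace E]

/-- Unimodularity by Fubini: integrating `f(s⁻¹ t)` over `t` first gives `∫ f`, over `s` first gives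
`∫ f(s⁻¹) ds`, and the remaining integration has total mass one. -/
theorem integral_inv_of_continuous {f : G → E} (hf : Continuous f) :
    ∫ t, f t⁻¹ ∂μ = ∫ t, f t ∂μ := by
  have h1 : ∀ s, ∫ t, f (s⁻¹ * t) ∂μ = ∫ t, f t ∂μ := fun s => integral_mul_left_eq_self f s⁻¹
  have h2 : ∀ t, ∫ s, f (s⁻¹ * t) ∂μ = ∫ s, f s⁻¹ ∂μ := fun t => by
    rw [← integral_mul_left_eq_self (fun s => f (s⁻¹ * t)) t]
    simp
  have h3 : ∫ s, ∫ t, f (s⁻¹ * t) ∂μ ∂μ = ∫ t, ∫ s, f (s⁻¹ * t) ∂μ ∂μ :=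
    integral_integral_swap_of_hasCompactSupport (f := fun s t => f (s⁻¹ * t))
      (hf.comp (continuous_fst.inv.mul continuous_snd)) (HasCompactSupport.of_compactSpace _)
  simp_rw [h1, h2] at h3
  simpa using h3.symm

theorem integral_inv_mul_of_continuous {f : G → E} (hf : Continuous f) (t : G) :
    ∫ s, f (s⁻¹ * t) ∂μ = ∫ s, f s ∂μ := by
  rw [← integral_inv_of_continuous μ hf, ← integral_mul_left_eq_self (fun s => f (s⁻¹ * t)) t]
  simp

/-- A form of the dominated convergence theorem for upper limits. -/
theorem eventually_integral_le {h : ℕ → G → ℝ} (hc : ∀ n, Continuous (h n)) {C : ℝ}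
    (hC : ∀ n s, |h n s| ≤ C) {M : ℝ}
    (hM : ∀ s, ∀ ε > 0, ∀ᶠ n in Filter.atTop, h n s ≤ M + ε) {ε : ℝ} (hε : 0 < ε) :
    ∀ᶠ n in Filter.atTop, ∫ s, h n s ∂μ ≤ M + ε := by
  -- Only an upper bound is known, so dominated convergence is applied to the positive part of `h n
  -- - M`, which tends to `0` pointwise.
  have ht : Filter.Tendsto (fun n => ∫ s, max (h n s - M) 0 ∂μ) Filter.atTop
      (𝓝 (∫ _, (0 : ℝ) ∂μ)) := by
    refine tendsto_integral_of_dominated_convergence (fun _ => C + |M|)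
      (fun n => (((hc n).sub continuous_const).max continuous_const).aestronglyMeasurable)
      (integrable_const _) (fun n => ?_) ?_
    · filter_upwards with s
      rw [Real.norm_of_nonneg (le_max_right _ _)]
      refine max_le ?_ (by have := (abs_nonneg _).trans (hC n s); positivity)
      have := neg_abs_le M
      have := (le_abs_self _).trans (hC n s)
      linarith
    · filter_upwards with s
      rw [Metric.tendsto_nhds]
      intro δ hδ
      filter_upwards [hM s (δ / 2) (half_pos hδ)] with n hn
      rw [Real.dist_eq, sub_zero, abs_of_nonneg (le_max_right _ _)]
      exact (max_le (by linarith) (by positivity) : _ ≤ δ / 2).trans_lt (half_lt_self hδ)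
  rw [integral_zero] at ht
  filter_upwards [ht.eventually (gt_mem_nhds hε)] with n hn
  have i1 : Integrable (h n) μ := ConvAlg.integrable_of_continuous (hc n)
  have i2 : Integrable (fun s => max (h n s - M) 0) μ :=
    ConvAlg.integrable_of_continuous (((hc n).sub continuous_const).max continuous_const)
  calc ∫ s, h n s ∂μ ≤ ∫ s, (M + max (h n s - M) 0) ∂μ := by
        refine integral_mono i1 ((integrable_const _).add i2) fun s => ?_
        have := le_max_left (h n s - M) 0
        change h n s ≤ M + max (h n s - M) 0
        linarith
    _ = M + ∫ s, max (h n s - M) 0 ∂μ := by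
        rw [integral_add (integrable_const _) i2]; simp
    _ ≤ M + ε := by linarith

end Haar

/-! ### The universal property of `C(X, A)` -/

section CauchySchwarz

/-- The Cauchy–Schwarz inequality in the column module over a `C*`-algebra. -/
theorem norm_sum_star_mul_sq_le {D : Type*} [NonUnitalCStarAlgebra D] {ι : Type*} (s : Finset ι)
    (x y : ι → D) :
    ‖∑ i ∈ s, star (x i) * y i‖ ^ 2 ≤
      ‖∑ i ∈ s, star (x i) * x i‖ * ‖∑ i ∈ s, star (y i) * y i‖ := by
  let _ := CStarAlgebra.spectralOrder D
  have := CStarAlgebra.spectralOrderedRing D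
  -- The inner product of the module is `∑ v_i u_i*`; the stars in `u` and `v` turn it into `∑ x_i*
  -- y_i`.
  let u : WithCStarModule D (s → D) := (WithCStarModule.equiv D (s → D)).symm fun i => star (y i)
  let v : WithCStarModule D (s → D) := (WithCStarModule.equiv D (s → D)).symm fun i => star (x i)
  have h := CStarModule.norm_inner_le (A := D) (WithCStarModule D (s → D)) (x := u) (y := v)
  have hu : ‖u‖ ^ 2 = ‖∑ i ∈ s, star (y i) * y i‖ := by
    rw [WithCStarModule.pi_norm_sq, ← Finset.sum_coe_sort s]
    simp [u, WithCStarModule.inner_def]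
  have hv : ‖v‖ ^ 2 = ‖∑ i ∈ s, star (x i) * x i‖ := by
    rw [WithCStarModule.pi_norm_sq, ← Finset.sum_coe_sort s]
    simp [v, WithCStarModule.inner_def]
  have huv : inner D u v = ∑ i ∈ s, star (x i) * y i := by
    rw [WithCStarModule.pi_inner, ← Finset.sum_coe_sort s]
    simp [u, v, WithCStarModule.inner_def]
  rw [huv] at h
  calc _ ≤ (‖u‖ * ‖v‖) ^ 2 := by gcongr
    _ = _ := by rw [mul_pow, hu, hv, mul_comm]

end CauchySchwarz

section FunctionAlgebra

variable {X : Type*} [TopologicalSpace X] [CompactSpace X] [T2Space X]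

theorem continuousMap_induction {E : Type*} [NormedAddCommGroup E] [NormedSpace ℂ E]
    {P : C(X, E) → Prop} (hcl : IsClosed {F | P F})
    (hadd : ∀ F F', P F → P F' → P (F + F')) (hsmul : ∀ f e, P (smulConst X E f e))
    (F : C(X, E)) : P F := by
  refine denseRange_tensorToFun.induction_on (p := P) F hcl fun x => ?_
  induction x using TensorProduct.induction_on with
  | zero =>
    have := hsmul 0 0
    rwa [map_zero] at this
  | tmul f e => exact hsmul f e
  | add x y hx hy =>
    rw [map_add]
    exact hadd _ _ hx hy

variable {A D : Type*} [NonUnitalCStarAlgebra A] [NonUnitalCStarAlgebra D]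

/-- A bilinear map `C(X) × A → D` that is multiplicative and star-preserving, like the one given by
a pair of commuting `*`-homomorphisms. -/
structure CommutingPair (θ : C(X, ℂ) →ₗ[ℂ] A →ₗ[ℂ] D) : Prop where
  mul_apply : ∀ f g a b, θ f a * θ g b = θ (f * g) (a * b)
  star_apply : ∀ f a, star (θ f a) = θ (star f) (star a)

namespace CommutingPair

variable {θ : C(X, ℂ) →ₗ[ℂ] A →ₗ[ℂ] D}

theorem norm_one_apply_le (hθ : CommutingPair θ) (a : A) : ‖θ 1 a‖ ≤ ‖a‖ := by
  let T : A →⋆ₙₐ[ℂ] D :=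
    { toFun := θ 1
      map_smul' := fun c a => map_smul (θ 1) c a
      map_zero' := map_zero (θ 1)
      map_add' := map_add (θ 1)
      map_mul' := fun a b => by rw [hθ.mul_apply, one_mul]
      map_star' := fun a => by rw [hθ.star_apply, star_one] }
  exact NonUnitalStarAlgHom.norm_apply_le T a

/-- With `g = √(1 - |f|²)` one has `θ(f,a)* θ(f,a) + θ(g,a)* θ(g,a) = θ(1, a* a)`, so the first
summand is dominated by `θ(1, a* a)`, whose norm is at most `‖a‖²`. -/
theorem norm_apply_le_of_norm_le_one (hθ : CommutingPair θ) (f : C(X, ℂ)) (hf : ‖f‖ ≤ 1) (a : A) :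
    ‖θ f a‖ ≤ ‖a‖ := by
  let _ := CStarAlgebra.spectralOrder D
  have := CStarAlgebra.spectralOrderedRing D
  let g : C(X, ℂ) := ⟨fun x => ((√(1 - ‖f x‖ ^ 2) : ℝ) : ℂ), by fun_prop⟩
  have hg : star f * f + star g * g = 1 := by
    ext x
    have h1 : ‖f x‖ ≤ 1 := (f.norm_coe_le_norm x).trans hf
    have h2 : 0 ≤ 1 - ‖f x‖ ^ 2 := by nlinarith [norm_nonneg (f x)]
    have e1 : star (f x) * f x = ((‖f x‖ ^ 2 : ℝ) : ℂ) := by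
      rw [Complex.star_def, ← Complex.normSq_eq_conj_mul_self, Complex.normSq_eq_norm_sq]
    have e2 : star (g x) * g x = ((1 - ‖f x‖ ^ 2 : ℝ) : ℂ) := by
      change star ((√(1 - ‖f x‖ ^ 2) : ℝ) : ℂ) * ((√(1 - ‖f x‖ ^ 2) : ℝ) : ℂ) = _
      rw [Complex.star_def, Complex.conj_ofReal, ← Complex.ofReal_mul, Real.mul_self_sqrt h2]
    change star (f x) * f x + star (g x) * g x = 1
    rw [e1, e2, ← Complex.ofReal_add]
    norm_num
  have key : star (θ f a) * θ f a + star (θ g a) * θ g a = θ 1 (star a * a) := by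
    rw [hθ.star_apply, hθ.star_apply, hθ.mul_apply, hθ.mul_apply,
      ← LinearMap.add_apply, ← map_add, hg]
  have hle : star (θ f a) * θ f a ≤ θ 1 (star a * a) := by
    rw [← key]
    exact le_add_of_nonneg_right (star_mul_self_nonneg _)
  have hn := CStarAlgebra.norm_le_norm_of_nonneg_of_le (star_mul_self_nonneg _) hle
  have hn' := hn.trans (hθ.norm_one_apply_le _)
  rw [CStarRing.norm_star_mul_self, CStarRing.norm_star_mul_self] at hn'
  exact abs_le_of_sq_le_sq' (by nlinarith) (norm_nonneg a) |>.2

theorem norm_apply_le (hθ : CommutingPair θ) (f : C(X, ℂ)) (a : A) : ‖θ f a‖ ≤ ‖f‖ * ‖a‖ := by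
  rcases (norm_nonneg f).eq_or_lt with h0 | h0
  · have : f = 0 := norm_eq_zero.1 h0.symm
    simp [this]
  · have h1 : ‖((‖f‖⁻¹ : ℝ) : ℂ) • f‖ ≤ 1 := by
      rw [norm_smul, Complex.norm_real, Real.norm_of_nonneg (by positivity),
        inv_mul_cancel₀ h0.ne']
    have h2 := hθ.norm_apply_le_of_norm_le_one _ h1 a
    rw [map_smul, LinearMap.smul_apply, norm_smul, Complex.norm_real,
      Real.norm_of_nonneg (by positivity), inv_mul_le_iff₀ h0] at h2
    exact h2

theorem continuous_apply (hθ : CommutingPair θ) (f : C(X, ℂ)) : Continuous (θ f) :=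
  AddMonoidHomClass.continuous_of_bound (θ f) ‖f‖ (hθ.norm_apply_le f)

/-- Write `h_j = g_j²` with `g_j = √h_j`. Then `θ(h_j, c* a_j b) = θ(g_j, c)* θ(g_j, a_j b)`, and
Cauchy–Schwarz bounds the sum by the norms of two columns, which are at most `1` and `M`. The outer
factors `c` and `b` stand in for a unit, which `A` need not have. -/
theorem norm_partition_conj_le (hθ : CommutingPair θ) {s : Finset X} {h : X → C(X, ℝ)}
    (h0 : ∀ j x, 0 ≤ h j x)
    (h1 : ∀ x, ∑ j ∈ s, h j x = 1) {a : X → A} {M : ℝ} (hM : 0 ≤ M) (ha : ∀ j, ‖a j‖ ≤ M) {b c : A}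
    (hb : ‖b‖ ≤ 1) (hc : ‖c‖ ≤ 1) :
    ‖∑ j ∈ s, θ (realToComplex (h j)) (star c * (a j * b))‖ ≤ M := by
  let _ := CStarAlgebra.spectralOrder D
  have := CStarAlgebra.spectralOrderedRing D
  let _ := CStarAlgebra.spectralOrder A
  have := CStarAlgebra.spectralOrderedRing A
  let g : X → C(X, ℂ) := fun j => realToComplex ⟨fun x => √(h j x), by fun_prop⟩
  have hg : ∀ j, star (g j) * g j = realToComplex (h j) := fun j => by
    ext x
    change star ((√(h j x) : ℝ) : ℂ) * ((√(h j x) : ℝ) : ℂ) = (h j x : ℂ)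
    rw [Complex.star_def, Complex.conj_ofReal, ← Complex.ofReal_mul, Real.mul_self_sqrt (h0 j x)]
  have hsum : ∑ j ∈ s, realToComplex (h j) = 1 := by
    ext x
    rw [ContinuousMap.sum_apply]
    change ∑ j ∈ s, (h j x : ℂ) = 1
    rw [← Complex.ofReal_sum, h1, Complex.ofReal_one]
  have hθg : ∀ j (d d' : A), star (θ (g j) d) * θ (g j) d' =
      θ (realToComplex (h j)) (star d * d') := fun j d d' => by rw [hθ.star_apply, hθ.mul_apply, hg]
  have hcs := norm_sum_star_mul_sq_le s (fun j => θ (g j) c) (fun j => θ (g j) (a j * b))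
  simp only [hθg] at hcs
  have n1 : ‖∑ j ∈ s, θ (realToComplex (h j)) (star c * c)‖ ≤ 1 := by
    rw [← LinearMap.sum_apply, ← map_sum, hsum]
    refine (hθ.norm_one_apply_le _).trans ?_
    rw [CStarRing.norm_star_mul_self]
    nlinarith [norm_nonneg c]
  have n2 : ‖∑ j ∈ s, θ (realToComplex (h j)) (star (a j * b) * (a j * b))‖ ≤ M ^ 2 := by
    -- Since `a_j* a_j ≤ M²`, each argument is at most `M² b* b`, and then the `h_j` can be summed
    -- to `1`.
    have le1 : ∑ j ∈ s, θ (realToComplex (h j)) (star (a j * b) * (a j * b)) ≤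
        ∑ j ∈ s, θ (realToComplex (h j)) (((M ^ 2 : ℝ) : ℂ) • (star b * b)) := by
      refine Finset.sum_le_sum fun j _ => ?_
      have e : star (a j * b) * (a j * b) = star b * (star (a j) * a j) * b := by
        rw [star_mul]; simp only [mul_assoc]
      have l1 : star (a j * b) * (a j * b) ≤ ((M ^ 2 : ℝ) : ℂ) • (star b * b) := by
        rw [e]
        refine (CStarAlgebra.star_left_conjugate_le_norm_smul (.star_mul_self (a j))).trans ?_
        rw [Complex.coe_smul]
        refine smul_le_smul_of_nonneg_right ?_ (star_mul_self_nonneg b)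
        rw [CStarRing.norm_star_mul_self]
        nlinarith [norm_nonneg (a j), ha j]
      -- `θ(h_j, ·)` is positive, because `θ(h_j, d* d) = θ(g_j, d)* θ(g_j, d)`.
      obtain ⟨d, hd⟩ := CStarAlgebra.nonneg_iff_eq_star_mul_self.1 (sub_nonneg.2 l1)
      rw [← sub_nonneg, ← map_sub, hd, ← hθg]
      exact star_mul_self_nonneg _
    refine (CStarAlgebra.norm_le_norm_of_nonneg_of_le
      (Finset.sum_nonneg fun j _ => ?_) le1).trans ?_
    · rw [← hθg]
      exact star_mul_self_nonneg _
    · rw [← LinearMap.sum_apply, ← map_sum, hsum]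
      refine (hθ.norm_one_apply_le _).trans ?_
      rw [norm_smul, CStarRing.norm_star_mul_self, Complex.norm_real,
        Real.norm_of_nonneg (by positivity)]
      have : ‖b‖ * ‖b‖ ≤ 1 := by nlinarith [norm_nonneg b]
      nlinarith [sq_nonneg M]
  refine abs_le_of_sq_le_sq' ?_ hM |>.2
  calc _ ≤ _ := hcs
    _ ≤ 1 * M ^ 2 := mul_le_mul n1 n2 (norm_nonneg _) zero_le_one
    _ = M ^ 2 := one_mul _

/-- The factors `c` and `b` of `norm_partition_conj_le` are removed by letting them run, one after
the other, through an approximate unit. -/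
theorem norm_partition_sum_le (hθ : CommutingPair θ) {s : Finset X} {h : X → C(X, ℝ)}
    (h0 : ∀ j x, 0 ≤ h j x)
    (h1 : ∀ x, ∑ j ∈ s, h j x = 1) {a : X → A} {M : ℝ} (hM : 0 ≤ M) (ha : ∀ j, ‖a j‖ ≤ M) :
    ‖∑ j ∈ s, θ (realToComplex (h j)) (a j)‖ ≤ M := by
  let _ := CStarAlgebra.spectralOrder A
  have := CStarAlgebra.spectralOrderedRing A
  have hl := CStarAlgebra.increasingApproximateUnit A
  have step : ∀ b : A, ‖b‖ ≤ 1 → ‖∑ j ∈ s, θ (realToComplex (h j)) (a j * b)‖ ≤ M := by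
    intro b hb
    have ht : Filter.Tendsto (fun c => ‖∑ j ∈ s, θ (realToComplex (h j)) (c * (a j * b))‖)
        (CStarAlgebra.approximateUnit A) (𝓝 ‖∑ j ∈ s, θ (realToComplex (h j)) (a j * b)‖) :=
      (tendsto_finsetSum _ fun j _ => ((hθ.continuous_apply _).tendsto _).comp
        (hl.tendsto_mul_right (a j * b))).norm
    refine le_of_tendsto ht ?_
    filter_upwards [hl.eventually_norm, hl.eventually_star_eq] with c hc hc'
    have := hθ.norm_partition_conj_le h0 h1 hM ha hb hc
    rwa [hc'] at this
  have ht : Filter.Tendsto (fun b => ‖∑ j ∈ s, θ (realToComplex (h j)) (a j * b)‖)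
      (CStarAlgebra.approximateUnit A) (𝓝 ‖∑ j ∈ s, θ (realToComplex (h j)) (a j)‖) :=
    (tendsto_finsetSum _ fun j _ => ((hθ.continuous_apply _).tendsto _).comp
      (hl.tendsto_mul_left (a j))).norm
  refine le_of_tendsto ht ?_
  filter_upwards [hl.eventually_norm] with b hb
  exact step b hb

/-- This is the contractivity behind the universal property of `C(X, A)`. A sufficiently fine
partition of unity changes the image of `x` by at most `ε` if `x` is replaced by `∑ h_j ⊗ x(j)`, and
for sums of the latter form the bound is `norm_partition_sum_le`. -/
theorem norm_lift_le (hθ : CommutingPair θ) (x : C(X, ℂ) ⊗[ℂ] A) :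
    ‖TensorProduct.lift θ x‖ ≤ ‖tensorToFun X A x‖ := by
  obtain ⟨S, hS⟩ := TensorProduct.exists_finset x
  refine le_of_forall_pos_le_add fun ε hε => ?_
  set K : ℝ := ∑ i ∈ S, ‖i.2‖ with hK
  have hK0 : 0 ≤ K := Finset.sum_nonneg fun _ _ => norm_nonneg _
  set δ : ℝ := ε / (K + 1) with hδ
  have hδ0 : 0 < δ := by positivity
  -- The finitely many scalar functions occurring in `x` are bundled into one function to `ℂ^S`, so
  -- that a single partition of unity serves all of them.
  let F : C(X, S → ℂ) := ContinuousMap.pi fun i => i.1.1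
  obtain ⟨s, h, h0, h1, hF⟩ := exists_partition F hδ0
  have happ : ∀ i ∈ S, ‖i.1 - ∑ j ∈ s, i.1 j • realToComplex (h j)‖ ≤ δ := by
    intro i hi
    rw [ContinuousMap.norm_le _ hδ0.le]
    intro t
    have hb := (norm_le_pi_norm (F t - ∑ j ∈ s, (h j t : ℂ) • F j) ⟨i, hi⟩).trans
      (norm_sub_partition_sum_le F h0 h1 hF t)
    have e : (i.1 - ∑ j ∈ s, i.1 j • realToComplex (h j)) t =
        (F t - ∑ j ∈ s, (h j t : ℂ) • F j) ⟨i, hi⟩ := by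
      rw [ContinuousMap.sub_apply, ContinuousMap.sum_apply, Pi.sub_apply, Finset.sum_apply]
      exact congrArg (i.1 t - ·) (Finset.sum_congr rfl fun j _ => mul_comm _ _)
    rw [e]
    exact hb
  have e1 : TensorProduct.lift θ x - ∑ j ∈ s, θ (realToComplex (h j)) (tensorToFun X A x j) =
      ∑ i ∈ S, θ (i.1 - ∑ j ∈ s, i.1 j • realToComplex (h j)) i.2 := by
    have l1 : TensorProduct.lift θ x = ∑ i ∈ S, θ i.1 i.2 := by
      rw [hS, map_sum]
      rfl
    have l2 : ∀ j, tensorToFun X A x j = ∑ i ∈ S, i.1 j • i.2 := fun j => by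
      rw [hS, map_sum, ContinuousMap.sum_apply]
      rfl
    simp only [l1, l2, map_sum, map_smul, map_sub, LinearMap.sub_apply, LinearMap.sum_apply,
      LinearMap.smul_apply, Finset.sum_sub_distrib]
    rw [Finset.sum_comm]
  have n1 : ‖TensorProduct.lift θ x -
      ∑ j ∈ s, θ (realToComplex (h j)) (tensorToFun X A x j)‖ ≤ ε := by
    rw [e1]
    calc _ ≤ ∑ i ∈ S, δ * ‖i.2‖ := norm_sum_le_of_le _ fun i hi =>
          (hθ.norm_apply_le _ _).trans
            (mul_le_mul_of_nonneg_right (happ i hi) (norm_nonneg _))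
      _ = ε * (K / (K + 1)) := by rw [← Finset.mul_sum, ← hK, hδ]; ring
      _ ≤ ε * 1 := by gcongr; rw [div_le_one (by positivity)]; linarith
      _ = ε := mul_one _
  have n2 := hθ.norm_partition_sum_le h0 h1 (a := fun j => tensorToFun X A x j)
    (norm_nonneg _) fun j => ContinuousMap.norm_coe_le_norm _ j
  calc ‖TensorProduct.lift θ x‖ ≤
        ‖∑ j ∈ s, θ (realToComplex (h j)) (tensorToFun X A x j)‖ + ‖TensorProduct.lift θ x -
          ∑ j ∈ s, θ (realToComplex (h j)) (tensorToFun X A x j)‖ := norm_le_insert' _ _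
    _ ≤ _ := add_le_add n2 n1

/-- The universal property of `C(X) ⊗ A = C(X, A)`. -/
theorem exists_hom (hθ : CommutingPair θ) :
    ∃ ψ : C(X, A) →⋆ₙₐ[ℂ] D, ∀ f a, ψ (smulConst X A f a) = θ f a := by
  let T : C(X, A) →L[ℂ] D := (TensorProduct.lift θ).extendOfNorm (tensorToFun X A)
  have hT : ∀ f a, T (smulConst X A f a) = θ f a := fun f a =>
    LinearMap.extendOfNorm_eq (denseRange_tensorToFun (X := X) (E := A))
      ⟨1, fun x => by rw [one_mul]; exact hθ.norm_lift_le x⟩ (f ⊗ₜ a)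
  have hsm : ∀ f g a b, smulConst X A f a * smulConst X A g b =
      smulConst X A (f * g) (a * b) := fun f g a b => ContinuousMap.ext fun x =>
    smul_mul_smul_comm (f x) a (g x) b
  have hss : ∀ f a, star (smulConst X A f a) = smulConst X A (star f) (star a) :=
    fun f a => ContinuousMap.ext fun x => star_smul (f x) a
  refine ⟨{ toFun := T
            map_smul' := fun c x => map_smul T c x
            map_zero' := map_zero T
            map_add' := map_add T
            map_mul' := fun F F' => ?_
            map_star' := fun F => ?_ }, hT⟩
  · induction F using continuousMap_induction with
    | hcl => exact isClosed_eq (by fun_prop) (by fun_prop)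
    | hadd F₁ F₂ h₁ h₂ => rw [add_mul, map_add, h₁, h₂, map_add, add_mul]
    | hsmul f a =>
      induction F' using continuousMap_induction with
      | hcl => exact isClosed_eq (by fun_prop) (by fun_prop)
      | hadd F₁ F₂ h₁ h₂ => rw [mul_add, map_add, h₁, h₂, map_add, mul_add]
      | hsmul g b => rw [hsm, hT, hT, hT, hθ.mul_apply]
  · induction F using continuousMap_induction with
    | hcl => exact isClosed_eq (by fun_prop) (by fun_prop)
    | hadd F₁ F₂ h₁ h₂ => rw [star_add, map_add, h₁, h₂, map_add, star_add]
    | hsmul f a => rw [hss, hT, hT, hθ.star_apply]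

end CommutingPair

end FunctionAlgebra

/-! ### The action of the central sequence algebra on `A` -/

section CentralAction

variable {A : Type*} [NonUnitalCStarAlgebra A]

open StarIdeal.Quotient (mk)

theorem relCommutant_comm (x : relCommutant A) (a : A) :
    toSeqAlgebra A a * (x : SeqAlgebra A) = (x : SeqAlgebra A) * toSeqAlgebra A a :=
  ((NonUnitalStarSubalgebra.mem_centralizer_iff ℂ).1 x.2 _ ⟨a, rfl⟩).1

variable (A) in
/-- The product `(x, a) ↦ x a`, for `x ∈ A_∞ ∩ A'` and `a ∈ A`. -/
def commutantMul : relCommutant A →ₗ[ℂ] A →ₗ[ℂ] SeqAlgebra A :=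
  LinearMap.mk₂ ℂ (fun x a => (x : SeqAlgebra A) * toSeqAlgebra A a)
    (fun x y a => by simp [add_mul]) (fun c x a => by simp [smul_mul_assoc])
    (fun x a b => by simp [mul_add]) (fun c x a => by simp [mul_smul_comm])

variable (A) in
/-- The product `F_∞(A) × A → A_∞`. -/
def centralMul : CentralSeqAlgebra A →ₗ[ℂ] A →ₗ[ℂ] SeqAlgebra A :=
  (annihilator A).toSubmodule.liftQ (commutantMul A) fun _ hx =>
    LinearMap.ext fun a => (hx a).1

theorem centralMul_mk (x : relCommutant A) (a : A) :
    centralMul A (mk x) a = (x : SeqAlgebra A) * toSeqAlgebra A a := rfl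

/-- Representatives of `F_∞(A)` commute with `A`, so `x a y b = x y a b`. This makes multiplication
into `A` behave like a pair of commuting `*`-homomorphisms. -/
theorem centralMul_mul (x y : CentralSeqAlgebra A) (a b : A) :
    centralMul A x a * centralMul A y b = centralMul A (x * y) (a * b) := by
  obtain ⟨x, rfl⟩ := StarIdeal.Quotient.mk_surjective x
  obtain ⟨y, rfl⟩ := StarIdeal.Quotient.mk_surjective y
  rw [← StarIdeal.Quotient.mk_mul, centralMul_mk, centralMul_mk, centralMul_mk, map_mul]
  rw [NonUnitalStarSubalgebra.coe_mul]
  simp only [mul_assoc]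
  rw [← mul_assoc (toSeqAlgebra A a), relCommutant_comm, mul_assoc]

theorem centralMul_star (x : CentralSeqAlgebra A) (a : A) :
    star (centralMul A x a) = centralMul A (star x) (star a) := by
  obtain ⟨x, rfl⟩ := StarIdeal.Quotient.mk_surjective x
  rw [← StarIdeal.Quotient.mk_star, centralMul_mk, centralMul_mk, star_mul, ← map_star,
    ← relCommutant_comm]
  rfl

variable (A) in
-- Separability replaces the canonical approximate unit by a sequence: `e n` is chosen to work up to
-- `1/(n+1)` for the first `n` members of a dense sequence, and the bound `‖e n‖ ≤ 1` extends the
-- convergence to all of `A`.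
theorem exists_sequential_approximateUnit [TopologicalSpace.SeparableSpace A] :
    ∃ e : ℕ → A, (∀ n, ‖e n‖ ≤ 1) ∧
      ∀ a, Filter.Tendsto (fun n => ‖e n * a - a‖) Filter.atTop (𝓝 0) ∧
      Filter.Tendsto (fun n => ‖a * e n - a‖) Filter.atTop (𝓝 0) := by
  let _ := CStarAlgebra.spectralOrder A
  have := CStarAlgebra.spectralOrderedRing A
  have hl := CStarAlgebra.increasingApproximateUnit A
  have : Nonempty A := ⟨0⟩
  let d := TopologicalSpace.denseSeq A
  have hd : DenseRange d := TopologicalSpace.denseRange_denseSeq A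
  have hex : ∀ n : ℕ, ∃ e : A, ‖e‖ ≤ 1 ∧ ∀ k ∈ Finset.range n,
      ‖e * d k - d k‖ < 1 / ((n : ℝ) + 1) ∧ ‖d k * e - d k‖ < 1 / ((n : ℝ) + 1) := by
    intro n
    have hn : 0 < 1 / ((n : ℝ) + 1) := by positivity
    have h1 : ∀ k ∈ Finset.range n, ∀ᶠ e in CStarAlgebra.approximateUnit A,
        ‖e * d k - d k‖ < 1 / ((n : ℝ) + 1) ∧ ‖d k * e - d k‖ < 1 / ((n : ℝ) + 1) := by
      intro k _
      have t1 := (tendsto_iff_norm_sub_tendsto_zero.1 (hl.tendsto_mul_right (d k))).eventually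
        (gt_mem_nhds hn)
      have t2 := (tendsto_iff_norm_sub_tendsto_zero.1 (hl.tendsto_mul_left (d k))).eventually
        (gt_mem_nhds hn)
      exact t1.and t2
    exact (hl.eventually_norm.and ((Filter.eventually_all_finset _).2 h1)).exists
  choose e he1 he2 using hex
  have aux : ∀ T : ℕ → A →ₗ[ℂ] A, (∀ n a, ‖T n a‖ ≤ ‖a‖) →
      (∀ n, ∀ k ∈ Finset.range n, ‖T n (d k) - d k‖ < 1 / ((n : ℝ) + 1)) →
      ∀ a, Filter.Tendsto (fun n => ‖T n a - a‖) Filter.atTop (𝓝 0) := by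
    intro T hT hk a
    rw [Metric.tendsto_nhds]
    intro ε hε
    obtain ⟨k, hk'⟩ := Metric.denseRange_iff.1 hd a (ε / 4) (by positivity)
    have h0 := (tendsto_one_div_add_atTop_nhds_zero_nat (𝕜 := ℝ)).eventually
      (gt_mem_nhds (show 0 < ε / 4 by positivity))
    filter_upwards [h0, Filter.eventually_gt_atTop k] with n hn hkn
    rw [Real.dist_eq, sub_zero, abs_of_nonneg (norm_nonneg _)]
    have e1 : T n a - a = T n (a - d k) + (T n (d k) - d k) + (d k - a) := by
      rw [map_sub]; abel
    rw [dist_eq_norm] at hk'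
    have hk2 := norm_sub_rev a (d k)
    have h3 := hk n k (Finset.mem_range.2 hkn)
    calc ‖T n a - a‖ ≤ ‖T n (a - d k)‖ + ‖T n (d k) - d k‖ + ‖d k - a‖ := by
          rw [e1]; exact norm_add₃_le
      _ < ε := by linarith [hT n (a - d k)]
  refine ⟨e, he1, fun a => ⟨?_, ?_⟩⟩
  · refine aux (fun n => LinearMap.mulLeft ℂ (e n)) (fun n a => ?_) (fun n k hk => (he2 n k hk).1) a
    exact (norm_mul_le _ _).trans (mul_le_of_le_one_left (norm_nonneg _) (he1 n))
  · refine aux (fun n => LinearMap.mulRight ℂ (e n)) (fun n a => ?_)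
      (fun n k hk => (he2 n k hk).2) a
    exact (norm_mul_le _ _).trans (mul_le_of_le_one_right (norm_nonneg _) (he1 n))

variable (A) in
/-- The central sequence algebra of a separable `C*`-algebra has a unit, which is represented by an
approximate unit. -/
theorem exists_central_unit [TopologicalSpace.SeparableSpace A] :
    ∃ e : relCommutant A, ∀ a, (e : SeqAlgebra A) * toSeqAlgebra A a = toSeqAlgebra A a := by
  obtain ⟨e, he1, he⟩ := exists_sequential_approximateUnit A
  let x : lp (fun _ : ℕ => A) ∞ := ⟨e, memℓp_infty ⟨1, by rintro _ ⟨n, rfl⟩; exact he1 n⟩⟩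
  have h1 : ∀ a, (mk x : SeqAlgebra A) * toSeqAlgebra A a = toSeqAlgebra A a := fun a =>
    SeqAlgebra.mk_eq_mk_iff.2 (he a).1
  have h2 : ∀ a, toSeqAlgebra A a * (mk x : SeqAlgebra A) = toSeqAlgebra A a := fun a =>
    SeqAlgebra.mk_eq_mk_iff.2 (he a).2
  refine ⟨⟨mk x, (NonUnitalStarSubalgebra.mem_centralizer_iff ℂ).2 ?_⟩, h1⟩
  rintro _ ⟨a, rfl⟩
  rw [← map_star]
  exact ⟨by rw [h1, h2], by rw [h1, h2]⟩

end CentralAction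

/-! ### The Rokhlin property and equivariant `*`-homomorphisms to the sequence algebra -/

namespace CStarAction

variable {G A : Type*} [Group G] [TopologicalSpace G] [NonUnitalCStarAlgebra A]
  (α : CStarAction G A)

theorem seqAut_centralMul (g : G) (x : CentralSeqAlgebra A) (a : A) :
    α.seqAut g (centralMul A x a) = centralMul A (α.centralAut g x) (α.aut g a) := by
  obtain ⟨x, rfl⟩ := StarIdeal.Quotient.mk_surjective x
  rw [centralMul_mk, map_mul]
  rfl

theorem continuous_seqAut (g : G) : Continuous (α.seqAut g) := (homL (α.seqAut g)).continuous

variable [IsTopologicalGroup G] [CompactSpace G]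

/-- Unitality of `φ` only says that `φ 1` acts as the unit on the continuous part of `F_∞(A)`. The
class of an approximate unit `e` belongs to that part, since `α_g(e)` and `e` both act as the
identity on `A` and thus agree modulo the annihilator. Hence `φ(1) e = e` and `φ(1) a = φ(1) e a = e
a = a`. -/
theorem centralMul_one_of_unital [TopologicalSpace.SeparableSpace A]
    {φ : C(G, ℂ) →⋆ₙₐ[ℂ] α.continuousCentral} (hφ : ∀ x, φ 1 * x = x ∧ x * φ 1 = x) (a : A) :
    centralMul A (φ 1) a = toSeqAlgebra A a := by
  obtain ⟨e, he⟩ := exists_central_unit A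
  have hinv : ∀ g, α.centralAut g (StarIdeal.Quotient.mk e) = StarIdeal.Quotient.mk e := by
    intro g
    refine StarIdeal.Quotient.mk_eq_mk.2 ?_
    have h1 : ∀ a, ((α.commutantAut g e - e : relCommutant A) : SeqAlgebra A) *
        toSeqAlgebra A a = 0 := fun a => by
      have e1 : ((α.commutantAut g e - e : relCommutant A) : SeqAlgebra A) =
        α.seqAut g (e : SeqAlgebra A) - (e : SeqAlgebra A) := rfl
      rw [e1, sub_mul, he]
      nth_rw 1 [α.toSeqAlgebra_eq_seqAut g a]
      rw [← map_mul, he, ← α.toSeqAlgebra_eq_seqAut, sub_self]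
    exact fun a => ⟨h1 a, by rw [relCommutant_comm, h1]⟩
  have hmem : (StarIdeal.Quotient.mk e : CentralSeqAlgebra A) ∈ α.continuousCentral := by
    change Continuous fun g => α.centralAut g (StarIdeal.Quotient.mk e)
    simp_rw [hinv]
    exact continuous_const
  have h1 : ((φ 1 : α.continuousCentral) : CentralSeqAlgebra A) * StarIdeal.Quotient.mk e =
      StarIdeal.Quotient.mk e :=
    congrArg Subtype.val (hφ ⟨StarIdeal.Quotient.mk e, hmem⟩).1
  obtain ⟨x, hx⟩ := StarIdeal.Quotient.mk_surjective
    ((φ 1 : α.continuousCentral) : CentralSeqAlgebra A)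
  calc centralMul A (φ 1) a =
        centralMul A ((φ 1 : CentralSeqAlgebra A) * StarIdeal.Quotient.mk e) a := by
        rw [← hx, ← StarIdeal.Quotient.mk_mul, centralMul_mk, centralMul_mk,
          NonUnitalStarSubalgebra.coe_mul, mul_assoc, he]
    _ = toSeqAlgebra A a := by rw [h1, centralMul_mk, he]

variable [T2Space G]

/-- If `α` has the Rokhlin property, then the second-factor embedding
`(A, α) → (C(G) ⊗ A, σ ⊗ α)` is equivariantly sequentially split. -/
theorem RokhlinProperty.exists_hom [TopologicalSpace.SeparableSpace A] (hα : α.RokhlinProperty) :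
    ∃ ψ : C(G, A) →⋆ₙₐ[ℂ] SeqAlgebra A, (∀ a, ψ (secondFactor G A a) = toSeqAlgebra A a) ∧
      ∀ g F, ψ (α.shiftTensor.aut g F) = α.seqAut g (ψ F) := by
  obtain ⟨φ, hφ1, hφ⟩ := hα
  let φ' : C(G, ℂ) →ₗ[ℂ] CentralSeqAlgebra A :=
    { toFun := fun f => (φ f : CentralSeqAlgebra A)
      map_add' := fun f g => by rw [map_add]; rfl
      map_smul' := fun c f => by rw [map_smul]; rfl }
  let θ : C(G, ℂ) →ₗ[ℂ] A →ₗ[ℂ] SeqAlgebra A := centralMul A ∘ₗ φ'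
  have hθ : CommutingPair θ :=
    { mul_apply := fun f g a b => by
        change centralMul A (φ f) a * centralMul A (φ g) b = centralMul A (φ (f * g)) (a * b)
        have e : (φ (f * g) : CentralSeqAlgebra A) = φ f * φ g :=
          congrArg Subtype.val (map_mul φ f g)
        exact (centralMul_mul _ _ a b).trans (congrArg (fun z => centralMul A z (a * b)) e.symm)
      star_apply := fun f a => by
        change star (centralMul A (φ f) a) = centralMul A (φ (star f)) (star a)
        have e : (φ (star f) : CentralSeqAlgebra A) = star (φ f : CentralSeqAlgebra A) :=
          congrArg Subtype.val (map_star φ f)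
        exact (centralMul_star _ a).trans (congrArg (fun z => centralMul A z (star a)) e.symm) }
  obtain ⟨ψ, hψ⟩ := hθ.exists_hom
  refine ⟨ψ, fun a => ?_, fun g F => ?_⟩
  · have e : secondFactor G A a = smulConst G A 1 a :=
      ContinuousMap.ext fun t => (one_smul ℂ a).symm
    rw [e, hψ]
    exact α.centralMul_one_of_unital hφ1 a
  · have hψc : Continuous ψ := (homL ψ).continuous
    induction F using continuousMap_induction with
    | hcl =>
      exact isClosed_eq (hψc.comp (homL (α.shiftTensor.aut g)).continuous)
        ((α.continuous_seqAut g).comp hψc)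
    | hadd F₁ F₂ h₁ h₂ => rw [map_add, map_add, h₁, h₂, map_add, map_add]
    | hsmul f a =>
      -- On elementary tensors `σ ⊗ α` acts factorwise, and equivariance of `ψ` reduces to that of
      -- `φ`.
      have e : α.shiftTensor.aut g (smulConst G A f a) = smulConst G A (shift g f) (α.aut g a) :=
        ContinuousMap.ext fun t => map_smul (α.aut g) _ a
      rw [e, hψ, hψ]
      change centralMul A (φ (shift g f)) (α.aut g a) = α.seqAut g (centralMul A (φ f) a)
      rw [hφ, seqAut_centralMul]

end CStarAction

/-! ### The fixed point algebra -/

section Factor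

/-- A `*`-homomorphism factors through an injective one if its range is contained in the range of
the latter. -/
theorem exists_factorization {A B D : Type*} [NonUnitalNonAssocSemiring A] [Module ℂ A] [Star A]
    [NonUnitalNonAssocSemiring B] [Module ℂ B] [Star B] [NonUnitalNonAssocSemiring D] [Module ℂ D]
    [Star D] (ι : B →⋆ₙₐ[ℂ] D) (hι : Function.Injective ι) (T : A →⋆ₙₐ[ℂ] D)
    (hT : ∀ a, ∃ b, ι b = T a) : ∃ S : A →⋆ₙₐ[ℂ] B, ∀ a, ι (S a) = T a := by
  choose S hS using hT
  exact ⟨{ toFun := S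
           map_smul' := fun c a => hι (by simp only [MonoidHom.id_apply, map_smul, hS])
           map_zero' := hι (by simp only [map_zero, hS])
           map_add' := fun a b => hι (by simp only [map_add, hS])
           map_mul' := fun a b => hι (by simp only [map_mul, hS])
           map_star' := fun a => hι (by simp only [map_star, hS]) }, hS⟩

end Factor

namespace CStarAction

variable {G A : Type*} [Group G] [TopologicalSpace G] [IsTopologicalGroup G] [CompactSpace G]
  [SecondCountableTopology G] [MeasurableSpace G] [BorelSpace G] [NonUnitalCStarAlgebra A]
  (α : CStarAction G A)

/-- The average of the orbit of an element. -/
def average (μ : Measure G) [μ.IsHaarMeasure] (a : A) : α.fixedPoints :=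
  ⟨∫ g, α.aut g a ∂μ, fun h => by
    have i := (homL (α.aut h)).integral_comp_comm (μ := μ)
      (ConvAlg.integrable_of_continuous (α.continuous_aut a))
    refine i.symm.trans ?_
    change ∫ g, α.aut h (α.aut g a) ∂μ = _
    simp_rw [← α.aut_mul]
    exact integral_mul_left_eq_self (fun g => α.aut g a) h⟩

theorem norm_average_le (μ : Measure G) [μ.IsHaarMeasure] [IsProbabilityMeasure μ]
    (a : A) : ‖α.average μ a‖ ≤ ‖a‖ := by
  change ‖∫ g, α.aut g a ∂μ‖ ≤ ‖a‖
  refine (norm_integral_le_of_norm_le_const (C := ‖a‖)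
    (Filter.Eventually.of_forall fun g => (α.norm_aut g a).le)).trans ?_
  simp

theorem norm_average_sub_le (μ : Measure G) [μ.IsHaarMeasure] [IsProbabilityMeasure μ]
    (a : A) :
    ‖(α.average μ a : A) - a‖ ≤ ∫ g, ‖α.aut g a - a‖ ∂μ := by
  have e : (α.average μ a : A) - a = ∫ g, (α.aut g a - a) ∂μ := by
    rw [integral_sub (ConvAlg.integrable_of_continuous (α.continuous_aut a))
      (integrable_const _)]
    simp [average]
  rw [e]
  exact norm_integral_le_integral_norm _

/-- `A^α` carries the norm of `A`, so a sequence of fixed points that is null in `A` is null in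
`A^α`. -/
theorem injective_map_fixedPointsInclusion :
    Function.Injective (SeqAlgebra.map α.fixedPointsInclusion) := by
  intro x y h
  obtain ⟨x, rfl⟩ := StarIdeal.Quotient.mk_surjective x
  obtain ⟨y, rfl⟩ := StarIdeal.Quotient.mk_surjective y
  have h' := (SeqAlgebra.mk_eq_mk_iff (x := seqMap α.fixedPointsInclusion x)
    (y := seqMap α.fixedPointsInclusion y)).1 h
  exact SeqAlgebra.mk_eq_mk_iff.2 h'

/-- The fixed points of `A_∞` come from sequences of fixed points. -/
theorem exists_fixed_lift (μ : Measure G) [μ.IsHaarMeasure] [IsProbabilityMeasure μ]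
    (x : SeqAlgebra A) (hx : ∀ g, α.seqAut g x = x) :
    ∃ y, SeqAlgebra.map α.fixedPointsInclusion y = x := by
  obtain ⟨x, rfl⟩ := StarIdeal.Quotient.mk_surjective x
  have hb : ∀ n, ‖x n‖ ≤ ‖x‖ := fun n => lp.norm_apply_le_norm ENNReal.top_ne_zero x n
  let y : lp (fun _ : ℕ => α.fixedPoints) ∞ := ⟨fun n => α.average μ (x n),
    memℓp_infty ⟨‖x‖, by rintro _ ⟨n, rfl⟩; exact (α.norm_average_le μ _).trans (hb n)⟩⟩
  refine ⟨StarIdeal.Quotient.mk y, SeqAlgebra.mk_eq_mk_iff.2 ?_⟩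
  refine squeeze_zero (fun n => norm_nonneg _) (fun n => α.norm_average_sub_le μ (x n)) ?_
  have h : ∀ g, Filter.Tendsto (fun n => ‖α.aut g (x n) - x n‖) Filter.atTop (𝓝 0) := fun g =>
    SeqAlgebra.mk_eq_mk_iff.1 (hx g)
  rw [Metric.tendsto_nhds]
  intro ε hε
  -- Invariance of the class gives `‖α_g(x_n) - x_n‖ → 0` only for each `g` separately, without
  -- uniformity. Since these norms are bounded by `2‖x‖`, that is enough for their integrals to tend
  -- to `0`.
  have hev := eventually_integral_le μ (h := fun n g => ‖α.aut g (x n) - x n‖)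
    (fun n => ((α.continuous_aut (x n)).sub continuous_const).norm) (C := 2 * ‖x‖) (M := 0)
    (fun n g => by
      rw [abs_norm]
      have := norm_sub_le (α.aut g (x n)) (x n)
      rw [α.norm_aut] at this
      linarith [hb n])
    (fun g δ hδ => ((h g).eventually (gt_mem_nhds hδ)).mono fun n hn => by linarith)
    (half_pos hε)
  filter_upwards [hev] with n hn
  rw [Real.dist_eq, sub_zero, abs_of_nonneg (integral_nonneg fun _ => norm_nonneg _)]
  linarith

/-- The embedding `A → C(G, A)`, `a ↦ (t ↦ α_t(a))`, onto the fixed point algebra of `σ ⊗ α`. -/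
def orbitHom : A →⋆ₙₐ[ℂ] C(G, A) where
  toFun a := ⟨fun t => α.aut t a, α.continuous_aut a⟩
  map_smul' c a := ContinuousMap.ext fun t => map_smul (α.aut t) c a
  map_zero' := ContinuousMap.ext fun t => map_zero (α.aut t)
  map_add' a b := ContinuousMap.ext fun t => map_add (α.aut t) a b
  map_mul' a b := ContinuousMap.ext fun t => map_mul (α.aut t) a b
  map_star' a := ContinuousMap.ext fun t => map_star (α.aut t) a

theorem shiftTensor_orbitHom (g : G) (a : A) :
    α.shiftTensor.aut g (α.orbitHom a) = α.orbitHom a :=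
  ContinuousMap.ext fun t => by
    rw [shiftTensor_aut_apply]
    change α.aut g (α.aut (g⁻¹ * t) a) = α.aut t a
    rw [← aut_mul, mul_inv_cancel_left]

theorem orbitHom_fixedPoints (a : α.fixedPoints) :
    α.orbitHom (a : A) = secondFactor G A (a : A) :=
  ContinuousMap.ext fun t => a.2 t

/-- The splitting is `a ↦ ψ(t ↦ α_t(a))`. Orbit functions are invariant under `σ ⊗ α`, so the values
are invariant in `A_∞` and come from `(A^α)_∞`; on `A^α` orbit functions are constant. -/
theorem sequentiallySplit_fixedPointsInclusion (μ : Measure G) [μ.IsHaarMeasure]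
    [IsProbabilityMeasure μ]
    {ψ : C(G, A) →⋆ₙₐ[ℂ] SeqAlgebra A}
    (h1 : ∀ a, ψ (secondFactor G A a) = toSeqAlgebra A a)
    (h2 : ∀ g F, ψ (α.shiftTensor.aut g F) = α.seqAut g (ψ F)) :
    SequentiallySplit α.fixedPointsInclusion := by
  obtain ⟨S, hS⟩ := exists_factorization (SeqAlgebra.map α.fixedPointsInclusion)
    α.injective_map_fixedPointsInclusion (ψ.comp α.orbitHom)
    (fun a => α.exists_fixed_lift μ _ fun g => by
      rw [NonUnitalStarAlgHom.comp_apply, ← h2, shiftTensor_orbitHom])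
  refine ⟨S, NonUnitalStarAlgHom.ext fun a => α.injective_map_fixedPointsInclusion ?_⟩
  rw [NonUnitalStarAlgHom.comp_apply, hS, SeqAlgebra.map_toSeqAlgebra]
  change ψ (α.orbitHom (a : A)) = toSeqAlgebra A (a : A)
  rw [orbitHom_fixedPoints, h1]

end CStarAction

/-! ### `*`-homomorphisms on enveloping algebras -/

section EnvelopingLift

variable {X : Type*} [NonUnitalRing X] [StarRing X] [Module ℂ X]
  {D : Type*} [NonUnitalCStarAlgebra D]

/-- The `C*`-seminorm of a `*`-homomorphism to a `C*`-algebra. -/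
def homSeminorm (T : X →⋆ₙₐ[ℂ] D) : CStarSeminorm X :=
  CStarSeminorm.comp
    { toSeminorm := normSeminorm ℂ D
      mul_le' := norm_mul_le
      star_mul_self' := fun _ => CStarRing.norm_star_mul_self } T

theorem homSeminorm_apply (T : X →⋆ₙₐ[ℂ] D) (x : X) : (homSeminorm T).toSeminorm x = ‖T x‖ := rfl

variable [IsScalarTower ℂ X X] [SMulCommClass ℂ X X] [StarModule ℂ X] {S : SeminormFamily X}

/-- The canonical map to the enveloping algebra, as a linear map. -/
def envOfₗ (S : SeminormFamily X) : X →ₗ[ℂ] S.Env where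
  toFun x := SeminormFamily.Env.of (S := S) x
  map_add' := SeminormFamily.Env.of_add S
  map_smul' := SeminormFamily.Env.of_smul S

theorem norm_envOfₗ (S : SeminormFamily X) (x : X) : ‖envOfₗ S x‖ = S.sup x :=
  SeminormFamily.Env.norm_of S x

theorem denseRange_envOfₗ (S : SeminormFamily X) : DenseRange (envOfₗ S) :=
  SeminormFamily.Env.denseRange_of S

/-- The universal property of the enveloping algebra. -/
theorem exists_env_hom (T : X →⋆ₙₐ[ℂ] D) (hT : homSeminorm T ∈ S.seminorms) :
    ∃ T' : S.Env →⋆ₙₐ[ℂ] D, ∀ x, T' (envOfₗ S x) = T x := by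
  let T₁ : X →ₗ[ℂ] D :=
    { toFun := T, map_add' := map_add T, map_smul' := fun c x => map_smul T c x }
  let T₂ : S.Env →L[ℂ] D := T₁.extendOfNorm (envOfₗ S)
  have h : ∀ x, T₂ (envOfₗ S x) = T x := fun x =>
    LinearMap.extendOfNorm_eq (denseRange_envOfₗ S) ⟨1, fun x => by
      rw [one_mul, norm_envOfₗ]
      exact S.le_sup hT x⟩ x
  refine ⟨{ toFun := T₂
            map_smul' := fun c x => map_smul T₂ c x
            map_zero' := map_zero T₂
            map_add' := map_add T₂
            map_mul' := fun x y => ?_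
            map_star' := fun x => ?_ }, h⟩
  · induction x, y using SeminormFamily.Env.induction_on₂ with
    | hP => exact isClosed_eq (by fun_prop) (by fun_prop)
    | h x y =>
      rw [← SeminormFamily.Env.of_mul]
      exact (h (x * y)).trans ((map_mul T x y).trans (congrArg₂ _ (h x).symm (h y).symm))
  · induction x using SeminormFamily.Env.induction_on with
    | hP => exact isClosed_eq (by fun_prop) (by fun_prop)
    | h x =>
      rw [← SeminormFamily.Env.of_star]
      exact (h (star x)).trans ((map_star T x).trans (congrArg star (h x).symm))

/-- `*`-homomorphisms on the enveloping algebra are determined by their values on the original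
algebra. -/
theorem env_hom_ext {T T' : S.Env →⋆ₙₐ[ℂ] D} (h : ∀ x, T (envOfₗ S x) = T' (envOfₗ S x)) :
    T = T' :=
  NonUnitalStarAlgHom.ext fun x => congrFun ((denseRange_envOfₗ S).equalizer
    (homL T).continuous (homL T').continuous (funext h)) x

end EnvelopingLift

/-! ### `*`-homomorphisms on crossed products -/

section CrossedProductLift

variable {G A : Type*} [Group G] [TopologicalSpace G] [IsTopologicalGroup G] [CompactSpace G]
  [SecondCountableTopology G] [MeasurableSpace G] [BorelSpace G] [NonUnitalCStarAlgebra A]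
  (α : CStarAction G A) (μ : Measure G) [μ.IsHaarMeasure] [IsProbabilityMeasure μ]

namespace ConvAlg

/-- The identification of `C(G, A)` with the convolution algebra. -/
def ofFun : C(G, A) ≃ₗ[ℂ] ConvAlg α μ := LinearEquiv.refl ℂ C(G, A)

variable {α μ}

theorem ofFun_symm_apply (f : ConvAlg α μ) (t : G) : (ofFun α μ).symm f t = f t := rfl

theorem continuous_norm (f : ConvAlg α μ) : Continuous fun t => ‖f t‖ := f.continuous_coe.norm

theorem norm_apply_le (f : ConvAlg α μ) (t : G) : ‖f t‖ ≤ ‖(ofFun α μ).symm f‖ :=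
  ContinuousMap.norm_coe_le_norm ((ofFun α μ).symm f) t

theorem integral_norm_le (f : ConvAlg α μ) : ∫ t, ‖f t‖ ∂μ ≤ ‖(ofFun α μ).symm f‖ := by
  refine (integral_mono (integrable_of_continuous f.continuous_norm)
    (integrable_const ‖(ofFun α μ).symm f‖) fun t => f.norm_apply_le t).trans ?_
  simp

theorem norm_integrand (f g : ConvAlg α μ) (s t : G) :
    ‖f s * α.aut s (g (s⁻¹ * t))‖ ≤ ‖f s‖ * ‖g (s⁻¹ * t)‖ := by
  refine (norm_mul_le _ _).trans ?_
  rw [α.norm_aut]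

/-- The supremum norm is a module norm over the `L¹`-norm. This is the hypothesis under which
`norm_le_of_norm_le_const_mul` passes from supremum bounds to `L¹`-contractivity. -/
theorem norm_symm_mul_le (f g : ConvAlg α μ) :
    ‖(ofFun α μ).symm (f * g)‖ ≤ (∫ t, ‖f t‖ ∂μ) * ‖(ofFun α μ).symm g‖ := by
  rw [ContinuousMap.norm_le _ (mul_nonneg (integral_nonneg fun _ => norm_nonneg _) (norm_nonneg _))]
  intro t
  rw [ofFun_symm_apply, mul_apply, ← integral_mul_const]
  refine norm_integral_le_of_norm_le
    ((integrable_of_continuous f.continuous_norm).mul_const _)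
    (Filter.Eventually.of_forall fun s => (norm_integrand f g s t).trans ?_)
  exact mul_le_mul_of_nonneg_left (g.norm_apply_le _) (norm_nonneg _)

theorem norm_symm_mul_le' (f g : ConvAlg α μ) :
    ‖(ofFun α μ).symm (f * g)‖ ≤ ‖(ofFun α μ).symm f‖ * ‖(ofFun α μ).symm g‖ :=
  (norm_symm_mul_le f g).trans (mul_le_mul_of_nonneg_right f.integral_norm_le (norm_nonneg _))

theorem norm_symm_star (f : ConvAlg α μ) : ‖(ofFun α μ).symm (star f)‖ ≤ ‖(ofFun α μ).symm f‖ := by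
  rw [ContinuousMap.norm_le _ (norm_nonneg _)]
  intro t
  rw [ofFun_symm_apply, star_apply, α.norm_aut, norm_star]
  exact f.norm_apply_le _

theorem integral_norm_mul_le (f g : ConvAlg α μ) :
    ∫ t, ‖(f * g) t‖ ∂μ ≤ (∫ t, ‖f t‖ ∂μ) * ∫ t, ‖g t‖ ∂μ := by
  have hc : Continuous fun p : G × G => ‖f p.2‖ * ‖g (p.2⁻¹ * p.1)‖ :=
    (f.continuous_norm.comp continuous_snd).mul
      (g.continuous_norm.comp (continuous_snd.inv.mul continuous_fst))
  have hc1 : ∀ t, Continuous fun s => ‖f s‖ * ‖g (s⁻¹ * t)‖ := fun t =>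
    hc.comp (Continuous.prodMk_right t)
  have hc2 : Continuous fun t => ∫ s, ‖f s‖ * ‖g (s⁻¹ * t)‖ ∂μ := by
    have h := continuous_parametric_integral_of_continuous (μ := μ) (s := Set.univ)
      (f := fun t s => ‖f s‖ * ‖g (s⁻¹ * t)‖) hc isCompact_univ
    simpa only [Measure.restrict_univ] using h
  calc ∫ t, ‖(f * g) t‖ ∂μ ≤ ∫ t, ∫ s, ‖f s‖ * ‖g (s⁻¹ * t)‖ ∂μ ∂μ := by
        refine integral_mono (integrable_of_continuous (f * g).continuous_norm)
          (integrable_of_continuous hc2) fun t => ?_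
        exact norm_integral_le_of_norm_le (integrable_of_continuous (hc1 t))
          (Filter.Eventually.of_forall fun s => norm_integrand f g s t)
    _ = ∫ s, ∫ t, ‖f s‖ * ‖g (s⁻¹ * t)‖ ∂μ ∂μ :=
        integral_integral_swap_of_hasCompactSupport hc (HasCompactSupport.of_compactSpace _)
    _ = ∫ s, ‖f s‖ * ∫ t, ‖g t‖ ∂μ ∂μ := by
        refine integral_congr_ae (Filter.Eventually.of_forall fun s => ?_)
        change ∫ t, ‖f s‖ * ‖g (s⁻¹ * t)‖ ∂μ = _
        rw [integral_const_mul, integral_mul_left_eq_self (fun t => ‖g t‖)]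
    _ = _ := integral_mul_const _ _

theorem integral_norm_star (f : ConvAlg α μ) : ∫ t, ‖star f t‖ ∂μ = ∫ t, ‖f t‖ ∂μ := by
  simp_rw [star_apply, α.norm_aut, norm_star]
  exact integral_inv_of_continuous μ f.continuous_norm

/-- `*`-homomorphisms on the convolution algebra that are bounded for the supremum norm are
contractive for the `L¹`-norm. -/
theorem norm_hom_le_integral_norm {D : Type*} [NonUnitalCStarAlgebra D]
    (T : ConvAlg α μ →⋆ₙₐ[ℂ] D) {C : ℝ} (hC : ∀ f, ‖T f‖ ≤ C * ‖(ofFun α μ).symm f‖)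
    (f : ConvAlg α μ) : ‖T f‖ ≤ ∫ t, ‖f t‖ ∂μ := by
  refine norm_le_of_norm_le_const_mul T (map_mul T) (map_star T) (fun x => by simp)
    (fun x y => star_mul x y) (fun f => ∫ t, ‖f t‖ ∂μ) (fun f => ‖(ofFun α μ).symm f‖)
    (fun f => integral_nonneg fun _ => norm_nonneg _) integral_norm_mul_le
    (fun f => (integral_norm_star f).le) norm_symm_mul_le |C| (abs_nonneg C) (fun f => ?_) f
  exact (hC f).trans (mul_le_mul_of_nonneg_right (le_abs_self C) (norm_nonneg _))

variable (α μ)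

/-- The convolution product, as a bounded bilinear map for the supremum norm. -/
def convL : C(G, A) →L[ℂ] C(G, A) →L[ℂ] C(G, A) :=
  LinearMap.mkContinuous₂
    (LinearMap.mk₂ ℂ (fun f g => (ofFun α μ).symm (ofFun α μ f * ofFun α μ g))
      (fun f f' g => by rw [map_add, add_mul, map_add])
      (fun c f g => by rw [map_smul, smul_mul_assoc, map_smul])
      (fun f g g' => by rw [map_add, mul_add, map_add])
      (fun c f g => by rw [map_smul, mul_smul_comm, map_smul])) 1
    fun f g => by rw [one_mul]; exact norm_symm_mul_le' _ _

theorem convL_apply (f g : C(G, A)) :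
    convL α μ f g = (ofFun α μ).symm (ofFun α μ f * ofFun α μ g) := rfl

theorem continuous_convStar :
    Continuous fun f : C(G, A) => (ofFun α μ).symm (star (ofFun α μ f)) := by
  let S : C(G, A) →+ C(G, A) :=
    { toFun := fun f => (ofFun α μ).symm (star (ofFun α μ f))
      map_zero' := by simp
      map_add' := fun f g => by simp }
  exact AddMonoidHomClass.continuous_of_bound S 1 fun f => by
    rw [one_mul]; exact norm_symm_star _

end ConvAlg

namespace CStarAction

variable {D : Type*} [NonUnitalCStarAlgebra D]

/-- The canonical map `C(G, A) → A ⋊_α G`. -/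
def funToCrossedProduct : C(G, A) →ₗ[ℂ] α.CrossedProduct μ :=
  envOfₗ (ConvAlg.seminormFamily α μ) ∘ₗ (ConvAlg.ofFun α μ : C(G, A) →ₗ[ℂ] ConvAlg α μ)

theorem funToCrossedProduct_apply (f : C(G, A)) :
    α.funToCrossedProduct μ f = α.toCrossedProduct μ (ConvAlg.ofFun α μ f) := rfl

theorem norm_toCrossedProduct_le (f : ConvAlg α μ) :
    ‖α.toCrossedProduct μ f‖ ≤ ∫ t, ‖f t‖ ∂μ := by
  change ‖envOfₗ (ConvAlg.seminormFamily α μ) f‖ ≤ _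
  rw [norm_envOfₗ]
  exact SeminormFamily.sup_le _ (integral_nonneg fun _ => norm_nonneg _) fun p hp => hp f

variable {α μ}

/-- `*`-homomorphisms on the crossed product, given by their values on a dense `*`-subalgebra of
`C(G, A)`. -/
theorem exists_crossedProduct_hom {E : Type*} [AddCommGroup E] [Module ℂ E]
    (κ : E →ₗ[ℂ] C(G, A)) (hκ : DenseRange κ) (τ : E →ₗ[ℂ] D) {C : ℝ}
    (hC : ∀ e, ‖τ e‖ ≤ C * ‖κ e‖)
    (hmul : ∀ e e', ∃ e'', ConvAlg.ofFun α μ (κ e'') =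
      ConvAlg.ofFun α μ (κ e) * ConvAlg.ofFun α μ (κ e') ∧ τ e'' = τ e * τ e')
    (hstar : ∀ e, ∃ e', ConvAlg.ofFun α μ (κ e') = star (ConvAlg.ofFun α μ (κ e)) ∧
      τ e' = star (τ e)) :
    ∃ T : α.CrossedProduct μ →⋆ₙₐ[ℂ] D, ∀ e, T (α.funToCrossedProduct μ (κ e)) = τ e := by
  let T₀ : C(G, A) →L[ℂ] D := τ.extendOfNorm κ
  have hT₀ : ∀ e, T₀ (κ e) = τ e := LinearMap.extendOfNorm_eq hκ ⟨C, hC⟩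
  let T₁ : ConvAlg α μ →⋆ₙₐ[ℂ] D :=
    { toFun := fun f => T₀ ((ConvAlg.ofFun α μ).symm f)
      map_smul' := fun c f => by rw [map_smul, map_smul]; rfl
      map_zero' := by rw [map_zero, map_zero]
      map_add' := fun f g => by rw [map_add, map_add]
      map_mul' := fun f g => by
        have key : ∀ f g : C(G, A), T₀ (ConvAlg.convL α μ f g) = T₀ f * T₀ g := by
          intro f g
          refine hκ.induction_on₂ (p := fun f g => T₀ (ConvAlg.convL α μ f g) = T₀ f * T₀ g)
            (isClosed_eq (by fun_prop) (by fun_prop)) (fun e e' => ?_) f g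
          obtain ⟨e'', h1, h2⟩ := hmul e e'
          rw [ConvAlg.convL_apply, ← h1, LinearEquiv.symm_apply_apply, hT₀, hT₀, hT₀, h2]
        exact key ((ConvAlg.ofFun α μ).symm f) ((ConvAlg.ofFun α μ).symm g)
      map_star' := fun f => by
        have key : ∀ f : C(G, A),
            T₀ ((ConvAlg.ofFun α μ).symm (star (ConvAlg.ofFun α μ f))) = star (T₀ f) := by
          intro f
          have hs := ConvAlg.continuous_convStar α μ
          refine hκ.induction_on (p := fun f => T₀ ((ConvAlg.ofFun α μ).symm
            (star (ConvAlg.ofFun α μ f))) = star (T₀ f)) f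
            (isClosed_eq (T₀.continuous.comp hs) (by fun_prop)) fun e => ?_
          obtain ⟨e', h1, h2⟩ := hstar e
          rw [← h1, LinearEquiv.symm_apply_apply, hT₀, hT₀, h2]
        exact key ((ConvAlg.ofFun α μ).symm f) }
  -- Boundedness in the supremum norm, with any constant, suffices: `norm_hom_le_integral_norm`
  -- improves it to domination by the `L¹`-norm, which puts the seminorm of `T₁` in the family that
  -- defines the crossed product.
  have hT₁ : ∀ f, ‖T₁ f‖ ≤ ‖T₀‖ * ‖(ConvAlg.ofFun α μ).symm f‖ := fun f => T₀.le_opNorm _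
  obtain ⟨T, hT⟩ := exists_env_hom (S := ConvAlg.seminormFamily α μ) T₁
    (fun f => ConvAlg.norm_hom_le_integral_norm T₁ hT₁ f)
  refine ⟨T, fun e => ?_⟩
  rw [← hT₀ e]
  exact hT (ConvAlg.ofFun α μ (κ e))

/-- `*`-homomorphisms on the crossed product are determined by their values on a dense subspace of
`C(G, A)`. -/
theorem crossedProduct_hom_ext {E : Type*} (κ : E → C(G, A)) (hκ : DenseRange κ)
    {T T' : α.CrossedProduct μ →⋆ₙₐ[ℂ] D}
    (h : ∀ e, T (α.funToCrossedProduct μ (κ e)) = T' (α.funToCrossedProduct μ (κ e))) :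
    T = T' := by
  refine env_hom_ext fun f => ?_
  have hc : Continuous (α.funToCrossedProduct μ) :=
    AddMonoidHomClass.continuous_of_bound (α.funToCrossedProduct μ) 1 fun f => by
      rw [one_mul]
      exact (α.norm_toCrossedProduct_le μ _).trans (ConvAlg.integral_norm_le _)
  exact congrFun (hκ.equalizer ((homL T).continuous.comp hc) ((homL T').continuous.comp hc)
    (funext h)) ((ConvAlg.ofFun α μ).symm f)

end CStarAction

end CrossedProductLift

/-! ### Crossed products of equivariant `*`-homomorphisms to sequence algebras -/

theorem env_map_of {X Y : Type*} [NonUnitalRing X] [StarRing X] [Module ℂ X]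
    [IsScalarTower ℂ X X] [SMulCommClass ℂ X X] [StarModule ℂ X] [NonUnitalRing Y] [StarRing Y]
    [Module ℂ Y] [IsScalarTower ℂ Y Y] [SMulCommClass ℂ Y Y] [StarModule ℂ Y]
    {S : SeminormFamily X} {T : SeminormFamily Y} (θ : S.Pre →⋆ₙₐ[ℂ] T.Pre)
    (h : ∀ x, ‖θ x‖ ≤ ‖x‖) (x : S.Pre) :
    SeminormFamily.Env.map θ h (SeminormFamily.Env.of x) = SeminormFamily.Env.of (θ x) :=
  UniformSpace.Completion.map_coe
    (LipschitzWith.uniformContinuous (K := 1) (LipschitzWith.of_dist_le_mul fun x y => by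
      rw [dist_eq_norm, dist_eq_norm, NNReal.coe_one, one_mul, ← map_sub]
      exact h _)) x

section SequenceLift

open StarIdeal.Quotient (mk)

/-- Evaluation at a point. -/
def evalHom {G : Type*} [TopologicalSpace G] [CompactSpace G] (A : Type*) [NonUnitalCStarAlgebra A]
    (s : G) : C(G, A) →⋆ₙₐ[ℂ] A where
  toFun f := f s
  map_smul' _ _ := rfl
  map_zero' := rfl
  map_add' _ _ := rfl
  map_mul' _ _ := rfl
  map_star' _ := rfl

/-- Componentwise application of a bounded linear map to bounded sequences. -/
def seqMapL {A Y : Type*} [NonUnitalCStarAlgebra A] [NonUnitalCStarAlgebra Y] (L : A →L[ℂ] Y) :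
    lp (fun _ : ℕ => A) ∞ →L[ℂ] lp (fun _ : ℕ => Y) ∞ :=
  lp.mapCLM ∞ (fun _ => L) (norm_nonneg L) fun _ => le_rfl

variable {G : Type*} [Group G] [TopologicalSpace G] [IsTopologicalGroup G] [CompactSpace G]
  [SecondCountableTopology G] [MeasurableSpace G] [BorelSpace G]
  {A B : Type*} [NonUnitalCStarAlgebra A] [NonUnitalCStarAlgebra B]

/-- Pairs of a continuous function `F` to `B` and a bounded sequence of continuous functions to `A`
that lifts `ψ ∘ F` pointwise. -/
def liftPairs (G : Type*) [TopologicalSpace G] [CompactSpace G] (ψ : B →⋆ₙₐ[ℂ] SeqAlgebra A) :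
    Submodule ℂ (C(G, B) × lp (fun _ : ℕ => C(G, A)) ∞) where
  carrier := {p | ∀ s, (mk (seqMap (evalHom A s) p.2) : SeqAlgebra A) = ψ (p.1 s)}
  zero_mem' s := by
    rw [Prod.snd_zero, Prod.fst_zero, map_zero, ContinuousMap.zero_apply, map_zero,
      StarIdeal.Quotient.mk_zero]
  add_mem' {p q} hp hq s := by
    rw [Prod.snd_add, Prod.fst_add, map_add, ContinuousMap.add_apply, map_add,
      StarIdeal.Quotient.mk_add, hp, hq]
  smul_mem' c p hp s := by
    rw [Prod.smul_snd, Prod.smul_fst, map_smul, ContinuousMap.smul_apply, map_smul,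
      StarIdeal.Quotient.mk_smul, hp]

variable (ψ : B →⋆ₙₐ[ℂ] SeqAlgebra A)

theorem mem_liftPairs {p : C(G, B) × lp (fun _ : ℕ => C(G, A)) ∞} :
    p ∈ liftPairs G ψ ↔ ∀ s, (mk (seqMap (evalHom A s) p.2) : SeqAlgebra A) = ψ (p.1 s) := Iff.rfl

variable (G) in
/-- The first component of a pair. -/
def liftPairsFst : liftPairs G ψ →ₗ[ℂ] C(G, B) :=
  LinearMap.fst ℂ _ _ ∘ₗ (liftPairs G ψ).subtype

/-- The constant sequence with the value `h`, multiplied by a bounded sequence in `A`. -/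
def smulSeq (h : C(G, ℂ)) (x : lp (fun _ : ℕ => A) ∞) : lp (fun _ : ℕ => C(G, A)) ∞ :=
  ⟨fun n => smulConst G A h (x n), memℓp_infty ⟨‖h‖ * ‖x‖, by
    rintro _ ⟨n, rfl⟩
    exact (norm_smulConst h (x n)).trans (mul_le_mul_of_nonneg_left
      (lp.norm_apply_le_norm ENNReal.top_ne_zero x n) (norm_nonneg _))⟩⟩

theorem smulSeq_mem (h : C(G, ℂ)) {b : B} {x : lp (fun _ : ℕ => A) ∞}
    (hx : (mk x : SeqAlgebra A) = ψ b) : (smulConst G B h b, smulSeq h x) ∈ liftPairs G ψ := by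
  intro s
  change (mk (h s • x) : SeqAlgebra A) = ψ (h s • b)
  rw [StarIdeal.Quotient.mk_smul, hx, map_smul]

variable [T2Space G]

/-- For `h ⊗ b` a representative of `ψ(b)` multiplied by `h` is a lift. Sums of such functions are
dense, so lifts of arbitrary continuous `F` are not needed. -/
theorem denseRange_liftPairsFst : DenseRange (liftPairsFst G ψ) := by
  refine Dense.mono ?_ (denseRange_tensorToFun (X := G) (E := B))
  rintro _ ⟨x, rfl⟩
  have : tensorToFun G B x ∈ LinearMap.range (liftPairsFst G ψ) := by
    induction x using TensorProduct.induction_on with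
    | zero => rw [map_zero]; exact zero_mem _
    | tmul h b =>
      obtain ⟨x, hx⟩ := StarIdeal.Quotient.mk_surjective (ψ b)
      exact ⟨⟨_, smulSeq_mem ψ h hx⟩, rfl⟩
    | add x y hx hy => rw [map_add]; exact add_mem hx hy
  exact this

variable {Y : Type*} [NonUnitalCStarAlgebra Y] (L : C(G, A) →L[ℂ] Y)

/-- The class of the image under `L` of the second component of a pair. -/
def liftPairsMap : liftPairs G ψ →ₗ[ℂ] SeqAlgebra Y where
  toFun p := mk (seqMapL L p.1.2)
  map_add' p q := by
    rw [← StarIdeal.Quotient.mk_add, ← map_add]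
    rfl
  map_smul' c p := by
    rw [RingHom.id_apply, ← StarIdeal.Quotient.mk_smul, ← map_smul]
    rfl

variable (μ : Measure G) [μ.IsHaarMeasure] [IsProbabilityMeasure μ]

/-- For each `s` one has `limsup ‖f_n(s)‖ = ‖ψ(F(s))‖ ≤ ‖F‖`, but not uniformly in `s`. Domination
of `L` by the `L¹`-norm is what makes pointwise control sufficient, by dominated convergence. In
particular the class of `(L f_n)` does not depend on the lift chosen for `F`. -/
theorem norm_liftPairsMap_le (hL : ∀ f, ‖L f‖ ≤ ∫ t, ‖f t‖ ∂μ) (p : liftPairs G ψ) :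
    ‖liftPairsMap ψ L p‖ ≤ ‖liftPairsFst G ψ p‖ := by
  obtain ⟨⟨F, f⟩, hp⟩ := p
  change ‖(mk (seqMapL L f) : SeqAlgebra Y)‖ ≤ ‖F‖
  refine SeqAlgebra.norm_mk_le_of_eventually (norm_nonneg _) fun ε hε => ?_
  have hev := eventually_integral_le μ (h := fun n s => ‖f n s‖) (M := ‖F‖) (C := ‖f‖)
    (fun n => (f n).continuous.norm)
    (fun n s => by
      rw [abs_norm]
      exact ((f n).norm_coe_le_norm s).trans (lp.norm_apply_le_norm ENNReal.top_ne_zero f n))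
    (fun s δ hδ => by
      have hle : ‖(mk (seqMap (evalHom A s) f) : SeqAlgebra A)‖ ≤ ‖F‖ := by
        rw [(mem_liftPairs ψ).1 hp s]
        exact (NonUnitalStarAlgHom.norm_apply_le ψ _).trans (F.norm_coe_le_norm s)
      exact SeqAlgebra.eventually_norm_le hle hδ) hε
  filter_upwards [hev] with n hn
  exact (hL (f n)).trans hn

/-- Integration on `C(G, A)`. -/
def integralL (A : Type*) [NonUnitalCStarAlgebra A] : C(G, A) →L[ℂ] A :=
  LinearMap.mkContinuous
    { toFun := fun f => ∫ t, f t ∂μ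
      map_add' := fun f g => integral_add (ConvAlg.integrable_of_continuous f.continuous)
        (ConvAlg.integrable_of_continuous g.continuous)
      map_smul' := fun c f => integral_smul c f } 1 fun f => by
    rw [one_mul]
    refine (norm_integral_le_of_norm_le_const (C := ‖f‖)
      (Filter.Eventually.of_forall f.norm_coe_le_norm)).trans ?_
    simp

theorem integralL_smulConst (h : C(G, ℂ)) (a : A) :
    integralL μ A (smulConst G A h a) = (∫ t, h t ∂μ) • a :=
  integral_smul_const (fun t => h t) a

/-- Lifting commutes with integration. -/
theorem mk_integral_of_mem_liftPairs {F : C(G, B)} {f : lp (fun _ : ℕ => C(G, A)) ∞}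
    (hp : (F, f) ∈ liftPairs G ψ) :
    (mk (seqMapL (integralL μ A) f) : SeqAlgebra A) = ψ (∫ t, F t ∂μ) := by
  have hbd : ∃ C, ∀ p, ‖liftPairsMap ψ (integralL μ A) p‖ ≤ C * ‖liftPairsFst G ψ p‖ :=
    ⟨1, fun p => by
      rw [one_mul]
      exact norm_liftPairsMap_le ψ _ μ (fun f => norm_integral_le_integral_norm _) p⟩
  -- By the norm estimate the class of the integrated lift is a bounded linear function `J` of `F`
  -- alone. It can therefore be compared with `ψ(∫ F)` on elementary tensors, with the evident
  -- lifts.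
  let J : C(G, B) →L[ℂ] SeqAlgebra A :=
    (liftPairsMap ψ (integralL μ A)).extendOfNorm (liftPairsFst G ψ)
  have hJ : ∀ p, J (liftPairsFst G ψ p) = liftPairsMap ψ (integralL μ A) p :=
    LinearMap.extendOfNorm_eq (denseRange_liftPairsFst ψ) hbd
  have e : J = (homL ψ).comp (integralL μ B) := by
    refine continuousLinearMap_ext fun h b => ?_
    obtain ⟨x, hx⟩ := StarIdeal.Quotient.mk_surjective (ψ b)
    refine (hJ ⟨_, smulSeq_mem ψ h hx⟩).trans ?_
    have e1 : seqMapL (integralL μ A) (smulSeq h x) = (∫ t, h t ∂μ) • x :=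
      lp.ext (funext fun n => integralL_smulConst μ h (x n))
    change (mk (seqMapL (integralL μ A) (smulSeq h x)) : SeqAlgebra A) =
      ψ (integralL μ B (smulConst G B h b))
    rw [e1, integralL_smulConst, StarIdeal.Quotient.mk_smul, hx, map_smul]
  have h1 : J F = mk (seqMapL (integralL μ A) f) := hJ ⟨_, hp⟩
  rw [← h1, e]
  rfl

end SequenceLift

namespace CStarAction

variable {G : Type*} [Group G] [TopologicalSpace G] [IsTopologicalGroup G] [CompactSpace G]
  [SecondCountableTopology G] [MeasurableSpace G] [BorelSpace G] [T2Space G]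
  {A B : Type*} [NonUnitalCStarAlgebra A] [NonUnitalCStarAlgebra B]
  (α : CStarAction G A) {β : CStarAction G B}
  (μ : Measure G) [μ.IsHaarMeasure] [IsProbabilityMeasure μ]

/-- The componentwise convolution product of sequences. -/
def convSeq (f g : lp (fun _ : ℕ => C(G, A)) ∞) : lp (fun _ : ℕ => C(G, A)) ∞ :=
  ⟨fun n => (ConvAlg.ofFun α μ).symm (ConvAlg.ofFun α μ (f n) * ConvAlg.ofFun α μ (g n)),
    memℓp_infty ⟨‖f‖ * ‖g‖, by
      rintro _ ⟨n, rfl⟩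
      exact (ConvAlg.norm_symm_mul_le' _ _).trans
        (mul_le_mul (lp.norm_apply_le_norm ENNReal.top_ne_zero f n)
          (lp.norm_apply_le_norm ENNReal.top_ne_zero g n) (norm_nonneg _) (norm_nonneg _))⟩⟩

/-- The componentwise involution of the convolution algebra on sequences. -/
def convStarSeq (f : lp (fun _ : ℕ => C(G, A)) ∞) : lp (fun _ : ℕ => C(G, A)) ∞ :=
  ⟨fun n => (ConvAlg.ofFun α μ).symm (star (ConvAlg.ofFun α μ (f n))),
    memℓp_infty ⟨‖f‖, by
      rintro _ ⟨n, rfl⟩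
      exact (ConvAlg.norm_symm_star _).trans (lp.norm_apply_le_norm ENNReal.top_ne_zero f n)⟩⟩

/-- The integrand of the convolution product, as a continuous function. -/
def convIntegrand (f g : C(G, A)) (t : G) : C(G, A) :=
  ⟨fun s => f s * α.aut s (g (s⁻¹ * t)), f.continuous.mul (α.continuous_aut_comp continuous_id
    (g.continuous.comp (continuous_inv.mul continuous_const)))⟩

/-- The componentwise integrand of the convolution product of sequences. -/
def convIntegrandSeq (f g : lp (fun _ : ℕ => C(G, A)) ∞) (t : G) : lp (fun _ : ℕ => C(G, A)) ∞ :=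
  ⟨fun n => α.convIntegrand (f n) (g n) t, memℓp_infty ⟨‖f‖ * ‖g‖, by
    rintro _ ⟨n, rfl⟩
    rw [ContinuousMap.norm_le _ (by positivity)]
    intro s
    refine (norm_mul_le _ _).trans ?_
    rw [α.norm_aut]
    exact mul_le_mul
      (((f n).norm_coe_le_norm s).trans (lp.norm_apply_le_norm ENNReal.top_ne_zero f n))
      (((g n).norm_coe_le_norm _).trans (lp.norm_apply_le_norm ENNReal.top_ne_zero g n))
      (norm_nonneg _) (norm_nonneg _)⟩⟩

variable {α} {ψ : B →⋆ₙₐ[ℂ] SeqAlgebra A}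

theorem convIntegrandSeq_mem (hψ : ∀ g b, ψ (β.aut g b) = α.seqAut g (ψ b))
    {F F' : C(G, B)} {f f' : lp (fun _ : ℕ => C(G, A)) ∞} (h : (F, f) ∈ liftPairs G ψ)
    (h' : (F', f') ∈ liftPairs G ψ) (t : G) :
    (β.convIntegrand F F' t, α.convIntegrandSeq f f' t) ∈ liftPairs G ψ := by
  intro s
  change StarIdeal.Quotient.mk (seqMap (evalHom A s) f) *
    α.seqAut s (StarIdeal.Quotient.mk (seqMap (evalHom A (s⁻¹ * t)) f')) =
      ψ (F s * β.aut s (F' (s⁻¹ * t)))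
  rw [h s, h' (s⁻¹ * t), map_mul ψ, hψ]

/-- At a fixed `t` the convolution is an integral over `s`, and the integrands form a lifting pair
by equivariance of `ψ`. Since lifting commutes with integration, so does it with convolution. -/
theorem convSeq_mem (hψ : ∀ g b, ψ (β.aut g b) = α.seqAut g (ψ b))
    {F F' : C(G, B)} {f f' : lp (fun _ : ℕ => C(G, A)) ∞} (h : (F, f) ∈ liftPairs G ψ)
    (h' : (F', f') ∈ liftPairs G ψ) :
    ((ConvAlg.ofFun β μ).symm (ConvAlg.ofFun β μ F * ConvAlg.ofFun β μ F'),
      α.convSeq μ f f') ∈ liftPairs G ψ :=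
  fun t => mk_integral_of_mem_liftPairs ψ μ (convIntegrandSeq_mem hψ h h' t)

theorem convStarSeq_mem (hψ : ∀ g b, ψ (β.aut g b) = α.seqAut g (ψ b))
    {F : C(G, B)} {f : lp (fun _ : ℕ => C(G, A)) ∞} (h : (F, f) ∈ liftPairs G ψ) :
    ((ConvAlg.ofFun β μ).symm (star (ConvAlg.ofFun β μ F)), α.convStarSeq μ f) ∈ liftPairs G ψ := by
  intro t
  change α.seqAut t (star (StarIdeal.Quotient.mk (seqMap (evalHom A t⁻¹) f))) =
    ψ (β.aut t (star (F t⁻¹)))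
  rw [h t⁻¹, hψ, map_star ψ]

variable (α)

/-- The canonical map `C(G, A) → A ⋊_α G`, as a bounded linear map. -/
def funToCrossedProductL : C(G, A) →L[ℂ] α.CrossedProduct μ :=
  (α.funToCrossedProduct μ).mkContinuous 1 fun f => by
    rw [one_mul]
    exact (α.norm_toCrossedProduct_le μ _).trans (ConvAlg.integral_norm_le _)

variable {α}

/-- An equivariant `*`-homomorphism `ψ : B → A_∞` induces a `*`-homomorphism
`B ⋊_β G → (A ⋊_α G)_∞`. -/
theorem exists_crossedProduct_seqHom (hψ : ∀ g b, ψ (β.aut g b) = α.seqAut g (ψ b)) :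
    ∃ T : β.CrossedProduct μ →⋆ₙₐ[ℂ] SeqAlgebra (α.CrossedProduct μ),
      ∀ F f, (F, f) ∈ liftPairs G ψ → T (β.funToCrossedProduct μ F) =
        StarIdeal.Quotient.mk (seqMapL (α.funToCrossedProductL μ) f) := by
  -- The dense subspace is parametrized by the lifting pairs themselves. Convolutions and adjoints
  -- of pairs are again pairs, and on the sequence component they are taken termwise, where the map
  -- to `A ⋊_α G` is a `*`-homomorphism.
  obtain ⟨T, hT⟩ := exists_crossedProduct_hom (α := β) (μ := μ) (liftPairsFst G ψ)
    (denseRange_liftPairsFst ψ) (liftPairsMap ψ (α.funToCrossedProductL μ)) (C := 1)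
    (fun p => by
      rw [one_mul]
      exact norm_liftPairsMap_le ψ _ μ (fun f => α.norm_toCrossedProduct_le μ _) p)
    (by
      rintro ⟨⟨F, f⟩, h⟩ ⟨⟨F', f'⟩, h'⟩
      refine ⟨⟨_, convSeq_mem μ hψ h h'⟩, rfl, ?_⟩
      change StarIdeal.Quotient.mk (seqMapL (α.funToCrossedProductL μ) (α.convSeq μ f f')) =
        StarIdeal.Quotient.mk (seqMapL (α.funToCrossedProductL μ) f *
          seqMapL (α.funToCrossedProductL μ) f')
      refine congrArg _ (lp.ext (funext fun n => ?_))
      exact map_mul (α.toCrossedProduct μ) (ConvAlg.ofFun α μ (f n)) (ConvAlg.ofFun α μ (f' n)))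
    (by
      rintro ⟨⟨F, f⟩, h⟩
      refine ⟨⟨_, convStarSeq_mem μ hψ h⟩, rfl, ?_⟩
      change StarIdeal.Quotient.mk (seqMapL (α.funToCrossedProductL μ) (α.convStarSeq μ f)) =
        StarIdeal.Quotient.mk (star (seqMapL (α.funToCrossedProductL μ) f))
      refine congrArg _ (lp.ext (funext fun n => ?_))
      exact map_star (α.toCrossedProduct μ) (ConvAlg.ofFun α μ (f n)))
  exact ⟨T, fun F f h => hT ⟨_, h⟩⟩

/-- Crossed products preserve equivariant sequential splittings. -/
theorem exists_crossedProduct_split {φ : A →⋆ₙₐ[ℂ] B} (hφ : ∀ g a, φ (α.aut g a) = β.aut g (φ a))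
    (hψ : ∀ g b, ψ (β.aut g b) = α.seqAut g (ψ b)) (hψφ : ∀ a, ψ (φ a) = toSeqAlgebra A a) :
    SequentiallySplit (crossedProductMap (α := α) (β := β) μ φ hφ) := by
  obtain ⟨T, hT⟩ := exists_crossedProduct_seqHom μ hψ
  refine ⟨T, ?_⟩
  refine crossedProduct_hom_ext id Function.surjective_id.denseRange fun f => ?_
  -- Because `ψ ∘ φ` is the canonical embedding, the constant sequence `f` lifts `ψ ∘ φ ∘ f`; so `T`
  -- sends the image of `f` to the class of a constant sequence.
  have h : ((ConvAlg.ofFun β μ).symm (convMap μ φ hφ (ConvAlg.ofFun α μ f)), constSeq C(G, A) f) ∈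
      liftPairs G ψ := fun s => (hψφ (f s)).symm
  have e : crossedProductMap (α := α) (β := β) μ φ hφ (α.funToCrossedProduct μ f) =
      β.funToCrossedProduct μ
        ((ConvAlg.ofFun β μ).symm (convMap μ φ hφ (ConvAlg.ofFun α μ f))) := by
    exact env_map_of _ _ _
  rw [NonUnitalStarAlgHom.comp_apply, id, e, hT _ _ h]
  rfl

end CStarAction

/-! ### Compact operators as limits of operators of finite rank -/

section CompactApproximation

variable {H : Type*} [NormedAddCommGroup H] [InnerProductSpace ℂ H] [CompleteSpace H]

/-- Compact operators on a Hilbert space are norm limits of operators of finite rank. -/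
theorem exists_sum_rankOne_near {T : H →L[ℂ] H} (hT : IsCompactOperator T) {ε : ℝ} (hε : 0 < ε) :
    ∃ (n : ℕ) (u v : Fin n → H), ‖T - ∑ i, InnerProductSpace.rankOne ℂ (u i) (v i)‖ ≤ ε := by
  have h1 := (isCompactOperator_iff_isCompact_closure_image_closedBall (𝕜₁ := ℂ)
    (T : H →ₗ[ℂ] H) one_pos).1 hT
  have tb : TotallyBounded (T '' Metric.closedBall 0 1) := h1.totallyBounded.subset subset_closure
  obtain ⟨s, hs, hcov⟩ := Metric.totallyBounded_iff.1 tb ε hε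
  -- `W` is spanned by a finite `ε`-net of the image of the unit ball. The approximant is `P_W T`,
  -- and since `P_W T x` is the point of `W` closest to `T x`, it is at least as close as the net.
  let W : Submodule ℂ H := Submodule.span ℂ s
  have : FiniteDimensional ℂ W := FiniteDimensional.span_of_finite ℂ hs
  let b := stdOrthonormalBasis ℂ W
  refine ⟨_, fun i => (b i : H), fun i => T.adjoint (b i), ?_⟩
  have e : ∑ i, InnerProductSpace.rankOne ℂ (b i : H) (T.adjoint (b i)) =
      W.starProjection ∘L T := by
    rw [b.starProjection_eq_sum_rankOne, ContinuousLinearMap.finsetSum_comp]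
    exact Finset.sum_congr rfl fun i _ => (InnerProductSpace.rankOne_comp _ _ _).symm
  rw [e]
  refine ContinuousLinearMap.opNorm_le_of_unit_norm hε.le fun x hx => ?_
  obtain ⟨y, hy, hxy⟩ := Set.mem_iUnion₂.1
    (hcov ⟨x, by rw [mem_closedBall_zero_iff]; exact hx.le, rfl⟩)
  have hmin : ‖T x - W.starProjection (T x)‖ ≤ ‖T x - y‖ := by
    rw [Submodule.starProjection_minimal]
    exact ciInf_le ⟨0, by rintro _ ⟨z, rfl⟩; exact norm_nonneg _⟩
      (⟨y, Submodule.subset_span hy⟩ : W)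
  refine hmin.trans ?_
  rw [Metric.mem_ball, dist_eq_norm] at hxy
  exact hxy.le

theorem rankOneCompact_mul (u v w z : H) :
    rankOneCompact u v * rankOneCompact w z = (inner ℂ v w : ℂ) • rankOneCompact u z :=
  Subtype.ext (InnerProductSpace.rankOne_comp_rankOne u v w z)

theorem rankOneCompact_star (u v : H) : star (rankOneCompact u v) = rankOneCompact v u :=
  Subtype.ext (InnerProductSpace.adjoint_rankOne u v)

theorem continuous_rankOneCompact : Continuous fun p : H × H => rankOneCompact p.1 p.2 :=
  continuous_induced_rng.2 (((ContinuousLinearMap.toSpanSingletonCLE (𝕜 := ℂ)).continuous.comp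
    continuous_fst).clm_comp ((innerSL ℂ (E := H)).continuous.comp continuous_snd))

end CompactApproximation

/-! ### Systems of matrix units indexed by continuous functions -/

section KernelSystem

variable {G : Type*} [TopologicalSpace G] [CompactSpace G] [MeasurableSpace G] [BorelSpace G]
  (μ : Measure G) [IsFiniteMeasure μ]

/-- The inner product of `L²(G)`, on continuous functions. -/
def funInner (ξ η : C(G, ℂ)) : ℂ :=
  inner ℂ (ContinuousMap.toLp 2 μ ℂ ξ) (ContinuousMap.toLp 2 μ ℂ η)

/-- A map `(ξ, η, a) ↦ m(ξ, η, a)` that behaves like `a ⊗ |ξ⟩⟨η|`. -/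
structure KernelSystem {A D : Type*} [NonUnitalRing A] [StarRing A] [Module ℂ A]
    [NonUnitalRing D] [StarRing D] [Module ℂ D] (m : C(G, ℂ) → C(G, ℂ) → A →ₗ[ℂ] D) : Prop where
  mul_apply : ∀ ξ η ξ' η' a b, m ξ η a * m ξ' η' b = funInner μ η ξ' • m ξ η' (a * b)
  star_apply : ∀ ξ η a, star (m ξ η a) = m η ξ (star a)

/-- A finite family of continuous functions that is orthonormal in `L²(G)`. -/
def FunOrthonormal {n : ℕ} (ξ : Fin n → C(G, ℂ)) : Prop :=
  ∀ i j, funInner μ (ξ i) (ξ j) = if i = j then 1 else 0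

variable {μ} {A D : Type*} [NonUnitalRing A] [StarRing A] [Module ℂ A]
    [NonUnitalRing D] [StarRing D] [Module ℂ D] {m : C(G, ℂ) → C(G, ℂ) → A →ₗ[ℂ] D}

/-- The element `∑ m(ξ_i, ξ_j, a_ij)` that is given by a matrix. -/
def matrixElement (m : C(G, ℂ) → C(G, ℂ) → A →ₗ[ℂ] D) {n : ℕ} (ξ : Fin n → C(G, ℂ))
    (a : Matrix (Fin n) (Fin n) A) : D :=
  ∑ i, ∑ j, m (ξ i) (ξ j) (a i j)

/-- Over an orthonormal family the elements `m(ξ_i, ξ_j, ·)` multiply like matrix units. Products in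
every kernel system thus become matrix products, which is what allows two kernel systems to be
compared. -/
theorem KernelSystem.matrixElement_mul (hm : KernelSystem μ m) {n : ℕ} {ξ : Fin n → C(G, ℂ)}
    (hξ : FunOrthonormal μ ξ) (a b : Matrix (Fin n) (Fin n) A) :
    matrixElement m ξ (a * b) = matrixElement m ξ a * matrixElement m ξ b := by
  have h : ∀ i j k l, m (ξ i) (ξ j) (a i j) * m (ξ k) (ξ l) (b k l) =
      if j = k then m (ξ i) (ξ l) (a i j * b k l) else 0 := fun i j k l => by
    rw [hm.mul_apply, hξ]
    split_ifs <;> simp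
  simp only [matrixElement, Finset.sum_mul]
  simp only [Finset.mul_sum, Matrix.mul_apply, map_sum, h]
  refine Finset.sum_congr rfl fun i _ => ?_
  rw [Finset.sum_comm]
  refine Finset.sum_congr rfl fun j _ => ?_
  rw [Finset.sum_comm]
  exact Finset.sum_congr rfl fun l _ => by simp

theorem KernelSystem.matrixElement_star (hm : KernelSystem μ m) {n : ℕ} {ξ : Fin n → C(G, ℂ)}
    (a : Matrix (Fin n) (Fin n) A) :
    matrixElement m ξ (star a) = star (matrixElement m ξ a) := by
  simp only [matrixElement, star_sum, hm.star_apply]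
  rw [Finset.sum_comm]
  rfl

/-- Every finite set of continuous functions is contained in the span of an orthonormal family of
continuous functions. -/
theorem exists_funOrthonormal [SecondCountableTopology G] [μ.IsOpenPosMeasure]
    (S : Finset C(G, ℂ)) : ∃ (n : ℕ) (ξ : Fin n → C(G, ℂ)), FunOrthonormal μ ξ ∧
      ∀ f ∈ S, f ∈ Submodule.span ℂ (Set.range ξ) := by
  let Λ : C(G, ℂ) →ₗ[ℂ] Lp ℂ 2 μ := (ContinuousMap.toLp 2 μ ℂ : C(G, ℂ) →L[ℂ] Lp ℂ 2 μ)
  -- A measure of full support separates continuous functions. Thus an orthonormal basis of the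
  -- image in `L²`, together with the expansions in it, can be pulled back to `C(G)`.
  have hΛ : Function.Injective Λ := ContinuousMap.toLp_injective μ
  let V : Submodule ℂ C(G, ℂ) := Submodule.span ℂ S
  have : FiniteDimensional ℂ V := FiniteDimensional.span_finset ℂ S
  let b := stdOrthonormalBasis ℂ (V.map Λ)
  have hb : ∀ i, ∃ ξ, Λ ξ = b i := fun i => by
    obtain ⟨ξ, _, h⟩ := (b i).2
    exact ⟨ξ, h⟩
  choose ξ hξ using hb
  refine ⟨_, ξ, fun i j => ?_, fun f hf => ?_⟩
  · change inner ℂ (Λ (ξ i)) (Λ (ξ j)) = _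
    rw [hξ, hξ]
    exact orthonormal_iff_ite.1 b.orthonormal i j
  · have hmem : Λ f ∈ V.map Λ := Submodule.mem_map_of_mem (Submodule.subset_span hf)
    have e := congrArg Subtype.val (b.sum_repr ⟨Λ f, hmem⟩)
    have e2 : f = ∑ i, b.repr ⟨Λ f, hmem⟩ i • ξ i := by
      apply hΛ
      exact e.symm.trans (by simp [hξ])
    rw [e2]
    exact Submodule.sum_mem _ fun i _ => Submodule.smul_mem _ _ (Submodule.subset_span ⟨i, rfl⟩)

theorem tensor_induction {M : Type*} [AddCommGroup M] [Module ℂ M]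
    {P : (C(G, ℂ) ⊗[ℂ] C(G, ℂ)) ⊗[ℂ] M → Prop}
    (hadd : ∀ x y, P x → P y → P (x + y)) (htmul : ∀ f g a, P ((f ⊗ₜ g) ⊗ₜ a))
    (x : (C(G, ℂ) ⊗[ℂ] C(G, ℂ)) ⊗[ℂ] M) : P x := by
  have h0 : P 0 := by
    have := htmul 0 0 0
    rwa [TensorProduct.tmul_zero] at this
  induction x using TensorProduct.induction_on with
  | zero => exact h0
  | tmul p a =>
    induction p using TensorProduct.induction_on with
    | zero => rw [TensorProduct.zero_tmul]; exact h0
    | tmul f g => exact htmul f g a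
    | add p q hp hq => rw [TensorProduct.add_tmul]; exact hadd _ _ hp hq
  | add x y hx hy => exact hadd _ _ hx hy

/-- Every element of `C(G) ⊙ C(G) ⊙ M` can be written as a matrix over an orthonormal family. -/
theorem exists_matrix_repr [SecondCountableTopology G] [μ.IsOpenPosMeasure]
    {M : Type*} [AddCommGroup M] [Module ℂ M] (x : (C(G, ℂ) ⊗[ℂ] C(G, ℂ)) ⊗[ℂ] M) :
    ∃ (n : ℕ) (ξ : Fin n → C(G, ℂ)) (a : Fin n → Fin n → M), FunOrthonormal μ ξ ∧
      x = ∑ i, ∑ j, (ξ i ⊗ₜ[ℂ] star (ξ j)) ⊗ₜ[ℂ] a i j := by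
  classical
  have hS : ∃ S : Finset C(G, ℂ), x ∈ Submodule.span ℂ
      {y | ∃ f ∈ S, ∃ g ∈ S, ∃ a : M, y = (f ⊗ₜ[ℂ] star g) ⊗ₜ[ℂ] a} := by
    induction x using tensor_induction with
    | hadd x y hx hy =>
      obtain ⟨S, hS⟩ := hx
      obtain ⟨S', hS'⟩ := hy
      refine ⟨S ∪ S', add_mem (Submodule.span_mono ?_ hS) (Submodule.span_mono ?_ hS')⟩
      · rintro _ ⟨f, hf, g, hg, a, rfl⟩
        exact ⟨f, Finset.mem_union_left _ hf, g, Finset.mem_union_left _ hg, a, rfl⟩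
      · rintro _ ⟨f, hf, g, hg, a, rfl⟩
        exact ⟨f, Finset.mem_union_right _ hf, g, Finset.mem_union_right _ hg, a, rfl⟩
    | htmul f g a =>
      -- The second leg is required in the form of a conjugate, so `g` is written as `star (star
      -- g)`.
      exact ⟨{f, star g}, Submodule.subset_span ⟨f, by simp, star g, by simp, a, by simp⟩⟩
  obtain ⟨S, hS⟩ := hS
  obtain ⟨n, ξ, hξ, hspan⟩ := exists_funOrthonormal (μ := μ) S
  let R : (Fin n → Fin n → M) →ₗ[ℂ] (C(G, ℂ) ⊗[ℂ] C(G, ℂ)) ⊗[ℂ] M :=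
    { toFun := fun a => ∑ i, ∑ j, (ξ i ⊗ₜ[ℂ] star (ξ j)) ⊗ₜ[ℂ] a i j
      map_add' := fun a b => by
        simp only [Pi.add_apply, TensorProduct.tmul_add, Finset.sum_add_distrib]
      map_smul' := fun c a => by
        simp only [Pi.smul_apply, TensorProduct.tmul_smul, Finset.smul_sum, RingHom.id_apply] }
  have hR : x ∈ LinearMap.range R := by
    refine Submodule.span_le.2 ?_ hS
    rintro _ ⟨f, hf, g, hg, a, rfl⟩
    obtain ⟨c, hc⟩ := (Submodule.mem_span_range_iff_exists_fun ℂ).1 (hspan f hf)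
    obtain ⟨d, hd⟩ := (Submodule.mem_span_range_iff_exists_fun ℂ).1 (hspan g hg)
    refine ⟨fun i j => (c i * star (d j)) • a, ?_⟩
    rw [← hc, ← hd]
    change ∑ i, ∑ j, (ξ i ⊗ₜ[ℂ] star (ξ j)) ⊗ₜ[ℂ] ((c i * star (d j)) • a) = _
    rw [star_sum, TensorProduct.sum_tmul, TensorProduct.sum_tmul]
    refine Finset.sum_congr rfl fun i _ => ?_
    rw [TensorProduct.tmul_sum, TensorProduct.sum_tmul]
    refine Finset.sum_congr rfl fun j _ => ?_
    rw [star_smul, TensorProduct.smul_tmul_smul, TensorProduct.smul_tmul]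
  obtain ⟨a, ha⟩ := hR
  exact ⟨n, ξ, a, hξ, ha.symm⟩

end KernelSystem

/-! ### The kernel functions in `C(G, C(G, A))` -/

theorem funInner_eq_integral {G : Type*} [TopologicalSpace G] [CompactSpace G] [MeasurableSpace G]
    [BorelSpace G] [SecondCountableTopology G] (μ : Measure G) [IsFiniteMeasure μ]
    (ξ η : C(G, ℂ)) : funInner μ ξ η = ∫ t, star (ξ t) * η t ∂μ := by
  refine (ContinuousMap.inner_toLp μ ξ η).trans ?_
  exact integral_congr_ae (Filter.Eventually.of_forall fun t => mul_comm _ _)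

namespace CStarAction

variable {G : Type*} [Group G] [TopologicalSpace G] [IsTopologicalGroup G] [CompactSpace G]
  [SecondCountableTopology G] [MeasurableSpace G] [BorelSpace G]
  {A : Type*} [NonUnitalCStarAlgebra A] (α : CStarAction G A)

/-- The function `s ↦ (t ↦ α_t(k(t)(s⁻¹ t)))` that is given by a kernel `k`. -/
def kernelTransformFun (k : C(G, C(G, A))) : C(G, C(G, A)) :=
  ContinuousMap.curry
    { toFun := fun p : G × G => α.aut p.2 (k p.2 (p.1⁻¹ * p.2))
      continuous_toFun := α.continuous_aut_comp continuous_snd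
        ((k.continuous.comp continuous_snd).eval (continuous_fst.inv.mul continuous_snd)) }

/-- The map `k ↦ (s ↦ (t ↦ α_t(k(t)(s⁻¹ t))))`. -/
def kernelTransform : C(G, C(G, A)) →L[ℂ] C(G, C(G, A)) :=
  LinearMap.mkContinuous
    { toFun := α.kernelTransformFun
      map_add' := fun k l => ContinuousMap.ext fun s => ContinuousMap.ext fun t =>
        map_add (α.aut t) _ _
      map_smul' := fun c k => ContinuousMap.ext fun s => ContinuousMap.ext fun t =>
        map_smul (α.aut t) c _ } 1 fun k => by
    rw [one_mul, ContinuousMap.norm_le _ (norm_nonneg _)]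
    intro s
    rw [ContinuousMap.norm_le _ (norm_nonneg _)]
    intro t
    change ‖α.aut t (k t (s⁻¹ * t))‖ ≤ _
    rw [α.norm_aut]
    exact ((k t).norm_coe_le_norm _).trans (k.norm_coe_le_norm t)

theorem kernelTransform_surjective : Function.Surjective α.kernelTransform := by
  intro F
  -- The kernel of `F` is `k(t)(r) = α_t⁻¹(F(t r⁻¹)(t))`, obtained by solving `r = s⁻¹ t` for `s`.
  refine ⟨ContinuousMap.curry
    { toFun := fun p : G × G => α.aut p.1⁻¹ (F (p.1 * p.2⁻¹) p.1)
      continuous_toFun := α.continuous_aut_comp continuous_fst.inv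
        ((F.continuous.comp (continuous_fst.mul continuous_snd.inv)).eval continuous_fst) }, ?_⟩
  refine ContinuousMap.ext fun s => ContinuousMap.ext fun t => ?_
  change α.aut t (α.aut t⁻¹ (F (t * (s⁻¹ * t)⁻¹) t)) = F s t
  rw [← α.aut_mul, mul_inv_cancel, α.aut_one]
  congr 2
  group

variable (G A) in
/-- The map `C(G) ⊙ C(G) ⊙ A → C(G, C(G, A))`. -/
def tensorToKernel : (C(G, ℂ) ⊗[ℂ] C(G, ℂ)) ⊗[ℂ] A →ₗ[ℂ] C(G, C(G, A)) :=
  tensorToFun G C(G, A) ∘ₗ LinearMap.lTensor C(G, ℂ) (tensorToFun G A) ∘ₗ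
    (TensorProduct.assoc ℂ C(G, ℂ) C(G, ℂ) A).toLinearMap

theorem denseRange_tensorToKernel [T2Space G] : DenseRange (tensorToKernel G A) := by
  intro k
  let P : Submodule ℂ C(G, C(G, A)) := (LinearMap.range (tensorToKernel G A)).topologicalClosure
  suffices h : k ∈ P from h
  induction k using continuousMap_induction with
  | hcl => exact Submodule.isClosed_topologicalClosure _
  | hadd F F' hF hF' => exact add_mem hF hF'
  | hsmul f h =>
    have hc : Continuous fun h : C(G, A) => smulConst G C(G, A) f h :=
      AddMonoidHomClass.continuous_of_bound (smulConst G C(G, A) f) ‖f‖ fun h =>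
        norm_smulConst f h
    induction h using continuousMap_induction with
    | hcl => exact (Submodule.isClosed_topologicalClosure _).preimage hc
    | hadd F F' hF hF' => rw [map_add]; exact add_mem hF hF'
    | hsmul g a =>
      exact Submodule.le_topologicalClosure _ ⟨(f ⊗ₜ g) ⊗ₜ a, rfl⟩

variable (μ : Measure G) [μ.IsHaarMeasure] [IsProbabilityMeasure μ]

/-- The kernel functions `s ↦ (t ↦ ξ(t) conj(η(s⁻¹ t)) α_t(a))`, as linear maps in `a`. -/
def kernelElementₗ (ξ η : C(G, ℂ)) : A →ₗ[ℂ] ConvAlg α.shiftTensor μ where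
  toFun a := α.kernelElement μ a ξ η
  map_add' a b := ConvAlg.ext fun s => ContinuousMap.ext fun t => by
    change (ξ t * star (η (s⁻¹ * t))) • α.aut t (a + b) = (ξ t * star (η (s⁻¹ * t))) • α.aut t a +
      (ξ t * star (η (s⁻¹ * t))) • α.aut t b
    rw [map_add, smul_add]
  map_smul' c a := ConvAlg.ext fun s => ContinuousMap.ext fun t => by
    change (ξ t * star (η (s⁻¹ * t))) • α.aut t (c • a) =
      c • (ξ t * star (η (s⁻¹ * t))) • α.aut t a
    rw [map_smul, smul_comm]

/-- In the convolution integral over `r` the automorphisms combine to `α_r α_{r⁻¹ t} = α_t`, and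
`η'` is evaluated at `s⁻¹ t`. The only dependence on `r` left is the scalar `conj(η) ξ'` at `r⁻¹ t`,
whose integral is `⟨η, ξ'⟩` by invariance under inversion and translation. -/
theorem kernelSystem_kernelElementₗ : KernelSystem μ (α.kernelElementₗ μ) where
  mul_apply ξ η ξ' η' a b := by
    refine ConvAlg.ext fun s => ContinuousMap.ext fun t => ?_
    have h1 := (homL (evalHom A t)).integral_comp_comm
      (ConvAlg.integrable_integrand (α.kernelElementₗ μ ξ η a) (α.kernelElementₗ μ ξ' η' b) s)
    refine h1.symm.trans ?_
    have h2 : ∀ r, homL (evalHom A t) (α.kernelElementₗ μ ξ η a r *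
        α.shiftTensor.aut r (α.kernelElementₗ μ ξ' η' b (r⁻¹ * s))) =
        (star (η (r⁻¹ * t)) * ξ' (r⁻¹ * t)) •
          ((ξ t * star (η' (s⁻¹ * t))) • α.aut t (a * b)) := fun r => by
      change (ξ t * star (η (r⁻¹ * t))) • α.aut t a *
        α.aut r ((ξ' (r⁻¹ * t) * star (η' ((r⁻¹ * s)⁻¹ * (r⁻¹ * t)))) • α.aut (r⁻¹ * t) b) = _
      rw [map_smul, ← α.aut_mul, mul_inv_cancel_left, smul_mul_smul_comm, ← map_mul, smul_smul]
      congr 1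
      have e : (r⁻¹ * s)⁻¹ * (r⁻¹ * t) = s⁻¹ * t := by group
      rw [e]
      ring
    simp_rw [h2]
    rw [integral_smul_const]
    have h3 := integral_inv_mul_of_continuous μ (f := fun r => star (η r) * ξ' r)
      (η.continuous.star.mul ξ'.continuous) t
    rw [h3, ← funInner_eq_integral]
    rfl
  star_apply ξ η a := by
    refine ConvAlg.ext fun s => ContinuousMap.ext fun t => ?_
    change α.aut s (star ((ξ (s⁻¹ * t) * star (η (s⁻¹⁻¹ * (s⁻¹ * t)))) • α.aut (s⁻¹ * t) a)) =
      (η t * star (ξ (s⁻¹ * t))) • α.aut t (star a)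
    rw [star_smul, map_smul, ← map_star (α.aut (s⁻¹ * t)), ← α.aut_mul, mul_inv_cancel_left,
      inv_inv, mul_inv_cancel_left, star_mul, star_star]

variable (G) in
/-- The map `C(G) ⊙ C(G) ⊙ A → C(G, C(G, A))` to the kernel functions. -/
def tensorToConv : (C(G, ℂ) ⊗[ℂ] C(G, ℂ)) ⊗[ℂ] A →ₗ[ℂ] C(G, C(G, A)) :=
  (α.kernelTransform : C(G, C(G, A)) →ₗ[ℂ] C(G, C(G, A))) ∘ₗ tensorToKernel G A

theorem denseRange_tensorToConv [T2Space G] : DenseRange (α.tensorToConv G) :=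
  α.kernelTransform_surjective.denseRange.comp denseRange_tensorToKernel
    α.kernelTransform.continuous

theorem ofFun_tensorToConv_tmul (f g : C(G, ℂ)) (a : A) :
    ConvAlg.ofFun α.shiftTensor μ (α.tensorToConv G ((f ⊗ₜ g) ⊗ₜ a)) =
      α.kernelElementₗ μ f (star g) a :=
  ConvAlg.ext fun s => ContinuousMap.ext fun t => by
    change α.aut t (f t • g (s⁻¹ * t) • a) = (f t * star (star (g (s⁻¹ * t)))) • α.aut t a
    rw [star_star, smul_smul, map_smul]

theorem ofFun_tensorToConv_matrix {n : ℕ} (ξ : Fin n → C(G, ℂ)) (a : Matrix (Fin n) (Fin n) A) :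
    ConvAlg.ofFun α.shiftTensor μ
      (α.tensorToConv G (∑ i, ∑ j, (ξ i ⊗ₜ[ℂ] star (ξ j)) ⊗ₜ[ℂ] a i j)) =
      matrixElement (α.kernelElementₗ μ) ξ a := by
  simp only [map_sum, ofFun_tensorToConv_tmul, star_star, matrixElement]

end CStarAction

/-! ### Models of the algebra of compact operators on `L²(G)` -/

section ElementaryTensors

variable {A K : Type*} [NonUnitalCStarAlgebra A] [NonUnitalCStarAlgebra K]

theorem elemTensor_mul (a b : A) (k l : K) :
    elemTensor a k * elemTensor b l = elemTensor (a * b) (k * l) := by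
  refine (SeminormFamily.Env.of_mul (tensorSeminorms A K) _ _).symm.trans ?_
  exact congrArg _ (Algebra.TensorProduct.tmul_mul_tmul a b k l)

theorem elemTensor_star (a : A) (k : K) :
    star (elemTensor a k) = elemTensor (star a) (star k) := by
  refine (SeminormFamily.Env.of_star (tensorSeminorms A K) _).symm.trans ?_
  exact congrArg _ (TensorProduct.star_tmul a k)

theorem norm_elemTensor_le (a : A) (k : K) : ‖elemTensor a k‖ ≤ ‖a‖ * ‖k‖ := by
  refine (norm_envOfₗ (tensorSeminorms A K) (a ⊗ₜ[ℂ] k)).trans_le ?_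
  exact SeminormFamily.sup_le _ (by positivity) fun p hp => hp a k

end ElementaryTensors

section CompactModel

variable {G : Type*} [TopologicalSpace G] [CompactSpace G] [SecondCountableTopology G]
  [MeasurableSpace G] [BorelSpace G] (μ : Measure G) [IsFiniteMeasure μ]
  {K : Type*} [NonUnitalCStarAlgebra K]

/-- A linear map `ρ : C(G) ⊙ C(G) → K` that behaves like the map `f ⊗ conj(g) ↦ |f⟩⟨g|` to the
compact operators on `L²(G)`. -/
structure CompactModel (ρ : C(G, ℂ) ⊗[ℂ] C(G, ℂ) →ₗ[ℂ] K) : Prop where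
  mul_apply : ∀ f g f' g', ρ (f ⊗ₜ star g) * ρ (f' ⊗ₜ star g') =
    funInner μ g f' • ρ (f ⊗ₜ star g')
  star_apply : ∀ f g, star (ρ (f ⊗ₜ star g)) = ρ (g ⊗ₜ star f)
  norm_coeff_le : ∀ {n : ℕ} (ξ : Fin n → C(G, ℂ)) (c : Fin n → Fin n → ℂ), FunOrthonormal μ ξ →
    ∀ i j, ‖c i j‖ ≤ ‖∑ i, ∑ j, c i j • ρ (ξ i ⊗ₜ star (ξ j))‖
  denseRange : DenseRange ρ

variable {ρ : C(G, ℂ) ⊗[ℂ] C(G, ℂ) →ₗ[ℂ] K} (A : Type*) [NonUnitalCStarAlgebra A]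

/-- The scalar multiples of `ρ(ξ ⊗ conj(η))`. -/
def compactKernel (ρ : C(G, ℂ) ⊗[ℂ] C(G, ℂ) →ₗ[ℂ] K) (ξ η : C(G, ℂ)) : ℂ →ₗ[ℂ] K :=
  LinearMap.toSpanSingleton ℂ K (ρ (ξ ⊗ₜ star η))

/-- The elements `a ⊗ ρ(ξ ⊗ conj(η))`, as linear maps in `a`. -/
def elemKernel (ρ : C(G, ℂ) ⊗[ℂ] C(G, ℂ) →ₗ[ℂ] K) (ξ η : C(G, ℂ)) : A →ₗ[ℂ] CStarTensor A K :=
  envOfₗ (tensorSeminorms A K) ∘ₗ (TensorProduct.mk ℂ A K).flip (ρ (ξ ⊗ₜ star η))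

/-- The map `C(G) ⊙ C(G) ⊙ A → A ⊗ K` induced by `ρ`. -/
def tensorToElem (ρ : C(G, ℂ) ⊗[ℂ] C(G, ℂ) →ₗ[ℂ] K) :
    (C(G, ℂ) ⊗[ℂ] C(G, ℂ)) ⊗[ℂ] A →ₗ[ℂ] CStarTensor A K :=
  envOfₗ (tensorSeminorms A K) ∘ₗ (TensorProduct.comm ℂ K A).toLinearMap ∘ₗ LinearMap.rTensor A ρ

variable {A}

theorem elemKernel_apply (ξ η : C(G, ℂ)) (a : A) :
    elemKernel A ρ ξ η a = elemTensor a (ρ (ξ ⊗ₜ star η)) := rfl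

theorem tensorToElem_tmul (p : C(G, ℂ) ⊗[ℂ] C(G, ℂ)) (a : A) :
    tensorToElem A ρ (p ⊗ₜ a) = elemTensor a (ρ p) := rfl

theorem tensorToElem_tmul_tmul (f g : C(G, ℂ)) (a : A) :
    tensorToElem A ρ ((f ⊗ₜ g) ⊗ₜ a) = elemKernel A ρ f (star g) a := by
  rw [elemKernel_apply, star_star, tensorToElem_tmul]

theorem tensorToElem_matrix {n : ℕ} (ξ : Fin n → C(G, ℂ)) (a : Matrix (Fin n) (Fin n) A) :
    tensorToElem A ρ (∑ i, ∑ j, (ξ i ⊗ₜ[ℂ] star (ξ j)) ⊗ₜ[ℂ] a i j) =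
      matrixElement (elemKernel A ρ) ξ a := by
  simp only [map_sum, tensorToElem_tmul_tmul, star_star, matrixElement]

variable {μ}

theorem CompactModel.kernelSystem_compactKernel (hρ : CompactModel μ ρ) :
    KernelSystem μ (compactKernel ρ) where
  mul_apply ξ η ξ' η' a b := by
    simp only [compactKernel, LinearMap.toSpanSingleton_apply]
    rw [smul_mul_smul_comm, hρ.mul_apply, smul_comm]
  star_apply ξ η a := by
    simp only [compactKernel, LinearMap.toSpanSingleton_apply]
    rw [star_smul, hρ.star_apply]

theorem CompactModel.kernelSystem_elemKernel (hρ : CompactModel μ ρ) :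
    KernelSystem μ (elemKernel A ρ) where
  mul_apply ξ η ξ' η' a b := by
    rw [elemKernel_apply, elemKernel_apply, elemTensor_mul, hρ.mul_apply]
    exact (congrArg (envOfₗ (tensorSeminorms A K)) (TensorProduct.tmul_smul _ _ _)).trans
      (map_smul _ _ _)
  star_apply ξ η a := by
    rw [elemKernel_apply, elemTensor_star, hρ.star_apply, elemKernel_apply]

end CompactModel

section CompactOperators

variable {G : Type*} [TopologicalSpace G] [CompactSpace G] [SecondCountableTopology G]
  [MeasurableSpace G] [BorelSpace G] (μ : Measure G) [IsFiniteMeasure μ]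
  {H : Type*} [NormedAddCommGroup H] [InnerProductSpace ℂ H] [CompleteSpace H]
  (Λ : C(G, ℂ) →ₗ[ℂ] H)

/-- The map `C(G) ⊙ C(G) → K(H)` with `f ⊗ conj(g) ↦ |Λ f⟩⟨Λ g|`. -/
def tensorToCompact : C(G, ℂ) ⊗[ℂ] C(G, ℂ) →ₗ[ℂ] compacts H :=
  TensorProduct.lift (LinearMap.mk₂ ℂ (fun f g => rankOneCompact (Λ f) (Λ (star g)))
    (fun f f' g => Subtype.ext (by simp [rankOneCompact]))
    (fun c f g => Subtype.ext (by simp [rankOneCompact]))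
    (fun f g g' => Subtype.ext (by simp [rankOneCompact]))
    (fun c f g => Subtype.ext (by simp [rankOneCompact])))

variable {Λ}

theorem tensorToCompact_tmul (f g : C(G, ℂ)) :
    tensorToCompact Λ (f ⊗ₜ star g) = rankOneCompact (Λ f) (Λ g) :=
  congrArg (fun h => rankOneCompact (Λ f) (Λ h)) (star_star g)

/-- The rank-one operators `|u⟩⟨v|` depend continuously on `u` and `v`, so the closure of the range
contains all of them, hence all finite sums of them, hence all compact operators. -/
theorem denseRange_tensorToCompact (hd : DenseRange Λ) : DenseRange (tensorToCompact Λ) := by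
  let P : Submodule ℂ (compacts H) := (LinearMap.range (tensorToCompact Λ)).topologicalClosure
  have hP : IsClosed (P : Set (compacts H)) := Submodule.isClosed_topologicalClosure _
  have h1 : ∀ p : H × H, rankOneCompact p.1 p.2 ∈ P := fun p => by
    refine (hd.prodMap hd).induction_on (p := fun p => rankOneCompact p.1 p.2 ∈ P) p
      (hP.preimage continuous_rankOneCompact) ?_
    rintro ⟨f, g⟩
    exact Submodule.le_topologicalClosure _ ⟨f ⊗ₜ star g, tensorToCompact_tmul f g⟩
  intro k
  suffices h : k ∈ P from h
  rw [← SetLike.mem_coe, ← hP.closure_eq, Metric.mem_closure_iff]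
  intro ε hε
  obtain ⟨n, u, v, huv⟩ := exists_sum_rankOne_near k.2 (half_pos hε)
  refine ⟨∑ i, rankOneCompact (u i) (v i), Submodule.sum_mem _ fun i _ => h1 (u i, v i), ?_⟩
  rw [dist_eq_norm]
  refine lt_of_le_of_lt (le_trans (le_of_eq ?_) huv) (half_lt_self hε)
  change ‖((k - ∑ i, rankOneCompact (u i) (v i) : compacts H) : H →L[ℂ] H)‖ = _
  rw [AddSubgroupClass.coe_sub, AddSubmonoidClass.coe_finsetSum]
  rfl

theorem compactModel_tensorToCompact (hd : DenseRange Λ)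
    (hΛ : ∀ f g, inner ℂ (Λ f) (Λ g) = funInner μ f g) : CompactModel μ (tensorToCompact Λ) where
  mul_apply f g f' g' := by
    simp only [tensorToCompact_tmul, rankOneCompact_mul, hΛ]
  star_apply f g := by simp only [tensorToCompact_tmul, rankOneCompact_star]
  norm_coeff_le {n} ξ c hξ k l := by
    let T : compacts H := ∑ i, ∑ j, c i j • tensorToCompact Λ (ξ i ⊗ₜ star (ξ j))
    have hn : ∀ i, ‖Λ (ξ i)‖ = 1 := fun i => by
      rw [norm_eq_sqrt_re_inner (𝕜 := ℂ), hΛ, hξ, if_pos rfl]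
      simp
    -- The coefficient `c k l` is the matrix entry of `T` at two unit vectors, so it is at most
    -- `‖T‖`.
    have e : inner ℂ (Λ (ξ k)) ((T : H →L[ℂ] H) (Λ (ξ l))) = c k l := by
      have e1 : (T : H →L[ℂ] H) =
          ∑ i, ∑ j, c i j • InnerProductSpace.rankOne ℂ (Λ (ξ i)) (Λ (ξ j)) := by
        simp only [T, AddSubmonoidClass.coe_finsetSum, tensorToCompact_tmul]
        rfl
      rw [e1]
      simp only [sum_apply, smul_apply,
        InnerProductSpace.rankOne_apply, inner_sum, inner_smul_right, hΛ,
        show ∀ i j, funInner μ (ξ i) (ξ j) = if i = j then 1 else 0 from hξ]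
      simp
    rw [← e]
    refine (norm_inner_le_norm _ _).trans ?_
    rw [hn, one_mul]
    refine ((T : H →L[ℂ] H).le_opNorm _).trans ?_
    rw [hn, mul_one]
    rfl
  denseRange := denseRange_tensorToCompact hd

end CompactOperators

/-! ### Comparison of the norms of kernels -/

namespace CStarAction

variable {G : Type*} [Group G] [TopologicalSpace G] [IsTopologicalGroup G] [CompactSpace G]
  [SecondCountableTopology G] [MeasurableSpace G] [BorelSpace G] [T2Space G]
  {A : Type*} [NonUnitalCStarAlgebra A] (α : CStarAction G A)
  {μ : Measure G} [μ.IsHaarMeasure] [IsProbabilityMeasure μ]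

/-- The transform only applies the isometries `α_t` and the substitution `s = t r⁻¹`, which is a
bijection of `G × G`. -/
theorem norm_le_norm_kernelTransform (k : C(G, C(G, A))) : ‖k‖ ≤ ‖α.kernelTransform k‖ := by
  rw [ContinuousMap.norm_le _ (norm_nonneg _)]
  intro t
  rw [ContinuousMap.norm_le _ (norm_nonneg _)]
  intro r
  have e : α.kernelTransform k (t * r⁻¹) t = α.aut t (k t r) := by
    change α.aut t (k t ((t * r⁻¹)⁻¹ * t)) = _
    congr 2
    group
  rw [← α.norm_aut t, ← e]
  exact ((α.kernelTransform k _).norm_coe_le_norm t).trans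
    ((α.kernelTransform k).norm_coe_le_norm _)

variable (μ) in
/-- The integral against a weight. -/
def weightedIntegral (h : C(G, ℂ)) (B : Type*) [NonUnitalCStarAlgebra B] : C(G, B) →L[ℂ] B :=
  LinearMap.mkContinuous
    { toFun := fun F => integralL μ B ⟨fun t => h t • F t, h.continuous.smul F.continuous⟩
      map_add' := fun F F' => by
        rw [← map_add]
        exact congrArg _ (ContinuousMap.ext fun t => smul_add _ _ _)
      map_smul' := fun c F => by
        rw [RingHom.id_apply, ← map_smul]
        exact congrArg _ (ContinuousMap.ext fun t => smul_comm _ _ _) } (‖integralL μ B‖ * ‖h‖)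
    fun F => by
      rw [mul_assoc]
      refine ((integralL μ B).le_opNorm _).trans (mul_le_mul_of_nonneg_left ?_ (norm_nonneg _))
      rw [ContinuousMap.norm_le _ (by positivity)]
      intro t
      refine (norm_smul_le _ _).trans ?_
      exact mul_le_mul (h.norm_coe_le_norm t) (F.norm_coe_le_norm t) (norm_nonneg _)
        (norm_nonneg _)

theorem weightedIntegral_smulConst (h f : C(G, ℂ)) {B : Type*} [NonUnitalCStarAlgebra B] (b : B) :
    weightedIntegral μ h B (smulConst G B f b) = funInner μ (star h) f • b := by
  change ∫ t, h t • f t • b ∂μ = _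
  simp_rw [smul_smul]
  rw [integral_smul_const, funInner_eq_integral]
  simp only [ContinuousMap.star_apply, star_star]

/-- The coefficients of a kernel are bounded by the supremum norm. -/
theorem exists_norm_coeff_le {n : ℕ} {ξ : Fin n → C(G, ℂ)} (hξ : FunOrthonormal μ ξ) (i j : Fin n) :
    ∃ C : ℝ, ∀ a : Matrix (Fin n) (Fin n) A,
      ‖a i j‖ ≤ C * ‖(ConvAlg.ofFun α.shiftTensor μ).symm
        (matrixElement (α.kernelElementₗ μ) ξ a)‖ := by
  let W := weightedIntegral μ (star (ξ i)) C(G, A)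
  let W' := weightedIntegral μ (ξ j) A
  have hξ' : ∀ i j, funInner μ (ξ i) (ξ j) = if i = j then 1 else 0 := hξ
  have hξ'' : ∀ i j, funInner μ (star (ξ i)) (star (ξ j)) = if j = i then 1 else 0 := fun i j => by
    rw [← hξ' j i, funInner_eq_integral, funInner_eq_integral]
    simp only [ContinuousMap.star_apply, star_star, mul_comm]
  refine ⟨‖W'‖ * ‖W‖, fun a => ?_⟩
  let k := tensorToKernel G A (∑ i, ∑ j, (ξ i ⊗ₜ[ℂ] star (ξ j)) ⊗ₜ[ℂ] a i j)
  have hk : k = ∑ i, ∑ j, smulConst G C(G, A) (ξ i) (smulConst G A (star (ξ j)) (a i j)) := by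
    simp only [k, map_sum]
    rfl
  -- Integrating the kernel against `conj(ξ_i)` in the first variable and `ξ_j` in the second
  -- extracts the entry `a i j`, by orthonormality.
  have e : W' (W k) = a i j := by
    simp only [hk, map_sum, W, W', weightedIntegral_smulConst, map_smul, star_star, hξ', hξ'']
    simp
  have e2 : (ConvAlg.ofFun α.shiftTensor μ).symm (matrixElement (α.kernelElementₗ μ) ξ a) =
      α.kernelTransform k := by
    rw [LinearEquiv.symm_apply_eq, ← ofFun_tensorToConv_matrix]
    rfl
  rw [e2, ← e, mul_assoc]
  refine (W'.le_opNorm _).trans (mul_le_mul_of_nonneg_left ?_ (norm_nonneg _))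
  refine (W.le_opNorm _).trans (mul_le_mul_of_nonneg_left ?_ (norm_nonneg _))
  exact α.norm_le_norm_kernelTransform k

variable {K : Type*} [NonUnitalCStarAlgebra K] {ρ : C(G, ℂ) ⊗[ℂ] C(G, ℂ) →ₗ[ℂ] K}

/-- After writing `e` as a matrix over an orthonormal family, the entries are bounded by the
supremum norm of the convolution element, which gives the estimate with a constant depending on the
family. As both sides are multiplicative in the matrix, the contractivity principle replaces the
constant by `1`. -/
theorem norm_tensorToElem_le (hρ : CompactModel μ ρ) (e : (C(G, ℂ) ⊗[ℂ] C(G, ℂ)) ⊗[ℂ] A) :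
    ‖tensorToElem A ρ e‖ ≤ ‖α.tensorToConv G e‖ := by
  obtain ⟨n, ξ, a, hξ, rfl⟩ := exists_matrix_repr (μ := μ) e
  have hm := α.kernelSystem_kernelElementₗ μ
  have hm' := hρ.kernelSystem_elemKernel (A := A)
  choose C hC using fun i j => α.exists_norm_coeff_le hξ i j
  have key := norm_le_of_norm_le_const_mul
    (fun a : Matrix (Fin n) (Fin n) A => matrixElement (elemKernel A ρ) ξ a)
    (hm'.matrixElement_mul hξ) hm'.matrixElement_star (fun x => by simp) (fun x y => star_mul x y)
    (fun a => ‖(ConvAlg.ofFun α.shiftTensor μ).symm (matrixElement (α.kernelElementₗ μ) ξ a)‖)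
    (fun a => ‖(ConvAlg.ofFun α.shiftTensor μ).symm (matrixElement (α.kernelElementₗ μ) ξ a)‖)
    (fun a => norm_nonneg _)
    (fun a b => by rw [hm.matrixElement_mul hξ]; exact ConvAlg.norm_symm_mul_le' _ _)
    (fun a => by rw [hm.matrixElement_star]; exact ConvAlg.norm_symm_star _)
    (fun a b => by rw [hm.matrixElement_mul hξ]; exact ConvAlg.norm_symm_mul_le' _ _)
    (∑ i, ∑ j, |C i j| * ‖ρ (ξ i ⊗ₜ star (ξ j))‖)
    (Finset.sum_nonneg fun i _ => Finset.sum_nonneg fun j _ => by positivity)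
    (fun a => by
      rw [Finset.sum_mul]
      refine norm_sum_le_of_le _ fun i _ => ?_
      rw [Finset.sum_mul]
      refine norm_sum_le_of_le _ fun j _ => (norm_elemTensor_le _ _).trans ?_
      rw [mul_right_comm]
      refine mul_le_mul_of_nonneg_right ((hC i j a).trans ?_) (norm_nonneg _)
      exact mul_le_mul_of_nonneg_right (le_abs_self _) (norm_nonneg _)) a
  refine (congrArg norm (tensorToElem_matrix ξ a)).trans_le (key.trans_eq ?_)
  exact congrArg norm
    ((LinearEquiv.symm_apply_eq _).2 (α.ofFun_tensorToConv_matrix μ ξ a).symm)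

theorem norm_kernelElementₗ_le (ξ η : C(G, ℂ)) (a : A) :
    ‖α.shiftTensor.toCrossedProduct μ (α.kernelElementₗ μ ξ η a)‖ ≤ ‖ξ‖ * ‖η‖ * ‖a‖ := by
  refine (α.shiftTensor.norm_toCrossedProduct_le μ _).trans
    ((ConvAlg.integral_norm_le _).trans ?_)
  rw [ContinuousMap.norm_le _ (by positivity)]
  intro s
  rw [ContinuousMap.norm_le _ (by positivity)]
  intro t
  change ‖(ξ t * star (η (s⁻¹ * t))) • α.aut t a‖ ≤ _
  rw [norm_smul, norm_mul, norm_star, α.norm_aut]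
  gcongr
  · exact ξ.norm_coe_le_norm t
  · exact η.norm_coe_le_norm _

/-- The contractivity principle is applied to `(a, c) ↦ ∑ m(ξ_i, ξ_j, c_ij a)` on `A × M_n(ℂ)`. This
map is multiplicative and star-preserving but not linear on the product; hence the principle is
formulated for semigroups. The initial bound comes from `norm_coeff_le`. The result is the
cross-norm inequality that a seminorm in `tensorSeminorms` has to satisfy. -/
theorem norm_tensorToConv_tmul_le (hρ : CompactModel μ ρ) (p : C(G, ℂ) ⊗[ℂ] C(G, ℂ)) (a : A) :
    ‖α.shiftTensor.funToCrossedProduct μ (α.tensorToConv G (p ⊗ₜ a))‖ ≤ ‖a‖ * ‖ρ p‖ := by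
  -- Tensoring with `1 ∈ ℂ` makes the matrix representation available for `p` itself, with scalar
  -- entries.
  obtain ⟨n, ξ, c, hξ, hp⟩ := exists_matrix_repr (μ := μ) (p ⊗ₜ[ℂ] (1 : ℂ))
  replace hp : p = ∑ i, ∑ j, c i j • (ξ i ⊗ₜ[ℂ] star (ξ j)) := by
    have := congrArg (TensorProduct.rid ℂ _) hp
    simpa only [map_sum, TensorProduct.rid_tmul, one_smul] using this
  have hm := α.kernelSystem_kernelElementₗ μ
  have hm' := hρ.kernelSystem_compactKernel
  let M : A × Matrix (Fin n) (Fin n) ℂ → Matrix (Fin n) (Fin n) A := fun x i j => x.2 i j • x.1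
  have hMmul : ∀ x y, M (x * y) = M x * M y := fun x y => by
    ext i j
    change (x.2 * y.2) i j • (x.1 * y.1) = ∑ k, (x.2 i k • x.1) * (y.2 k j • y.1)
    simp only [Matrix.mul_apply, Finset.sum_smul, smul_mul_smul_comm]
  have hMstar : ∀ x, M (star x) = star (M x) := fun x => by
    ext i j
    exact (star_smul (x.2 j i) x.1).symm
  have key := norm_le_of_norm_le_const_mul
    (fun x : A × Matrix (Fin n) (Fin n) ℂ => α.shiftTensor.toCrossedProduct μ
      (matrixElement (α.kernelElementₗ μ) ξ (M x)))
    (fun x y => by rw [hMmul, hm.matrixElement_mul hξ, map_mul])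
    (fun x => by rw [hMstar, hm.matrixElement_star, map_star])
    (fun x => by simp) (fun x y => star_mul x y)
    (fun x => ‖x.1‖ * ‖matrixElement (compactKernel ρ) ξ x.2‖)
    (fun x => ‖x.1‖ * ‖matrixElement (compactKernel ρ) ξ x.2‖)
    (fun x => by positivity)
    (fun x y => by
      rw [Prod.snd_mul, Prod.fst_mul, hm'.matrixElement_mul hξ, mul_mul_mul_comm]
      exact mul_le_mul (norm_mul_le _ _) (norm_mul_le _ _) (norm_nonneg _) (by positivity))
    (fun x => by rw [Prod.snd_star, Prod.fst_star, hm'.matrixElement_star, norm_star, norm_star])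
    (fun x y => by
      rw [Prod.snd_mul, Prod.fst_mul, hm'.matrixElement_mul hξ, mul_mul_mul_comm]
      exact mul_le_mul (norm_mul_le _ _) (norm_mul_le _ _) (norm_nonneg _) (by positivity))
    (∑ i, ∑ j, ‖ξ i‖ * ‖ξ j‖)
    (Finset.sum_nonneg fun i _ => Finset.sum_nonneg fun j _ => by positivity)
    (fun x => by
      simp only [matrixElement, map_sum]
      rw [Finset.sum_mul]
      refine norm_sum_le_of_le _ fun i _ => ?_
      rw [Finset.sum_mul]
      refine norm_sum_le_of_le _ fun j _ => (α.norm_kernelElementₗ_le _ _ _).trans ?_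
      refine mul_le_mul_of_nonneg_left ?_ (by positivity)
      refine (norm_smul_le _ _).trans ?_
      rw [mul_comm]
      exact mul_le_mul_of_nonneg_left (hρ.norm_coeff_le ξ x.2 hξ i j) (norm_nonneg _))
    (a, c)
  have e1 : matrixElement (compactKernel ρ) ξ c = ρ p := by
    rw [hp]
    simp only [map_sum, map_smul]
    rfl
  have e2 : p ⊗ₜ[ℂ] a = ∑ i, ∑ j, (ξ i ⊗ₜ[ℂ] star (ξ j)) ⊗ₜ[ℂ] M (a, c) i j := by
    rw [hp]
    simp only [TensorProduct.sum_tmul, M, TensorProduct.smul_tmul]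
  rw [e2, funToCrossedProduct_apply, ofFun_tensorToConv_matrix, ← e1]
  exact key

end CStarAction

/-! ### The canonical isomorphism -/

section CommonProducts

variable {G : Type*} [TopologicalSpace G] [CompactSpace G] [SecondCountableTopology G]
  [MeasurableSpace G] [BorelSpace G] {μ : Measure G} [IsFiniteMeasure μ]
  {A D D' : Type*} [NonUnitalRing A] [StarRing A] [Module ℂ A]
  [NonUnitalRing D] [StarRing D] [Module ℂ D] [IsScalarTower ℂ D D] [SMulCommClass ℂ D D]
  [NonUnitalRing D'] [StarRing D'] [Module ℂ D'] [IsScalarTower ℂ D' D'] [SMulCommClass ℂ D' D']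
  {m : C(G, ℂ) → C(G, ℂ) → A →ₗ[ℂ] D} {m' : C(G, ℂ) → C(G, ℂ) → A →ₗ[ℂ] D'}
  {L : (C(G, ℂ) ⊗[ℂ] C(G, ℂ)) ⊗[ℂ] A →ₗ[ℂ] D} {L' : (C(G, ℂ) ⊗[ℂ] C(G, ℂ)) ⊗[ℂ] A →ₗ[ℂ] D'}

/-- The products of two kernel systems are given by the same operation on tensors. -/
theorem exists_common_mul (hm : KernelSystem μ m) (hm' : KernelSystem μ m')
    (hL : ∀ f g a, L ((f ⊗ₜ g) ⊗ₜ a) = m f (star g) a)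
    (hL' : ∀ f g a, L' ((f ⊗ₜ g) ⊗ₜ a) = m' f (star g) a)
    (x y : (C(G, ℂ) ⊗[ℂ] C(G, ℂ)) ⊗[ℂ] A) :
    ∃ z, L z = L x * L y ∧ L' z = L' x * L' y := by
  induction x using tensor_induction with
  | hadd x x' hx hx' =>
    obtain ⟨z, hz, hz'⟩ := hx
    obtain ⟨w, hw, hw'⟩ := hx'
    exact ⟨z + w, by rw [map_add, map_add, add_mul, hz, hw],
      by rw [map_add, map_add, add_mul, hz', hw']⟩
  | htmul f g a =>
    induction y using tensor_induction with
    | hadd y y' hy hy' =>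
      obtain ⟨z, hz, hz'⟩ := hy
      obtain ⟨w, hw, hw'⟩ := hy'
      exact ⟨z + w, by rw [map_add, map_add, mul_add, hz, hw],
        by rw [map_add, map_add, mul_add, hz', hw']⟩
    | htmul f' g' b =>
      refine ⟨funInner μ (star g) f' • ((f ⊗ₜ g') ⊗ₜ (a * b)), ?_, ?_⟩
      · rw [map_smul, hL, hL, hL, hm.mul_apply]
      · rw [map_smul, hL', hL', hL', hm'.mul_apply]

/-- The adjoints for two kernel systems are given by the same operation on tensors. -/
theorem exists_common_star (hm : KernelSystem μ m) (hm' : KernelSystem μ m')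
    (hL : ∀ f g a, L ((f ⊗ₜ g) ⊗ₜ a) = m f (star g) a)
    (hL' : ∀ f g a, L' ((f ⊗ₜ g) ⊗ₜ a) = m' f (star g) a)
    (x : (C(G, ℂ) ⊗[ℂ] C(G, ℂ)) ⊗[ℂ] A) : ∃ z, L z = star (L x) ∧ L' z = star (L' x) := by
  induction x using tensor_induction with
  | hadd x x' hx hx' =>
    obtain ⟨z, hz, hz'⟩ := hx
    obtain ⟨w, hw, hw'⟩ := hx'
    exact ⟨z + w, by rw [map_add, map_add, star_add, hz, hw],
      by rw [map_add, map_add, star_add, hz', hw']⟩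
  | htmul f g a =>
    refine ⟨(star g ⊗ₜ star f) ⊗ₜ star a, ?_, ?_⟩
    · rw [hL, hL, hm.star_apply, star_star]
    · rw [hL', hL', hm'.star_apply, star_star]

end CommonProducts

namespace CStarAction

variable {G : Type*} [Group G] [TopologicalSpace G] [IsTopologicalGroup G] [CompactSpace G]
  [SecondCountableTopology G] [MeasurableSpace G] [BorelSpace G] [T2Space G]
  {A : Type*} [NonUnitalCStarAlgebra A] (α : CStarAction G A)
  {μ : Measure G} [μ.IsHaarMeasure] [IsProbabilityMeasure μ]
  {K : Type*} [NonUnitalCStarAlgebra K] {ρ : C(G, ℂ) ⊗[ℂ] C(G, ℂ) →ₗ[ℂ] K}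

theorem exists_hom_to_cstarTensor (hρ : CompactModel μ ρ) :
    ∃ Φ : α.shiftTensor.CrossedProduct μ →⋆ₙₐ[ℂ] CStarTensor A K,
      ∀ e, Φ (α.shiftTensor.funToCrossedProduct μ (α.tensorToConv G e)) = tensorToElem A ρ e := by
  have hmul := exists_common_mul
    (L := (ConvAlg.ofFun α.shiftTensor μ).toLinearMap ∘ₗ α.tensorToConv G)
    (L' := tensorToElem A ρ) (α.kernelSystem_kernelElementₗ μ) hρ.kernelSystem_elemKernel
    (α.ofFun_tensorToConv_tmul μ) tensorToElem_tmul_tmul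
  have hstar := exists_common_star
    (L := (ConvAlg.ofFun α.shiftTensor μ).toLinearMap ∘ₗ α.tensorToConv G)
    (L' := tensorToElem A ρ) (α.kernelSystem_kernelElementₗ μ) hρ.kernelSystem_elemKernel
    (α.ofFun_tensorToConv_tmul μ) tensorToElem_tmul_tmul
  have hC : ∀ e, ‖tensorToElem A ρ e‖ ≤ 1 * ‖α.tensorToConv G e‖ := fun e => by
    rw [one_mul]
    exact α.norm_tensorToElem_le hρ e
  have key := exists_crossedProduct_hom (E := (C(G, ℂ) ⊗[ℂ] C(G, ℂ)) ⊗[ℂ] A) (α := α.shiftTensor)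
    (μ := μ) (D := CStarTensor A K) (α.tensorToConv G) ?_ (tensorToElem A ρ) (C := 1) ?_ ?_ ?_
  · exact key
  · have h := α.denseRange_tensorToConv
    exact fun x => h x
  · exact hC
  · exact hmul
  · exact hstar

variable (μ) in
/-- The map `p ↦ κ(p ⊗ a)` from `C(G) ⊙ C(G)` to the crossed product. -/
def kernelToCrossedProduct (a : A) :
    C(G, ℂ) ⊗[ℂ] C(G, ℂ) →ₗ[ℂ] α.shiftTensor.CrossedProduct μ :=
  α.shiftTensor.funToCrossedProduct μ ∘ₗ α.tensorToConv G ∘ₗ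
    (TensorProduct.mk ℂ (C(G, ℂ) ⊗[ℂ] C(G, ℂ)) A).flip a

theorem kernelToCrossedProduct_apply (a : A) (p : C(G, ℂ) ⊗[ℂ] C(G, ℂ)) :
    α.kernelToCrossedProduct μ a p =
      α.shiftTensor.funToCrossedProduct μ (α.tensorToConv G (p ⊗ₜ a)) := rfl

theorem kernelToCrossedProduct_tmul (a : A) (f g : C(G, ℂ)) :
    α.kernelToCrossedProduct μ a (f ⊗ₜ g) =
      α.shiftTensor.toCrossedProduct μ (α.kernelElementₗ μ f (star g) a) :=
  congrArg (α.shiftTensor.toCrossedProduct μ) (α.ofFun_tensorToConv_tmul μ f g a)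

variable (μ) in
/-- The extension of `ρ(p) ↦ κ(p ⊗ a)` to `K`. -/
def compactToCrossedProduct (ρ : C(G, ℂ) ⊗[ℂ] C(G, ℂ) →ₗ[ℂ] K) (a : A) :
    K →L[ℂ] α.shiftTensor.CrossedProduct μ :=
  (α.kernelToCrossedProduct μ a).extendOfNorm ρ

theorem compactToCrossedProduct_apply (hρ : CompactModel μ ρ) (a : A)
    (p : C(G, ℂ) ⊗[ℂ] C(G, ℂ)) :
    α.compactToCrossedProduct μ ρ a (ρ p) = α.kernelToCrossedProduct μ a p :=
  LinearMap.extendOfNorm_eq hρ.denseRange ⟨‖a‖, fun p => α.norm_tensorToConv_tmul_le hρ p a⟩ p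

theorem norm_compactToCrossedProduct_le (hρ : CompactModel μ ρ) (a : A) (k : K) :
    ‖α.compactToCrossedProduct μ ρ a k‖ ≤ ‖a‖ * ‖k‖ := by
  refine hρ.denseRange.induction_on
    (p := fun k => ‖α.compactToCrossedProduct μ ρ a k‖ ≤ ‖a‖ * ‖k‖) k
    (isClosed_le (α.compactToCrossedProduct μ ρ a).continuous.norm
      (continuous_const.mul continuous_norm)) fun p => ?_
  rw [α.compactToCrossedProduct_apply hρ]
  exact α.norm_tensorToConv_tmul_le hρ p a

theorem compactToCrossedProduct_mul (hρ : CompactModel μ ρ) (a b : A) (k l : K) :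
    α.compactToCrossedProduct μ ρ (a * b) (k * l) =
      α.compactToCrossedProduct μ ρ a k * α.compactToCrossedProduct μ ρ b l := by
  refine (hρ.denseRange.prodMap hρ.denseRange).induction_on
    (p := fun x => α.compactToCrossedProduct μ ρ (a * b) (x.1 * x.2) =
      α.compactToCrossedProduct μ ρ a x.1 * α.compactToCrossedProduct μ ρ b x.2) (k, l)
    (isClosed_eq ((α.compactToCrossedProduct μ ρ (a * b)).continuous.comp
      (continuous_fst.mul continuous_snd))
      (((α.compactToCrossedProduct μ ρ a).continuous.comp continuous_fst).mul
        ((α.compactToCrossedProduct μ ρ b).continuous.comp continuous_snd))) ?_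
  rintro ⟨p, q⟩
  change α.compactToCrossedProduct μ ρ (a * b) (ρ p * ρ q) =
      α.compactToCrossedProduct μ ρ a (ρ p) * α.compactToCrossedProduct μ ρ b (ρ q)
  induction p using TensorProduct.induction_on with
  | zero => simp only [map_zero, zero_mul]
  | add p p' hp hp' => simp only [map_add, add_mul, hp, hp']
  | tmul f g =>
    induction q using TensorProduct.induction_on with
    | zero => simp only [map_zero, mul_zero]
    | add p p' hp hp' => simp only [map_add, mul_add, hp, hp']
    | tmul f' g' =>
      have h := hρ.mul_apply f (star g) f' (star g')
      rw [star_star, star_star] at h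
      rw [h, map_smul, α.compactToCrossedProduct_apply hρ, α.compactToCrossedProduct_apply hρ,
        α.compactToCrossedProduct_apply hρ, kernelToCrossedProduct_tmul,
        kernelToCrossedProduct_tmul, kernelToCrossedProduct_tmul, ← map_mul,
        (α.kernelSystem_kernelElementₗ μ).mul_apply, map_smul]

theorem compactToCrossedProduct_star (hρ : CompactModel μ ρ) (a : A) (k : K) :
    α.compactToCrossedProduct μ ρ (star a) (star k) =
      star (α.compactToCrossedProduct μ ρ a k) := by
  refine hρ.denseRange.induction_on
    (p := fun k => α.compactToCrossedProduct μ ρ (star a) (star k) =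
      star (α.compactToCrossedProduct μ ρ a k)) k
    (isClosed_eq ((α.compactToCrossedProduct μ ρ (star a)).continuous.comp continuous_star)
      (α.compactToCrossedProduct μ ρ a).continuous.star) fun p => ?_
  induction p using TensorProduct.induction_on with
  | zero => simp only [map_zero, star_zero]
  | add p p' hp hp' => simp only [map_add, star_add, hp, hp']
  | tmul f g =>
    have h := hρ.star_apply f (star g)
    rw [star_star] at h
    rw [h, α.compactToCrossedProduct_apply hρ, α.compactToCrossedProduct_apply hρ,
      kernelToCrossedProduct_tmul, kernelToCrossedProduct_tmul, ← map_star,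
      (α.kernelSystem_kernelElementₗ μ).star_apply, star_star]

/-- The bilinear map `(a, k) ↦ κ(ρ⁻¹(k) ⊗ a)`. -/
def compactToCrossedProductₗ (hρ : CompactModel μ ρ) :
    A →ₗ[ℂ] K →ₗ[ℂ] α.shiftTensor.CrossedProduct μ := by
  have hadd : ∀ a b, α.compactToCrossedProduct μ ρ (a + b) =
      α.compactToCrossedProduct μ ρ a + α.compactToCrossedProduct μ ρ b := fun a b => by
    refine DFunLike.coe_injective (hρ.denseRange.equalizer
      (ContinuousLinearMap.continuous _) (ContinuousLinearMap.continuous _) (funext fun p => ?_))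
    change α.compactToCrossedProduct μ ρ (a + b) (ρ p) =
      α.compactToCrossedProduct μ ρ a (ρ p) + α.compactToCrossedProduct μ ρ b (ρ p)
    simp only [α.compactToCrossedProduct_apply hρ, kernelToCrossedProduct_apply,
      TensorProduct.tmul_add, map_add]
  have hsmul : ∀ (c : ℂ) a, α.compactToCrossedProduct μ ρ (c • a) =
      c • α.compactToCrossedProduct μ ρ a := fun c a => by
    refine DFunLike.coe_injective (hρ.denseRange.equalizer
      (ContinuousLinearMap.continuous _) (ContinuousLinearMap.continuous _) (funext fun p => ?_))
    change α.compactToCrossedProduct μ ρ (c • a) (ρ p) =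
      c • α.compactToCrossedProduct μ ρ a (ρ p)
    simp only [α.compactToCrossedProduct_apply hρ, kernelToCrossedProduct_apply,
      TensorProduct.tmul_smul, map_smul]
  exact LinearMap.mk₂ ℂ (fun a k => α.compactToCrossedProduct μ ρ a k)
    (fun a b k => by rw [hadd]; rfl) (fun c a k => by rw [hsmul]; rfl)
    (fun a k l => map_add _ _ _) (fun c a k => map_smul _ _ _)

/-- The bilinear map `(a, k) ↦ κ(ρ⁻¹(k) ⊗ a)` is multiplicative, star-preserving and bounded by `‖a‖
‖k‖`. So the seminorm it defines on `A ⊙ K` is one of those used to form `A ⊗ K`, and the map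
extends; nuclearity of `K` plays no role. -/
theorem exists_hom_from_cstarTensor (hρ : CompactModel μ ρ) :
    ∃ Ψ : CStarTensor A K →⋆ₙₐ[ℂ] α.shiftTensor.CrossedProduct μ,
      ∀ e, Ψ (tensorToElem A ρ e) = α.shiftTensor.funToCrossedProduct μ (α.tensorToConv G e) := by
  let B := TensorProduct.lift (α.compactToCrossedProductₗ hρ)
  have hB : ∀ a k, B (a ⊗ₜ k) = α.compactToCrossedProduct μ ρ a k := fun a k => rfl
  let Ψ₀ : A ⊗[ℂ] K →⋆ₙₐ[ℂ] α.shiftTensor.CrossedProduct μ :=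
    { toFun := B
      map_smul' := map_smul B
      map_zero' := map_zero B
      map_add' := map_add B
      map_mul' := fun x y => by
        induction x using TensorProduct.induction_on with
        | zero => simp only [map_zero, zero_mul]
        | add x x' hx hx' => simp only [map_add, add_mul, hx, hx']
        | tmul a k =>
          induction y using TensorProduct.induction_on with
          | zero => simp only [map_zero, mul_zero]
          | add y y' hy hy' => simp only [map_add, mul_add, hy, hy']
          | tmul b l =>
            rw [Algebra.TensorProduct.tmul_mul_tmul, hB, hB, hB]
            exact α.compactToCrossedProduct_mul hρ a b k l
      map_star' := fun x => by
        induction x using TensorProduct.induction_on with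
        | zero => simp only [map_zero, star_zero]
        | add x x' hx hx' => simp only [map_add, star_add, hx, hx']
        | tmul a k =>
          rw [TensorProduct.star_tmul, hB, hB]
          exact α.compactToCrossedProduct_star hρ a k }
  obtain ⟨Ψ, hΨ⟩ := exists_env_hom (S := tensorSeminorms A K) Ψ₀ fun a k => by
    rw [homSeminorm_apply]
    exact α.norm_compactToCrossedProduct_le hρ a k
  refine ⟨Ψ, fun e => ?_⟩
  induction e using TensorProduct.induction_on with
  | zero => simp only [map_zero]
  | add e e' he he' => simp only [map_add, he, he']
  | tmul p a =>
    refine (hΨ (a ⊗ₜ ρ p)).trans ?_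
    exact α.compactToCrossedProduct_apply hρ a p

theorem denseRange_tensorToElem (hρ : CompactModel μ ρ) : DenseRange (tensorToElem A ρ) := by
  let P : Submodule ℂ (CStarTensor A K) := (LinearMap.range (tensorToElem A ρ)).topologicalClosure
  have hP : IsClosed (P : Set (CStarTensor A K)) := Submodule.isClosed_topologicalClosure _
  intro x
  suffices h : x ∈ P from h
  refine (denseRange_envOfₗ (tensorSeminorms A K)).induction_on (p := fun x => x ∈ P) x hP
    fun y => ?_
  induction y using TensorProduct.induction_on with
  | zero => rw [map_zero]; exact zero_mem _
  | add y y' hy hy' => rw [map_add]; exact add_mem hy hy'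
  | tmul a k =>
    let L : K →ₗ[ℂ] CStarTensor A K :=
      envOfₗ (tensorSeminorms A K) ∘ₗ TensorProduct.mk ℂ A K a
    have hL : Continuous L := AddMonoidHomClass.continuous_of_bound L ‖a‖ fun k =>
      norm_elemTensor_le a k
    exact hρ.denseRange.induction_on (p := fun k => L k ∈ P) k (hP.preimage hL) fun p =>
      Submodule.le_topologicalClosure _ ⟨p ⊗ₜ a, rfl⟩

/-- The isomorphism `(C(G) ⊗ A) ⋊ G ≅ A ⊗ K`. -/
theorem exists_equiv_cstarTensor (hρ : CompactModel μ ρ) :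
    ∃ Φ : α.shiftTensor.CrossedProduct μ ≃⋆ₐ[ℂ] CStarTensor A K,
      ∀ e, Φ (α.shiftTensor.funToCrossedProduct μ (α.tensorToConv G e)) = tensorToElem A ρ e := by
  obtain ⟨Φ, hΦ⟩ := α.exists_hom_to_cstarTensor hρ
  obtain ⟨Ψ, hΨ⟩ := α.exists_hom_from_cstarTensor hρ
  -- Both compositions are the identity on the image of `C(G) ⊙ C(G) ⊙ A`, which is dense on either
  -- side.
  have h1 : Ψ.comp Φ = NonUnitalStarAlgHom.id ℂ _ :=
    crossedProduct_hom_ext (α.tensorToConv G) α.denseRange_tensorToConv fun e => by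
      rw [NonUnitalStarAlgHom.comp_apply, hΦ, hΨ]
      rfl
  have h2 : ∀ x, Φ (Ψ x) = x := fun x => congrFun
    ((denseRange_tensorToElem hρ).equalizer (g := fun x => Φ (Ψ x)) (h := id)
      ((homL Φ).continuous.comp (homL Ψ).continuous) continuous_id
      (funext fun e => by
        change Φ (Ψ _) = _
        rw [hΨ, hΦ]
        rfl)) x
  exact ⟨{ toFun := Φ
           invFun := Ψ
           left_inv := fun x => DFunLike.congr_fun h1 x
           right_inv := h2
           map_mul' := map_mul Φ
           map_add' := map_add Φ
           map_star' := map_star Φ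
           map_smul' := map_smul Φ }, hΦ⟩

end CStarAction

/-! ### Transport of splittings along isomorphisms; existence and uniqueness on kernel functions -/

theorem SequentiallySplit.equiv_comp {B C D : Type*} [NonUnitalCStarAlgebra B]
    [NonUnitalCStarAlgebra C] [NonUnitalCStarAlgebra D] {φ : B →⋆ₙₐ[ℂ] C}
    (h : SequentiallySplit φ) (Φ : C ≃⋆ₐ[ℂ] D) :
    SequentiallySplit ((Φ : C →⋆ₙₐ[ℂ] D).comp φ) := by
  obtain ⟨T, hT⟩ := h
  refine ⟨T.comp (Φ.symm : D →⋆ₙₐ[ℂ] C), ?_⟩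
  rw [← hT]
  refine NonUnitalStarAlgHom.ext fun x => ?_
  exact congrArg T (Φ.symm_apply_apply _)

namespace CStarAction

variable {G : Type*} [Group G] [TopologicalSpace G] [IsTopologicalGroup G] [CompactSpace G]
  [SecondCountableTopology G] [MeasurableSpace G] [BorelSpace G] [T2Space G]
  {A : Type*} [NonUnitalCStarAlgebra A] (α : CStarAction G A)
  (μ : Measure G) [μ.IsHaarMeasure] [IsProbabilityMeasure μ]

/-- Of `L²(G)` only two facts enter: the continuous functions are dense in it and their inner
product is the integral. Any Hilbert space `H` with such a map `Λ` serves. -/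
theorem exists_equiv_rankOne {H : Type*} [NormedAddCommGroup H] [InnerProductSpace ℂ H]
    [CompleteSpace H] (Λ : C(G, ℂ) →ₗ[ℂ] H) (hd : DenseRange Λ)
    (hΛ : ∀ f g, inner ℂ (Λ f) (Λ g) = funInner μ f g) :
    ∃ Φ : α.shiftTensor.CrossedProduct μ ≃⋆ₐ[ℂ] CStarTensor A (compacts H), ∀ a ξ η,
      Φ (α.shiftTensor.toCrossedProduct μ (α.kernelElement μ a ξ η)) =
        elemTensor a (rankOneCompact (Λ ξ) (Λ η)) := by
  obtain ⟨Φ, hΦ⟩ := α.exists_equiv_cstarTensor (compactModel_tensorToCompact μ hd hΛ)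
  refine ⟨Φ, fun a ξ η => ?_⟩
  have h := hΦ ((ξ ⊗ₜ star η) ⊗ₜ a)
  rw [tensorToElem_tmul, tensorToCompact_tmul, funToCrossedProduct_apply,
    ofFun_tensorToConv_tmul, star_star] at h
  exact h

variable {α μ} in
/-- The kernel functions generate the crossed product. -/
theorem kernel_hom_ext {D : Type*} [NonUnitalCStarAlgebra D]
    {T T' : α.shiftTensor.CrossedProduct μ →⋆ₙₐ[ℂ] D}
    (h : ∀ a ξ η, T (α.shiftTensor.toCrossedProduct μ (α.kernelElement μ a ξ η)) =
      T' (α.shiftTensor.toCrossedProduct μ (α.kernelElement μ a ξ η))) : T = T' := by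
  refine crossedProduct_hom_ext (α.tensorToConv G) α.denseRange_tensorToConv fun e => ?_
  induction e using tensor_induction with
  | hadd x y hx hy => rw [map_add, map_add, map_add, map_add, hx, hy]
  | htmul f g a =>
    rw [funToCrossedProduct_apply, ofFun_tensorToConv_tmul]
    exact h a f (star g)

theorem equiv_unique {D : Type*} [NonUnitalCStarAlgebra D]
    {Φ Φ' : α.shiftTensor.CrossedProduct μ ≃⋆ₐ[ℂ] D}
    (h : ∀ a ξ η, Φ (α.shiftTensor.toCrossedProduct μ (α.kernelElement μ a ξ η)) =
      Φ' (α.shiftTensor.toCrossedProduct μ (α.kernelElement μ a ξ η))) : Φ = Φ' := by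
  have e := kernel_hom_ext (T := (Φ : α.shiftTensor.CrossedProduct μ →⋆ₙₐ[ℂ] D))
    (T' := (Φ' : α.shiftTensor.CrossedProduct μ →⋆ₙₐ[ℂ] D)) h
  exact StarAlgEquiv.ext fun x => DFunLike.congr_fun e x

end CStarAction

/-! ### The canonical isomorphism onto `A ⊗ K(L²(G))` and the two sequential splittings -/

namespace CStarAction

variable {G : Type*} [Group G] [TopologicalSpace G] [IsTopologicalGroup G] [CompactSpace G]
  [SecondCountableTopology G] [MeasurableSpace G] [BorelSpace G] [T2Space G]
  {A : Type*} [NonUnitalCStarAlgebra A] (α : CStarAction G A)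
  (μ : Measure G) [μ.IsHaarMeasure] [IsProbabilityMeasure μ]

theorem exists_isCanonicalIso : ∃ Φ, α.IsCanonicalIso μ Φ :=
  α.exists_equiv_rankOne μ (H := Lp ℂ 2 μ)
    (ContinuousMap.toLp 2 μ ℂ : C(G, ℂ) →L[ℂ] Lp ℂ 2 μ)
    (ContinuousMap.toLp_denseRange ℂ μ ℂ (by norm_num)) fun _ _ => rfl

theorem existsUnique_isCanonicalIso : ∃! Φ, α.IsCanonicalIso μ Φ :=
  existsUnique_of_exists_of_unique (α.exists_isCanonicalIso μ) fun _ _ h h' =>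
    α.equiv_unique μ fun a ξ η => (h a ξ η).trans (h' a ξ η).symm

variable {α} in
theorem RokhlinProperty.sequentiallySplit_secondFactor
    [TopologicalSpace.SeparableSpace A] (hα : α.RokhlinProperty) :
    SequentiallySplit
      (crossedProductMap μ (secondFactor G A) α.secondFactor_equivariant) := by
  have h := RokhlinProperty.exists_hom α hα
  obtain ⟨ψ, h1, h2⟩ := h
  have key := exists_crossedProduct_split (α := α) (β := α.shiftTensor) (ψ := ψ)
    (φ := secondFactor G A) μ α.secondFactor_equivariant ?_ ?_
  · exact key
  · exact h2
  · exact h1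

variable {α} in
theorem RokhlinProperty.sequentiallySplit_fixedPointsInclusion
    [TopologicalSpace.SeparableSpace A] (hα : α.RokhlinProperty)
    (ν : Measure G) [ν.IsHaarMeasure] [IsProbabilityMeasure ν] :
    SequentiallySplit α.fixedPointsInclusion := by
  have h := RokhlinProperty.exists_hom α hα
  obtain ⟨ψ, h1, h2⟩ := h
  have key := α.sequentiallySplit_fixedPointsInclusion ν (ψ := ψ) ?_ ?_
  · exact key
  · exact h1
  · exact h2

end CStarAction

end RokhlinSplit

end


theorem theorem4p8 {G A : Type*} [Group G] [TopologicalSpace G] [IsTopologicalGroup G]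
    [CompactSpace G] [T2Space G] [SecondCountableTopology G] [MeasurableSpace G] [BorelSpace G]
    [NonUnitalCStarAlgebra A] [TopologicalSpace.SeparableSpace A]
    (μ : MeasureTheory.Measure G) [μ.IsHaarMeasure] [MeasureTheory.IsProbabilityMeasure μ]
    (α : RokhlinSplit.CStarAction G A) (hα : α.RokhlinProperty) :
    RokhlinSplit.SequentiallySplit α.fixedPointsInclusion ∧
      (∃! Φ, α.IsCanonicalIso μ Φ) ∧
      ∀ Φ, α.IsCanonicalIso μ Φ →
        RokhlinSplit.SequentiallySplit (α.crossedProductEmbedding μ Φ) := by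
  exact ⟨hα.sequentiallySplit_fixedPointsInclusion μ, α.existsUnique_isCanonicalIso μ,
    fun Φ _ => (hα.sequentiallySplit_secondFactor μ).equiv_comp Φ⟩
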